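/- Let $(H_0,H_1)$ be a Hilbert space pair, i.e. $H_0,H_1$ are infinite dimensional real Hilbert spaces with $H_1\subset H_0$ dense and compact inclusion $\iota\colon H_1\to H_0$. A *Hessian* is a bounded linear Fredholm operator $A\colon H_1\to H_0$ of index zero which is symmetrizable, i.e. $\langle Ax,y\rangle'=\langle x,Ay\rangle'$ for all $x,y\in H_1$ and some inner product $\langle\cdot,\cdot\rangle'$ on $H_0$ equivalent to the given one. Put $\operatorname{spec}A=\{a\in\mathbb R: A-a\iota \text{ is not bijective}\}$ and $\mathcal R(A)=\mathbb R\setminus\operatorname{spec}A$ (the set of non-eigenvalues). Let $G\colon H_1\to H_1$ be the growth operator, $\langle x,y\rangle_0=\langle x,Gy\rangle_1$; for $\kappa>0$ and $x\in H_0$ let $x_\kappa$ be the $H_0$-orthogonal projection of $x$ to $\ker(G-\kappa)\subset H_1\subset H_0$, and let $H_{1/2}=\{x\in H_0:\|x\|_{1/2}^2:=\sum_{\kappa}\kappa^{-1/2}\|x_\kappa\|_0^2<\infty\}$. For $r\in\mathcal R(A)$ let $H^{+}_{1/2}(A-r\iota)$ and $H^{-}_{1/2}(A-r\iota)$ be the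 closed linear spans in $H_{1/2}$ of the eigenvectors of $A-r\iota$ to positive, respectively negative, eigenvalues, and let $\pi_{\pm}^{A-r\iota}$ be the projection of $H_{1/2}=H^+_{1/2}(A-r\iota)\oplus H^-_{1/2}(A-r\iota)$ onto $H^\pm_{1/2}(A-r\iota)$ along the other summand. For non-eigenvalues $l\le m$ of $A$ let $\rho_A(l,m)=\sum_{a\in\operatorname{spec}A\cap(l,m)}\dim\ker(A-a\iota)$ be the number of eigenvalues in $(l,m)$ counted with multiplicity, and $\rho_A(m,l)=-\rho_A(l,m)$. Let $T>0$, let $P_0=L^2([-T,T],H_0)$ and $P_1=L^2([-T,T],H_1)\cap W^{1,2}([-T,T],H_0)$, and let $A\colon[-T,T]\to\mathcal L(H_1,H_0)$ be norm continuous with every $A(s)$ a Hessian. For $\lambda=(\lambda_{-T},\lambda_T)$ with $\lambda_{\pm T}\in\mathcal R(A(\pm T))$ consider the shifted augmented operator $$\mathfrak D_A^\lambda\colon P_1\to P_0\times H^+_{1/2}\bigl(A(-T)-\lambda_{-T}\iota\bigr)\times H^-_{1/2}\bigl(A(T)-\lambda_T\iota\bigr),$$ $$\mathfrak D_A^\lambda\xi=\Bigl(\partial_s\xi+A\xi,\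 \pi_+^{A(-T)-\lambda_{-T}\iota}\,\xi(-T),\ \pi_-^{A(T)-\lambda_T\iota}\,\xi(T)\Bigr).$$ Let $\lambda_{\pm T},\mu_{\pm T}\in\mathcal R(A(\pm T))$, $\lambda=(\lambda_{-T},\lambda_T)$ and $\mu=(\mu_{-T},\mu_T)$. Then, for every $r\in\mathcal R(A(\pm T))$, $H_{1/2}$ is the topological direct sum of $H^+_{1/2}(A(\pm T)-r\iota)$ and $H^-_{1/2}(A(\pm T)-r\iota)$, so that the projections above are well defined; the operators $\mathfrak D_A^\lambda$ and $\mathfrak D_A^\mu$ are bounded Fredholm operators; and $$\operatorname{index}\mathfrak D_A^\mu-\operatorname{index}\mathfrak D_A^\lambda=\rho_{A(-T)}(\lambda_{-T},\mu_{-T})-\rho_{A(T)}(\lambda_T,\mu_T).$$ -/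

import Mathlib

open MeasureTheory Set
open scoped ContDiff ENNReal
noncomputable section

/-- Smooth real valued test functions with compact support in `(-T, T)`. -/
structure IsTestFunction (T : ℝ) (φ : ℝ → ℝ) : Prop where
  contDiff : ContDiff ℝ ∞ φ
  hasCompactSupport : HasCompactSupport φ
  tsupport_subset : tsupport φ ⊆ Ioo (-T) T

/-- `v` is the weak derivative of `w` on `(-T, T)`. -/
def IsWeakDeriv {E : Type*} [NormedAddCommGroup E] [NormedSpace ℝ E] (T : ℝ)
    (w v : ℝ → E) : Prop :=
  ∀ φ : ℝ → ℝ, IsTestFunction T φ →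
    ∫ s in Icc (-T) T, deriv φ s • w s = -∫ s in Icc (-T) T, φ s • v s

section Sobolev

variable {E : Type*} [NormedAddCommGroup E] [NormedSpace ℝ E]

theorem IsTestFunction.eq_zero {T : ℝ} {φ : ℝ → ℝ} (hφ : IsTestFunction T φ) {t : ℝ}
    (ht : t ∉ Ioo (-T) T) : φ t = 0 :=
  image_eq_zero_of_notMem_tsupport fun h => ht (hφ.tsupport_subset h)

theorem IsTestFunction.integrableOn_smul {T : ℝ} {φ : ℝ → ℝ} (hφ : Continuous φ)
    {w : ℝ → E} (hw : IntegrableOn w (Icc (-T) T)) :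
    IntegrableOn (fun s => φ s • w s) (Icc (-T) T) :=
  hw.continuousOn_smul hφ.continuousOn isCompact_Icc

theorem continuousOn_primitive_Icc {T : ℝ} (hT : 0 < T) {v : ℝ → E}
    (hv : IntegrableOn v (Icc (-T) T)) :
    ContinuousOn (fun t => ∫ s in (-T)..t, v s) (Icc (-T) T) := by
  rw [← uIcc_of_le (show -T ≤ T by linarith)] at hv ⊢
  exact intervalIntegral.continuousOn_primitive_interval hv

/-- Integration by parts for a primitive. -/
theorem isWeakDeriv_primitive [CompleteSpace E] {T : ℝ} (hT : 0 < T) {v : ℝ → E}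
    (hv : IntegrableOn v (Icc (-T) T)) (c : E) :
    IsWeakDeriv T (fun t => c + ∫ s in (-T)..t, v s) v := by
  intro φ hφ
  have hd : Continuous (deriv φ) := hφ.contDiff.continuous_deriv (by simp)
  have hFTC : ∀ r ∈ Icc (-T) T, ∫ s in r..T, deriv φ s = -φ r := fun r hr => by
    rw [intervalIntegral.integral_deriv_of_contDiffOn_Icc
      ((hφ.contDiff.of_le (by exact_mod_cast le_top)).contDiffOn) hr.2,
      hφ.eq_zero (t := T) (by simp), zero_sub]
  set μ := volume.restrict (Icc (-T) T) with hμ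
  have hind : ∀ s ∈ Icc (-T) T, ∫ r in (-T)..s, v r = ∫ r, (Iic s).indicator v r ∂μ :=
    fun s hs => by
      rw [intervalIntegral.integral_of_le hs.1, ← integral_Icc_eq_integral_Ioc,
        integral_indicator measurableSet_Iic, hμ, Measure.restrict_restrict measurableSet_Iic]
      congr 2
      ext x; simp only [mem_Icc, mem_inter_iff, mem_Iic]
      exact ⟨fun h => ⟨h.2, h.1, h.2.trans hs.2⟩, fun h => ⟨h.2.1, h.1⟩⟩
  have hdi : Integrable (deriv φ) μ := hd.continuousOn.integrableOn_Icc
  have hint : Integrable (fun p : ℝ × ℝ => {q : ℝ × ℝ | q.2 ≤ q.1}.indicator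
      (fun q => deriv φ q.1 • v q.2) p) (μ.prod μ) :=
    (hdi.smul_prod hv).indicator (measurableSet_le measurable_snd measurable_fst)
  have hcomm : ∫ s, deriv φ s • (∫ r in (-T)..s, v r) ∂μ = -∫ r, φ r • v r ∂μ := by
    calc ∫ s, deriv φ s • (∫ r in (-T)..s, v r) ∂μ
        = ∫ s, ∫ r, {q : ℝ × ℝ | q.2 ≤ q.1}.indicator
            (fun q => deriv φ q.1 • v q.2) (s, r) ∂μ ∂μ := by
          refine setIntegral_congr_fun measurableSet_Icc fun s hs => ?_
          rw [hind s hs, ← integral_smul]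
          refine integral_congr_ae (.of_forall fun r => ?_)
          by_cases h : r ≤ s <;> simp [indicator, h]
      _ = ∫ r, ∫ s, {q : ℝ × ℝ | q.2 ≤ q.1}.indicator
            (fun q => deriv φ q.1 • v q.2) (s, r) ∂μ ∂μ := integral_integral_swap hint
      _ = ∫ r, -(φ r • v r) ∂μ := by
          refine setIntegral_congr_fun measurableSet_Icc fun r hr => ?_
          rw [← neg_smul, ← hFTC r hr, intervalIntegral.integral_of_le hr.2,
            ← integral_Icc_eq_integral_Ioc, ← integral_smul_const]
          rw [← integral_indicator measurableSet_Icc, ← integral_indicator measurableSet_Icc]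
          congr 1
          funext s
          by_cases h1 : r ≤ s <;> by_cases h2 : s ≤ T <;>
            simp [indicator, h1, h2]
          intro h3; linarith [hr.1]
      _ = _ := integral_neg _
  have hprim : IntegrableOn (fun t => ∫ s in (-T)..t, v s) (Icc (-T) T) :=
    (continuousOn_primitive_Icc hT hv).integrableOn_Icc
  have h0 : ∫ s, deriv φ s ∂μ = 0 := by
    rw [hμ, integral_Icc_eq_integral_Ioc, ← intervalIntegral.integral_of_le (by linarith),
      hFTC (-T) ⟨le_rfl, by linarith⟩, hφ.eq_zero (by simp), neg_zero]
  change ∫ s, deriv φ s • (c + ∫ r in (-T)..s, v r) ∂μ = _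
  simp only [smul_add]
  rw [integral_add (hdi.smul_const c) (IsTestFunction.integrableOn_smul hd hprim),
    integral_smul_const, h0, zero_smul, zero_add, hcomm]

/-- A function with vanishing weak derivative is almost everywhere constant. -/
theorem ae_eq_const_of_isWeakDeriv_zero [CompleteSpace E] {T : ℝ} (hT : 0 < T) {w : ℝ → E}
    (hw : IntegrableOn w (Icc (-T) T))
    (h : ∀ φ : ℝ → ℝ, IsTestFunction T φ → ∫ s in Icc (-T) T, deriv φ s • w s = 0) :
    ∃ c : E, ∀ᵐ s ∂volume.restrict (Icc (-T) T), w s = c := by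
  let ψ : ContDiffBump (0 : ℝ) := ⟨T / 3, T / 2, by linarith, by linarith⟩
  set p : ℝ → ℝ := ψ.normed volume with hp
  have hpc : ContDiff ℝ ∞ p := ψ.contDiff_normed
  have hps : tsupport p ⊆ Ioo (-T) T := by
    rw [hp, ψ.tsupport_normed_eq, Real.closedBall_eq_Icc]
    intro x hx
    change x ∈ Icc (0 - T / 2) (0 + T / 2) at hx
    exact ⟨by linarith [hx.1], by linarith [hx.2]⟩
  have hp1 : ∫ x, p x = 1 := ψ.integral_normed
  set c := ∫ s in Icc (-T) T, p s • w s with hc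
  refine ⟨c, ?_⟩
  have key : ∀ g : ℝ → ℝ, ContDiff ℝ ∞ g → HasCompactSupport g → tsupport g ⊆ Ioo (-T) T →
      ∫ x, g x • (w x - c) = 0 := by
    intro g hg hgc hgs
    set k : ℝ → ℝ := fun x => g x - (∫ y, g y) * p x with hk
    have hkc : ContDiff ℝ ∞ k := hg.sub (contDiff_const.mul hpc)
    have hgi : Integrable g := hg.continuous.integrable_of_hasCompactSupport hgc
    have hpi : Integrable p := hpc.continuous.integrable_of_hasCompactSupport
      ψ.hasCompactSupport_normed
    have hk0 : ∫ x, k x = 0 := by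
      rw [hk, integral_sub hgi (hpi.const_mul _), integral_const_mul, hp1, mul_one, sub_self]
    have hki : Integrable k := hgi.sub (hpi.const_mul _)
    obtain ⟨a, b, ha, hb, hab⟩ : ∃ a b : ℝ, -T < a ∧ b < T ∧ ∀ x, x ∉ Icc a b → k x = 0 := by
      set K := insert (0 : ℝ) (tsupport g ∪ tsupport p) with hK
      have hKc : IsCompact K := (hgc.isCompact.union ψ.hasCompactSupport_normed.isCompact).insert 0
      have hKs : K ⊆ Ioo (-T) T := by
        intro x hx
        rcases hx with rfl | hx | hx
        · exact ⟨by linarith, hT⟩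
        · exact hgs hx
        · exact hps hx
      obtain ⟨a, ha⟩ := hKc.exists_isLeast ⟨0, mem_insert _ _⟩
      obtain ⟨b, hb⟩ := hKc.exists_isGreatest ⟨0, mem_insert _ _⟩
      refine ⟨a, b, (hKs ha.1).1, (hKs hb.1).2, fun x hx => ?_⟩
      have hxK : x ∉ K := fun hxK => hx ⟨ha.2 hxK, hb.2 hxK⟩
      have h1 : g x = 0 := image_eq_zero_of_notMem_tsupport fun h' => hxK (.inr (.inl h'))
      have h2 : p x = 0 := image_eq_zero_of_notMem_tsupport fun h' => hxK (.inr (.inr h'))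
      simp [hk, h1, h2]
    set φ : ℝ → ℝ := fun t => ∫ s in (-T)..t, k s with hφ
    have hderiv : ∀ t, HasDerivAt φ (k t) t := fun t =>
      intervalIntegral.integral_hasDerivAt_right (hkc.continuous.intervalIntegrable _ _)
        (hkc.continuous.stronglyMeasurableAtFilter _ _) hkc.continuous.continuousAt
    have hdφ : deriv φ = k := funext fun t => (hderiv t).deriv
    have hφc : ContDiff ℝ ∞ φ :=
      contDiff_infty_iff_deriv.2 ⟨fun t => (hderiv t).differentiableAt, hdφ ▸ hkc⟩
    have hφ0 : ∀ x, x ∉ Icc a b → φ x = 0 := by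
      intro x hx
      rw [mem_Icc, not_and_or, not_le, not_le] at hx
      rcases hx with hx | hx
      · refine intervalIntegral.integral_zero_ae (.of_forall fun s hs => hab s fun hs' => ?_)
        have : s ≤ max (-T) x := hs.2
        have : max (-T) x < a := max_lt ha hx
        linarith [hs'.1]
      · have h1 : ∫ s in (-T)..x, k s = ∫ s, k s := by
          rcases le_or_gt (-T) x with hTx | hTx
          · rw [intervalIntegral.integral_of_le hTx]
            refine setIntegral_eq_integral_of_forall_compl_eq_zero fun s hs => hab s fun hs' => ?_
            exact hs ⟨by linarith [hs'.1], by linarith [hs'.2]⟩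
          · have hz : ∀ s, k s = 0 := fun s => hab s fun hs' => by
              linarith [hs'.1, hs'.2]
            simp [hz]
        rw [hφ]; simp only; rw [h1, hk0]
    have hts : tsupport φ ⊆ Icc a b :=
      closure_minimal (fun x hx => by_contra fun hx' => hx (hφ0 x hx')) isClosed_Icc
    have htest : IsTestFunction T φ :=
      ⟨hφc, HasCompactSupport.intro isCompact_Icc hφ0,
        hts.trans fun x hx => ⟨by linarith [hx.1], by linarith [hx.2]⟩⟩
    have h1 := h φ htest
    rw [hdφ] at h1
    simp only [hk, sub_smul, mul_smul] at h1
    rw [integral_sub (IsTestFunction.integrableOn_smul hg.continuous hw)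
      (Integrable.fun_smul (∫ y, g y) (IsTestFunction.integrableOn_smul hpc.continuous hw)),
      integral_smul, ← hc] at h1
    have hgz : ∀ x, x ∉ Icc (-T) T → g x = 0 := fun x hx =>
      image_eq_zero_of_notMem_tsupport fun h' => hx (Ioo_subset_Icc_self (hgs h'))
    rw [← setIntegral_eq_integral_of_forall_compl_eq_zero (s := Icc (-T) T)
      (fun x hx => by rw [hgz x hx, zero_smul])]
    simp only [smul_sub]
    rw [integral_sub (IsTestFunction.integrableOn_smul hg.continuous hw)
      (hgi.integrableOn.smul_const c), integral_smul_const,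
      setIntegral_eq_integral_of_forall_compl_eq_zero hgz, h1]
  have hloc : LocallyIntegrableOn (fun x => w x - c) (Ioo (-T) T) volume := by
    refine IntegrableOn.locallyIntegrableOn ?_
    exact (hw.mono_set Ioo_subset_Icc_self).sub
      (integrableOn_const (by simp))
  have := isOpen_Ioo.ae_eq_zero_of_integral_contDiff_smul_eq_zero hloc key
  rw [Measure.restrict_congr_set Ioo_ae_eq_Icc.symm, ae_restrict_iff' measurableSet_Ioo]
  filter_upwards [this] with x hx hxI using sub_eq_zero.1 (hx hxI)

/-- A function with an integrable weak derivative agrees almost everywhere with a primitive. -/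
theorem IsWeakDeriv.exists_primitive [CompleteSpace E] {T : ℝ} (hT : 0 < T) {w v : ℝ → E}
    (hw : IntegrableOn w (Icc (-T) T)) (hv : IntegrableOn v (Icc (-T) T))
    (h : IsWeakDeriv T w v) :
    ∃ c : E, ∀ᵐ s ∂volume.restrict (Icc (-T) T), w s = c + ∫ r in (-T)..s, v r := by
  have hprim : IntegrableOn (fun t => (0 : E) + ∫ s in (-T)..t, v s) (Icc (-T) T) := by
    simp only [zero_add]
    exact (continuousOn_primitive_Icc hT hv).integrableOn_Icc
  obtain ⟨c, hc⟩ := ae_eq_const_of_isWeakDeriv_zero hT (hw.sub hprim) fun φ hφ => by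
    have hd : Continuous (deriv φ) := hφ.contDiff.continuous_deriv (by simp)
    simp only [Pi.sub_apply, smul_sub]
    rw [integral_sub (IsTestFunction.integrableOn_smul hd hw)
      (IsTestFunction.integrableOn_smul hd hprim), h φ hφ,
      isWeakDeriv_primitive hT hv 0 φ hφ, sub_self]
  refine ⟨c, ?_⟩
  filter_upwards [hc] with s hs
  rw [← hs]; simp

/-- Pointwise bound for a primitive on an interval of length `b - a`. -/
theorem sq_norm_le_of_primitive {x v : ℝ → E} {a b t : ℝ} (hab : a < b) (ht : t ∈ Icc a b)
    (hv : IntegrableOn v (Icc a b)) (hv2 : IntegrableOn (fun s => ‖v s‖ ^ 2) (Icc a b))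
    (hx2 : IntegrableOn (fun s => ‖x s‖ ^ 2) (Icc a b))
    (hx : ∀ s ∈ Icc a b, x t - x s = ∫ r in s..t, v r) :
    (b - a) * ‖x t‖ ^ 2 ≤ 2 * (∫ s in Icc a b, ‖x s‖ ^ 2)
      + 2 * (b - a) ^ 2 * (∫ s in Icc a b, ‖v s‖ ^ 2) := by
  set M := ∫ s in Icc a b, ‖v s‖ with hM
  set Q := ∫ s in Icc a b, ‖v s‖ ^ 2 with hQ
  set δ := b - a with hδ
  have hδ0 : 0 < δ := sub_pos.2 hab
  have hconst : ∀ k : ℝ, ∫ _ in Icc a b, k = δ * k := fun k => by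
    rw [setIntegral_const, Real.volume_real_Icc_of_le hab.le, smul_eq_mul]
  have hCS : M ^ 2 ≤ δ * Q := by
    have h1 : 0 ≤ ∫ s in Icc a b, (‖v s‖ ^ 2 - 2 * (M / δ) * ‖v s‖ + (M / δ) ^ 2) :=
      integral_nonneg fun s => by
        change 0 ≤ ‖v s‖ ^ 2 - 2 * (M / δ) * ‖v s‖ + (M / δ) ^ 2
        nlinarith [sq_nonneg (‖v s‖ - M / δ)]
    have hi : IntegrableOn (fun s => 2 * (M / δ) * ‖v s‖) (Icc a b) := hv.norm.const_mul _
    have hi' : IntegrableOn (fun s => ‖v s‖ ^ 2 - 2 * (M / δ) * ‖v s‖) (Icc a b) := hv2.sub hi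
    rw [integral_add hi' (integrableOn_const (by simp)), integral_sub hv2 hi,
      integral_const_mul, hconst, ← hM, ← hQ] at h1
    have h2 : Q - 2 * (M / δ) * M + δ * (M / δ) ^ 2 = Q - M ^ 2 / δ := by field_simp; ring
    rw [h2, sub_nonneg, div_le_iff₀ hδ0] at h1
    linarith
  have hpt : ∀ s ∈ Icc a b, ‖x t‖ ^ 2 ≤ 2 * ‖x s‖ ^ 2 + 2 * M ^ 2 := by
    intro s hs
    have h1 : ‖∫ r in s..t, v r‖ ≤ M := by
      refine (intervalIntegral.norm_integral_le_integral_norm_uIoc).trans ?_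
      refine setIntegral_mono_set hv.norm (.of_forall fun _ => norm_nonneg _) ?_
      exact (uIoc_subset_uIcc.trans (uIcc_subset_Icc hs ht)).eventuallyLE
    have h2 : ‖x t‖ ≤ ‖x s‖ + M := by
      have : x t = x s + ∫ r in s..t, v r := by rw [← hx s hs]; abel
      rw [this]
      exact (norm_add_le _ _).trans (by linarith)
    nlinarith [norm_nonneg (x t), norm_nonneg (x s), sq_nonneg (‖x s‖ - M)]
  have h3 : ∫ _ in Icc a b, ‖x t‖ ^ 2 ≤ ∫ s in Icc a b, (2 * ‖x s‖ ^ 2 + 2 * M ^ 2) :=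
    setIntegral_mono_on (integrableOn_const (by simp))
      ((hx2.const_mul 2).add (integrableOn_const (by simp))) measurableSet_Icc hpt
  rw [hconst, integral_add (hx2.const_mul 2) (integrableOn_const (by simp)), integral_const_mul,
    hconst] at h3
  nlinarith

end Sobolev
/-- A Hilbert space pair `(H₀, H₁)`: two infinite dimensional real Hilbert spaces together with
an inclusion `ι : H₁ → H₀` that is compact and has dense image. -/
structure HilbertPair (H₀ H₁ : Type*) [NormedAddCommGroup H₀] [InnerProductSpace ℝ H₀]
    [CompleteSpace H₀] [NormedAddCommGroup H₁] [InnerProductSpace ℝ H₁] [CompleteSpace H₁] where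
  incl : H₁ →L[ℝ] H₀
  incl_injective : Function.Injective incl
  incl_denseRange : DenseRange incl
  incl_compact : IsCompactOperator incl
  infinite₀ : ¬ FiniteDimensional ℝ H₀
  infinite₁ : ¬ FiniteDimensional ℝ H₁

/-- The Fredholm index `dim ker u - dim coker u`. -/
def fredholmIndex {E F : Type*} [NormedAddCommGroup E] [NormedSpace ℝ E]
    [NormedAddCommGroup F] [NormedSpace ℝ F] (u : E →L[ℝ] F) : ℤ :=
  (Module.finrank ℝ (LinearMap.ker u.toLinearMap) : ℤ) -
    (Module.finrank ℝ (F ⧸ LinearMap.range u.toLinearMap) : ℤ)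

namespace HilbertPair

variable {H₀ H₁ : Type*} [NormedAddCommGroup H₀] [InnerProductSpace ℝ H₀] [CompleteSpace H₀]
  [NormedAddCommGroup H₁] [InnerProductSpace ℝ H₁] [CompleteSpace H₁] (P : HilbertPair H₀ H₁)

/-! ### Hessians, spectrum, spectral content -/

/-- `A : H₁ → H₀` is symmetrizable: it is symmetric with respect to some inner product `B` on
`H₀` whose norm `√(B x x)` is equivalent to the given norm. -/
def IsSymmetrizable (A : H₁ →L[ℝ] H₀) : Prop :=
  ∃ B : LinearMap.BilinForm ℝ H₀, (∀ x y, B x y = B y x) ∧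
    (∃ c : ℝ, 0 < c ∧ ∀ x, c⁻¹ * ‖x‖ ≤ √(B x x) ∧ √(B x x) ≤ c * ‖x‖) ∧
    ∀ x y : H₁, B (A x) (P.incl y) = B (P.incl x) (A y)

/-- A Hessian: a symmetrizable Fredholm operator of index zero. -/
structure IsHessian (A : H₁ →L[ℝ] H₀) : Prop where
  symmetrizable : P.IsSymmetrizable A
  fredholm : A.IsFredholm
  index_zero : fredholmIndex A = 0

/-- A continuous path of Hessians on `[-T, T]` (the values of `A` elsewhere are irrelevant). -/
structure IsHessianPath (T : ℝ) (A : ℝ → H₁ →L[ℝ] H₀) : Prop where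
  continuousOn : ContinuousOn A (Icc (-T) T)
  isHessian : ∀ s ∈ Icc (-T) T, P.IsHessian (A s)

/-- The shifted operator `A - l ι`. -/
def shift (A : H₁ →L[ℝ] H₀) (l : ℝ) : H₁ →L[ℝ] H₀ := A - l • P.incl

/-- The spectrum of `A`: all real `a` such that `A - a ι` is not bijective. -/
def spec (A : H₁ →L[ℝ] H₀) : Set ℝ := {a | ¬ Function.Bijective (P.shift A a)}

/-- The resolvent set of `A`. For a Hessian these are exactly the non-eigenvalues. -/
def resolventSet (A : H₁ →L[ℝ] H₀) : Set ℝ := (P.spec A)ᶜ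

/-- The number of eigenvalues of `A` in the open interval `(l, m)`, with multiplicities. -/
def eigenvalueCount (A : H₁ →L[ℝ] H₀) (l m : ℝ) : ℕ :=
  ∑ᶠ a ∈ P.spec A ∩ Ioo l m, Module.finrank ℝ (LinearMap.ker (P.shift A a).toLinearMap)

open Classical in
/-- The spectral content `ρ_A(l, m)`, antisymmetric in `l` and `m`. -/
def spectralContent (A : H₁ →L[ℝ] H₀) (l m : ℝ) : ℤ :=
  if l ≤ m then (P.eigenvalueCount A l m : ℤ) else -(P.eigenvalueCount A m l : ℤ)

/-! ### The interpolation space `H_{1/2}` -/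

/-- The growth operator `G : H₁ → H₁` of the pair, characterized by `⟪x, y⟫₀ = ⟪x, G y⟫₁`. -/
def growthOp : H₁ →L[ℝ] H₁ := (ContinuousLinearMap.adjoint P.incl) ∘L P.incl

theorem inner_growthOp (x y : H₁) :
    inner ℝ (P.incl x) (P.incl y) = inner ℝ x (P.growthOp y) := by
  rw [growthOp, ContinuousLinearMap.comp_apply, ContinuousLinearMap.adjoint_inner_right]

theorem growthOp_compact : IsCompactOperator P.growthOp :=
  P.incl_compact.clm_comp (ContinuousLinearMap.adjoint P.incl)

/-- The eigenspace of the growth operator for the eigenvalue `κ`, regarded as a subspace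
of `H₀`. -/
def growthEigenspace (κ : ℝ) : Submodule ℝ H₀ :=
  (Module.End.eigenspace P.growthOp.toLinearMap κ).map P.incl.toLinearMap

instance (κ : Ioi (0 : ℝ)) : FiniteDimensional ℝ (P.growthEigenspace κ) := by
  have := ContinuousLinearMap.finite_dimensional_eigenspace P.growthOp_compact (κ : ℝ)
    (ne_of_gt κ.2)
  unfold growthEigenspace
  infer_instance

/-- The component `x_κ` of `x ∈ H₀`: the `H₀`-orthogonal projection onto the eigenspace of the
growth operator for `κ > 0`. -/
def comp (κ : Ioi (0 : ℝ)) : H₀ →L[ℝ] H₀ := (P.growthEigenspace κ).starProjection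

theorem mem_growthEigenspace {κ : ℝ} {x : H₀} (hx : x ∈ P.growthEigenspace κ) :
    P.incl (ContinuousLinearMap.adjoint P.incl x) = κ • x := by
  obtain ⟨v, hv, rfl⟩ := hx
  have := Module.End.mem_eigenspace_iff.1 hv
  change P.incl (P.growthOp v) = κ • P.incl v
  rw [← map_smul]
  exact congrArg _ this

theorem comp_mem (κ : Ioi (0 : ℝ)) (x : H₀) : P.comp κ x ∈ P.growthEigenspace κ :=
  Submodule.starProjection_apply_mem _ _

theorem incl_adjoint_comp (κ : Ioi (0 : ℝ)) (x : H₀) :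
    P.incl (ContinuousLinearMap.adjoint P.incl (P.comp κ x)) = (κ : ℝ) • P.comp κ x :=
  P.mem_growthEigenspace (P.comp_mem κ x)

theorem inner_comp_self (κ : Ioi (0 : ℝ)) (x : H₀) :
    inner ℝ (P.comp κ x) x = ‖P.comp κ x‖ ^ 2 := by
  have h := Submodule.starProjection_inner_eq_zero (K := P.growthEigenspace κ) x _
    (P.comp_mem κ x)
  change inner ℝ (x - P.comp κ x) (P.comp κ x) = 0 at h
  rw [inner_sub_left, real_inner_self_eq_norm_sq, real_inner_comm] at h
  linarith

theorem inner_comp_of_ne {κ κ' : Ioi (0 : ℝ)} (h : κ ≠ κ') (x y : H₀) :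
    inner ℝ (P.comp κ x) (P.comp κ' y) = 0 := by
  have h1 : inner ℝ (P.incl (ContinuousLinearMap.adjoint P.incl (P.comp κ x))) (P.comp κ' y)
      = inner ℝ (P.comp κ x) (P.incl (ContinuousLinearMap.adjoint P.incl (P.comp κ' y))) := by
    rw [← ContinuousLinearMap.adjoint_inner_left P.incl,
      ContinuousLinearMap.adjoint_inner_right P.incl,
      ← ContinuousLinearMap.adjoint_inner_right P.incl,
      ContinuousLinearMap.adjoint_inner_left P.incl]
  rw [incl_adjoint_comp, incl_adjoint_comp, real_inner_smul_left, real_inner_smul_right] at h1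
  have h2 : ((κ : ℝ) - κ') * inner ℝ (P.comp κ x) (P.comp κ' y) = 0 := by linarith
  rcases mul_eq_zero.1 h2 with h3 | h3
  · exact absurd (Subtype.ext (sub_eq_zero.1 h3)) h
  · exact h3

theorem inner_sum_comp (F : Finset (Ioi (0 : ℝ))) (c d : Ioi (0 : ℝ) → ℝ) (x : H₀) :
    inner ℝ (∑ κ ∈ F, c κ • P.comp κ x) (∑ κ ∈ F, d κ • P.comp κ x)
      = ∑ κ ∈ F, c κ * d κ * ‖P.comp κ x‖ ^ 2 := by
  rw [sum_inner]
  refine Finset.sum_congr rfl fun κ hκ => ?_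
  rw [inner_sum, Finset.sum_eq_single κ]
  · rw [real_inner_smul_left, real_inner_smul_right, real_inner_self_eq_norm_sq]; ring
  · intro κ' _ hne
    rw [real_inner_smul_left, real_inner_smul_right, P.inner_comp_of_ne hne.symm]; ring
  · exact fun h => absurd hκ h

theorem sum_norm_comp_sq_le (F : Finset (Ioi (0 : ℝ))) (x : H₀) :
    ∑ κ ∈ F, ‖P.comp κ x‖ ^ 2 ≤ ‖x‖ ^ 2 := by
  set z := ∑ κ ∈ F, P.comp κ x with hz
  have h1 : inner ℝ z x = ∑ κ ∈ F, ‖P.comp κ x‖ ^ 2 := by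
    rw [hz, sum_inner]; exact Finset.sum_congr rfl fun κ _ => P.inner_comp_self κ x
  have h2 : ‖z‖ ^ 2 = ∑ κ ∈ F, ‖P.comp κ x‖ ^ 2 := by
    rw [← real_inner_self_eq_norm_sq]
    simpa using P.inner_sum_comp F (fun _ => 1) (fun _ => 1) x
  have h3 := real_inner_le_norm z x
  nlinarith [sq_nonneg (‖z‖ - ‖x‖), norm_nonneg z, norm_nonneg x]

theorem sum_norm_comp_incl_sq_le (F : Finset (Ioi (0 : ℝ))) (y : H₁) :
    ∑ κ ∈ F, (κ : ℝ)⁻¹ * ‖P.comp κ (P.incl y)‖ ^ 2 ≤ ‖y‖ ^ 2 := by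
  set z := ∑ κ ∈ F, (κ : ℝ)⁻¹ • P.comp κ (P.incl y) with hz
  set w := ContinuousLinearMap.adjoint P.incl z with hw
  have h1 : inner ℝ w y = ∑ κ ∈ F, (κ : ℝ)⁻¹ * ‖P.comp κ (P.incl y)‖ ^ 2 := by
    rw [hw, ContinuousLinearMap.adjoint_inner_left, hz, sum_inner]
    refine Finset.sum_congr rfl fun κ _ => ?_
    rw [real_inner_smul_left, P.inner_comp_self]
  have h2 : ‖w‖ ^ 2 = ∑ κ ∈ F, (κ : ℝ)⁻¹ * ‖P.comp κ (P.incl y)‖ ^ 2 := by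
    rw [← real_inner_self_eq_norm_sq, hw, ContinuousLinearMap.adjoint_inner_left]
    have h4 : P.incl (ContinuousLinearMap.adjoint P.incl z)
        = ∑ κ ∈ F, (1 : ℝ) • P.comp κ (P.incl y) := by
      rw [hz, map_sum, map_sum]
      refine Finset.sum_congr rfl fun κ _ => ?_
      rw [map_smul, map_smul, incl_adjoint_comp, smul_smul, inv_mul_cancel₀ (ne_of_gt κ.2)]
    rw [h4, hz, P.inner_sum_comp F (fun κ => (κ : ℝ)⁻¹) (fun _ => 1)]
    simp
  have h3 := real_inner_le_norm w y
  nlinarith [sq_nonneg (‖w‖ - ‖y‖), norm_nonneg w, norm_nonneg y]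

theorem eq_zero_of_comp_eq_zero {x : H₀} (hx : ∀ κ, P.comp κ x = 0) : x = 0 := by
  have horth : ContinuousLinearMap.adjoint P.incl x = 0 := by
    have hsym : (P.growthOp : H₁ →ₗ[ℝ] H₁).IsSymmetric := by
      intro a b
      have h1 := P.inner_growthOp a b
      have h2 := P.inner_growthOp b a
      rw [real_inner_comm] at h2
      rw [h2, real_inner_comm] at h1
      exact h1
    have h := ContinuousLinearMap.orthogonalComplement_iSup_eigenspaces_eq_bot
      P.growthOp_compact hsym
    rw [← Submodule.mem_bot ℝ, ← h, Submodule.mem_orthogonal]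
    intro u hu
    induction hu using Submodule.iSup_induction' with
    | zero => simp
    | add a b _ _ ha hb => rw [inner_add_left, ha, hb, add_zero]
    | mem κ v hv =>
      rw [ContinuousLinearMap.adjoint_inner_right]
      have hv' : P.growthOp v = κ • v := Module.End.mem_eigenspace_iff.1 hv
      rcases lt_or_ge 0 κ with hκ | hκ
      · have hm : P.incl v ∈ P.growthEigenspace κ := ⟨v, hv, rfl⟩
        obtain ⟨k, rfl⟩ : ∃ k : Ioi (0 : ℝ), (k : ℝ) = κ := ⟨⟨κ, hκ⟩, rfl⟩
        have := Submodule.starProjection_inner_eq_zero (K := P.growthEigenspace k) x _ hm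
        change inner ℝ (x - P.comp k x) (P.incl v) = 0 at this
        rwa [hx, sub_zero, real_inner_comm] at this
      · have h5 := P.inner_growthOp v v
        rw [hv', real_inner_smul_right, real_inner_self_eq_norm_sq,
          real_inner_self_eq_norm_sq] at h5
        have h6 : ‖P.incl v‖ ^ 2 = 0 :=
          le_antisymm (h5 ▸ mul_nonpos_of_nonpos_of_nonneg hκ (sq_nonneg _)) (sq_nonneg _)
        have h7 : P.incl v = 0 := by simpa using h6
        rw [h7, inner_zero_left]
  have h8 : ∀ y, inner ℝ x y = 0 := by
    have hc : Continuous fun y : H₀ => (inner ℝ x y : ℝ) := by fun_prop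
    have := P.incl_denseRange.equalizer hc continuous_const (by
      funext v
      change inner ℝ x (P.incl v) = (0 : ℝ)
      rw [← ContinuousLinearMap.adjoint_inner_left, horth, inner_zero_left])
    exact fun y => congrFun this y
  simpa using h8 x

/-- The weighted components `κ^{-1/4} x_κ`. -/
def coord (x : H₀) (κ : Ioi (0 : ℝ)) : H₀ := ((κ : ℝ) ^ (-(1 / 4) : ℝ)) • P.comp κ x

theorem norm_coord_sq (x : H₀) (κ : Ioi (0 : ℝ)) :
    ‖P.coord x κ‖ ^ 2 = (κ : ℝ) ^ (-(1 / 2) : ℝ) * ‖P.comp κ x‖ ^ 2 := by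
  have hκ : (0 : ℝ) < κ := κ.2
  rw [coord, norm_smul, mul_pow, Real.norm_of_nonneg (by positivity), ← Real.rpow_natCast,
    ← Real.rpow_mul hκ.le]
  norm_num

theorem memℓp_coord_iff (x : H₀) : Memℓp (P.coord x) 2 ↔
    Summable fun κ : Ioi (0 : ℝ) => (κ : ℝ) ^ (-(1 / 2) : ℝ) * ‖P.comp κ x‖ ^ 2 := by
  rw [memℓp_gen_iff (by norm_num)]
  simp only [← norm_coord_sq]
  norm_num

/-- The interpolation space `H_{1/2}` of the pair, as a subspace of `H₀`: all `x` such that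
`∑ κ^{-1/2} ‖x_κ‖²` is finite, the sum being over the eigenvalues `κ` of the growth operator
(`x_κ = 0` if `κ` is not an eigenvalue). -/
def halfSubmodule : Submodule ℝ H₀ where
  carrier := {x | Summable fun κ : Ioi (0 : ℝ) => (κ : ℝ) ^ (-(1 / 2) : ℝ) * ‖P.comp κ x‖ ^ 2}
  add_mem' {x y} hx hy := by
    rw [mem_ofPred_eq, ← memℓp_coord_iff] at *
    convert hx.add hy using 1
    funext κ
    simp [coord]
  zero_mem' := by simp [summable_zero]
  smul_mem' c x hx := by
    rw [mem_ofPred_eq, ← memℓp_coord_iff] at *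
    convert hx.const_smul c using 1
    funext κ
    simp [coord, smul_comm c]

/-- The interpolation space `H_{1/2}`, with its own norm (see `Half.norm_sq`). -/
def Half : Type _ := P.halfSubmodule

instance : AddCommGroup P.Half := inferInstanceAs (AddCommGroup P.halfSubmodule)

instance : Module ℝ P.Half := inferInstanceAs (Module ℝ P.halfSubmodule)

/-- The inclusion `H_{1/2} → H₀`. -/
def halfIncl : P.Half →ₗ[ℝ] H₀ := P.halfSubmodule.subtype

theorem halfIncl_injective : Function.Injective P.halfIncl := Subtype.val_injective

/-- The map `x ↦ (κ^{-1/4} x_κ)_κ` from `H_{1/2}` to an `ℓ²` space, which defines the norm. -/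
def halfCoord : P.Half →ₗ[ℝ] lp (fun _ : Ioi (0 : ℝ) => H₀) 2 where
  toFun x := ⟨P.coord (P.halfIncl x), (P.memℓp_coord_iff _).2 x.2⟩
  map_add' x y := by
    ext κ
    change P.coord _ κ = P.coord _ κ + P.coord _ κ
    simp [coord]
  map_smul' c x := by
    ext κ
    change P.coord _ κ = c • P.coord _ κ
    simp [coord, smul_comm c]

theorem halfCoord_injective : Function.Injective P.halfCoord := by
  rw [← LinearMap.ker_eq_bot, LinearMap.ker_eq_bot']
  intro x hx
  apply P.halfIncl_injective
  rw [map_zero]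
  refine P.eq_zero_of_comp_eq_zero fun κ => ?_
  have h : P.coord (P.halfIncl x) κ = 0 := congrFun (congrArg Subtype.val hx) κ
  have hκ : (0 : ℝ) < κ := κ.2
  rw [coord, smul_eq_zero] at h
  exact h.resolve_left (by positivity)

instance : NormedAddCommGroup P.Half :=
  NormedAddCommGroup.induced P.Half _ P.halfCoord P.halfCoord_injective

instance : NormedSpace ℝ P.Half := NormedSpace.induced ℝ P.Half _ P.halfCoord

theorem Half.norm_sq (x : P.Half) : ‖x‖ ^ 2 =
    ∑' κ : Ioi (0 : ℝ), (κ : ℝ) ^ (-(1 / 2) : ℝ) * ‖P.comp κ (P.halfIncl x)‖ ^ 2 := by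
  have h := lp.norm_rpow_eq_tsum (p := 2) (by norm_num) (P.halfCoord x)
  simp only [ENNReal.toReal_ofNat, Real.rpow_ofNat] at h
  refine h.trans (tsum_congr fun κ => P.norm_coord_sq _ κ)

theorem Half.norm_sq_le {x : P.Half} {C : ℝ}
    (h : ∀ F : Finset (Ioi (0 : ℝ)),
      ∑ κ ∈ F, (κ : ℝ) ^ (-(1 / 2) : ℝ) * ‖P.comp κ (P.halfIncl x)‖ ^ 2 ≤ C) : ‖x‖ ^ 2 ≤ C := by
  rw [Half.norm_sq]
  exact x.2.tsum_le_of_sum_le h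

/-! ### Spectral splitting of `H_{1/2}` -/

/-- `H⁺_{1/2}(A)`: the closed span in `H_{1/2}` of the eigenvectors of `A` with positive
eigenvalue. -/
def halfPlus (A : H₁ →L[ℝ] H₀) : Submodule ℝ P.Half :=
  (Submodule.span ℝ {x | ∃ a : ℝ, 0 < a ∧ ∃ v : H₁, A v = a • P.incl v ∧
    P.halfIncl x = P.incl v}).topologicalClosure

/-- `H⁻_{1/2}(A)`: the closed span in `H_{1/2}` of the eigenvectors of `A` with negative
eigenvalue. -/
def halfMinus (A : H₁ →L[ℝ] H₀) : Submodule ℝ P.Half :=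
  (Submodule.span ℝ {x | ∃ a : ℝ, a < 0 ∧ ∃ v : H₁, A v = a • P.incl v ∧
    P.halfIncl x = P.incl v}).topologicalClosure

open Classical in
/-- The projection `π₊` of `H_{1/2}` onto `H⁺_{1/2}(A)` along `H⁻_{1/2}(A)`, defined whenever
`H_{1/2}` is the topological direct sum of the two (and zero by convention otherwise). -/
def projPlus (A : H₁ →L[ℝ] H₀) : P.Half →L[ℝ] P.halfPlus A :=
  if h : Submodule.IsTopCompl (P.halfPlus A) (P.halfMinus A) then
    (P.halfPlus A).projectionOntoL (P.halfMinus A) h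
  else 0

open Classical in
/-- The projection `π₋` of `H_{1/2}` onto `H⁻_{1/2}(A)` along `H⁺_{1/2}(A)`, defined whenever
`H_{1/2}` is the topological direct sum of the two (and zero by convention otherwise). -/
def projMinus (A : H₁ →L[ℝ] H₀) : P.Half →L[ℝ] P.halfMinus A :=
  if h : Submodule.IsTopCompl (P.halfMinus A) (P.halfPlus A) then
    (P.halfMinus A).projectionOntoL (P.halfPlus A) h
  else 0


/-! ### Path spaces -/

/-- The path space `P₀ = L²([-T, T], H₀)`. -/
abbrev P0 (_P : HilbertPair H₀ H₁) (T : ℝ) : Type _ := Lp H₀ 2 (volume.restrict (Icc (-T) T))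

/-- The path space `P₁ = L²([-T, T], H₁) ∩ W^{1,2}([-T, T], H₀)`. A path is recorded as the pair
of its class `u ∈ L²([-T, T], H₁)` and the weak derivative `v ∈ L²([-T, T], H₀)` of `ι ∘ u`, with
norm `(‖u‖² + ‖v‖²)^{1/2}`. -/
def P1 (T : ℝ) : Submodule ℝ (WithLp 2 (Lp H₁ 2 (volume.restrict (Icc (-T) T)) ×
    Lp H₀ 2 (volume.restrict (Icc (-T) T)))) where
  carrier := {ξ | IsWeakDeriv T (fun s => P.incl (ξ.fst s)) ξ.snd}
  zero_mem' := by
    intro φ hφ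
    have h1 : ∫ s in Icc (-T) T,
        deriv φ s • P.incl ((0 : Lp H₁ 2 (volume.restrict (Icc (-T) T))) s) = 0 := by
      refine (integral_congr_ae ?_).trans (integral_zero _ _)
      filter_upwards [Lp.coeFn_zero H₁ 2 (volume.restrict (Icc (-T) T))] with s hs
      rw [hs, Pi.zero_apply, map_zero, smul_zero]
    have h2 : ∫ s in Icc (-T) T,
        φ s • (0 : Lp H₀ 2 (volume.restrict (Icc (-T) T))) s = 0 := by
      refine (integral_congr_ae ?_).trans (integral_zero _ _)
      filter_upwards [Lp.coeFn_zero H₀ 2 (volume.restrict (Icc (-T) T))] with s hs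
      rw [hs, Pi.zero_apply, smul_zero]
    exact h1.trans (by rw [← neg_zero, ← h2]; rfl)
  add_mem' {ξ η} hξ hη := by
    intro φ hφ
    have hd : Continuous (deriv φ) := hφ.contDiff.continuous_deriv (by simp)
    have hi (ξ : Lp H₁ 2 (volume.restrict (Icc (-T) T))) :
        IntegrableOn (fun s => deriv φ s • P.incl (ξ s)) (Icc (-T) T) :=
      IsTestFunction.integrableOn_smul hd
        (P.incl.integrable_comp ((Lp.memLp ξ).integrable (by norm_num)))
    have hj (ξ : Lp H₀ 2 (volume.restrict (Icc (-T) T))) :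
        IntegrableOn (fun s => φ s • ξ s) (Icc (-T) T) :=
      IsTestFunction.integrableOn_smul hφ.contDiff.continuous
        ((Lp.memLp ξ).integrable (by norm_num))
    have h1 : ∫ s in Icc (-T) T, deriv φ s • P.incl ((ξ.fst + η.fst) s) =
        ∫ s in Icc (-T) T, (deriv φ s • P.incl (ξ.fst s) + deriv φ s • P.incl (η.fst s)) := by
      refine integral_congr_ae ?_
      filter_upwards [Lp.coeFn_add ξ.fst η.fst] with s hs
      rw [hs, Pi.add_apply, map_add, smul_add]
    have h2 : ∫ s in Icc (-T) T, φ s • (ξ.snd + η.snd) s =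
        ∫ s in Icc (-T) T, (φ s • ξ.snd s + φ s • η.snd s) := by
      refine integral_congr_ae ?_
      filter_upwards [Lp.coeFn_add ξ.snd η.snd] with s hs
      rw [hs, Pi.add_apply, smul_add]
    rw [integral_add (hi _) (hi _), hξ φ hφ, hη φ hφ] at h1
    rw [integral_add (hj _) (hj _)] at h2
    refine h1.trans ?_
    change _ = -∫ s in Icc (-T) T, φ s • (ξ.snd + η.snd) s
    rw [h2, neg_add]
  smul_mem' c ξ hξ := by
    intro φ hφ
    have h1 : ∫ s in Icc (-T) T, deriv φ s • P.incl ((c • ξ.fst) s) =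
        ∫ s in Icc (-T) T, c • (deriv φ s • P.incl (ξ.fst s)) := by
      refine integral_congr_ae ?_
      filter_upwards [Lp.coeFn_smul c ξ.fst] with s hs
      simp [hs, smul_comm c]
    have h2 : ∫ s in Icc (-T) T, φ s • (c • ξ.snd) s =
        ∫ s in Icc (-T) T, c • (φ s • ξ.snd s) := by
      refine integral_congr_ae ?_
      filter_upwards [Lp.coeFn_smul c ξ.snd] with s hs
      simp [hs, smul_comm c]
    rw [integral_smul, hξ φ hφ] at h1
    rw [integral_smul] at h2
    refine h1.trans ?_
    change _ = -∫ s in Icc (-T) T, φ s • (c • ξ.snd) s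
    rw [h2, smul_neg]

variable {P} {T : ℝ}

/-- The underlying class in `L²([-T, T], H₁)` of a path in `P₁`. -/
def P1.val : P.P1 T →L[ℝ] Lp H₁ 2 (volume.restrict (Icc (-T) T)) :=
  (WithLp.fstL 2 ℝ _ _) ∘L (P.P1 T).subtypeL

/-- The weak derivative `∂ₛ : P₁ → P₀`. -/
def P1.der : P.P1 T →L[ℝ] P.P0 T :=
  (WithLp.sndL 2 ℝ _ _) ∘L (P.P1 T).subtypeL

theorem P1.norm_sq (ξ : P.P1 T) : ‖ξ‖ ^ 2 = ‖P1.val ξ‖ ^ 2 + ‖P1.der ξ‖ ^ 2 :=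
  WithLp.prod_norm_sq_eq_of_L2 ξ.1

theorem P1.isWeakDeriv (ξ : P.P1 T) :
    IsWeakDeriv T (fun s => P.incl (P1.val ξ s)) (P1.der ξ) := ξ.2

theorem P1.integrableOn_val (ξ : P.P1 T) :
    IntegrableOn (fun s => P.incl (P1.val ξ s)) (Icc (-T) T) :=
  P.incl.integrable_comp ((Lp.memLp (P1.val ξ)).integrable (by norm_num))

theorem P1.integrableOn_der (ξ : P.P1 T) : IntegrableOn (P1.der ξ) (Icc (-T) T) :=
  (Lp.memLp (P1.der ξ)).integrable (by norm_num)

theorem P1.continuousOn_primitive (hT : 0 < T) (ξ : P.P1 T) (c : H₀) :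
    ContinuousOn (fun t => c + ∫ r in (-T)..t, P1.der ξ r) (Icc (-T) T) :=
  continuousOn_const.add (continuousOn_primitive_Icc hT (P1.integrableOn_der ξ))

theorem P1.exists_rep (hT : 0 < T) (ξ : P.P1 T) : ∃ g : ℝ → H₀, ContinuousOn g (Icc (-T) T) ∧
    ∀ᵐ s ∂volume.restrict (Icc (-T) T), P.incl (P1.val ξ s) = g s := by
  obtain ⟨c, hc⟩ := (P1.isWeakDeriv ξ).exists_primitive hT (P1.integrableOn_val ξ)
    (P1.integrableOn_der ξ)
  exact ⟨_, P1.continuousOn_primitive hT ξ c, hc⟩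

/-- The continuous representative `[-T, T] → H₀` of a path in `P₁`. -/
def P1.rep (hT : 0 < T) (ξ : P.P1 T) : ℝ → H₀ := (P1.exists_rep hT ξ).choose

theorem P1.continuousOn_rep (hT : 0 < T) (ξ : P.P1 T) :
    ContinuousOn (P1.rep hT ξ) (Icc (-T) T) := (P1.exists_rep hT ξ).choose_spec.1

theorem P1.rep_ae_eq (hT : 0 < T) (ξ : P.P1 T) :
    ∀ᵐ s ∂volume.restrict (Icc (-T) T), P.incl (P1.val ξ s) = P1.rep hT ξ s :=
  (P1.exists_rep hT ξ).choose_spec.2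

theorem P1.rep_unique (hT : 0 < T) (ξ : P.P1 T) {g : ℝ → H₀} (hg : ContinuousOn g (Icc (-T) T))
    (h : ∀ᵐ s ∂volume.restrict (Icc (-T) T), P.incl (P1.val ξ s) = g s) {t : ℝ}
    (ht : t ∈ Icc (-T) T) : P1.rep hT ξ t = g t := by
  refine Measure.eqOn_Icc_of_ae_eq volume (by linarith : -T ≠ T) ?_ (P1.continuousOn_rep hT ξ)
    hg ht
  filter_upwards [h, P1.rep_ae_eq hT ξ] with s h1 h2
  rw [← h1, ← h2]

theorem P1.rep_sub (hT : 0 < T) (ξ : P.P1 T) {s t : ℝ} (hs : s ∈ Icc (-T) T)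
    (ht : t ∈ Icc (-T) T) : P1.rep hT ξ t - P1.rep hT ξ s = ∫ r in s..t, P1.der ξ r := by
  obtain ⟨c, hc⟩ := (P1.isWeakDeriv ξ).exists_primitive hT (P1.integrableOn_val ξ)
    (P1.integrableOn_der ξ)
  have hII : ∀ t ∈ Icc (-T) T, IntervalIntegrable (P1.der ξ) volume (-T) t := fun t ht => by
    rw [intervalIntegrable_iff_integrableOn_Icc_of_le ht.1]
    exact (P1.integrableOn_der ξ).mono_set (Icc_subset_Icc_right ht.2)
  rw [P1.rep_unique hT ξ (P1.continuousOn_primitive hT ξ c) hc hs,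
    P1.rep_unique hT ξ (P1.continuousOn_primitive hT ξ c) hc ht,
    ← intervalIntegral.integral_interval_sub_left (hII t ht) (hII s hs)]
  abel

/-- Evaluation at time `t`, as a linear map to `H₀`. -/
def P1.eval₀ (hT : 0 < T) (t : ℝ) (ht : t ∈ Icc (-T) T) : P.P1 T →ₗ[ℝ] H₀ where
  toFun ξ := P1.rep hT ξ t
  map_add' ξ η := by
    refine P1.rep_unique hT _ (g := fun s => P1.rep hT ξ s + P1.rep hT η s)
      ((P1.continuousOn_rep hT ξ).add (P1.continuousOn_rep hT η)) ?_ ht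
    filter_upwards [P1.rep_ae_eq hT ξ, P1.rep_ae_eq hT η,
      Lp.coeFn_add (P1.val ξ) (P1.val η)] with s h1 h2 h3
    rw [map_add, h3, Pi.add_apply, map_add, h1, h2]
  map_smul' c ξ := by
    refine P1.rep_unique hT _ (g := fun s => c • P1.rep hT ξ s)
      ((P1.continuousOn_rep hT ξ).const_smul c) ?_ ht
    filter_upwards [P1.rep_ae_eq hT ξ, Lp.coeFn_smul c (P1.val ξ)] with s h1 h2
    rw [map_smul, h2, Pi.smul_apply, map_smul, h1]

theorem integrable_norm_sq {E : Type*} [NormedAddCommGroup E] (f : Lp E 2 (volume.restrict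
    (Icc (-T) T))) : IntegrableOn (fun s => ‖f s‖ ^ 2) (Icc (-T) T) :=
  (memLp_two_iff_integrable_sq_norm (Lp.memLp f).1).1 (Lp.memLp f)

theorem Lp_norm_sq {E : Type*} [NormedAddCommGroup E] [InnerProductSpace ℝ E]
    (f : Lp E 2 (volume.restrict (Icc (-T) T))) :
    ‖f‖ ^ 2 = ∫ s in Icc (-T) T, ‖f s‖ ^ 2 := by
  rw [← real_inner_self_eq_norm_sq, L2.inner_def]
  simp only [real_inner_self_eq_norm_sq]

theorem comp_eq_zero_of_lt {κ : Ioi (0 : ℝ)} (hκ : ‖P.incl‖ ^ 2 < κ) (x : H₀) :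
    P.comp κ x = 0 := by
  have h := congrArg norm (P.incl_adjoint_comp κ x)
  have h1 := P.incl.le_opNorm (ContinuousLinearMap.adjoint P.incl (P.comp κ x))
  have h2 := (ContinuousLinearMap.adjoint P.incl).le_opNorm (P.comp κ x)
  rw [LinearIsometryEquiv.norm_map] at h2
  have hκ0 : (0 : ℝ) < κ := κ.2
  rw [norm_smul, Real.norm_of_nonneg hκ0.le] at h
  have h3 : (κ : ℝ) * ‖P.comp κ x‖ ≤ ‖P.incl‖ ^ 2 * ‖P.comp κ x‖ := by
    rw [← h, pow_two, mul_assoc]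
    exact h1.trans (mul_le_mul_of_nonneg_left h2 (norm_nonneg _))
  by_contra hne
  exact absurd (le_of_mul_le_mul_right h3 (norm_pos_iff.2 hne)) (not_le.2 hκ)

/-- The trace estimate for a single component. -/
theorem P1.comp_trace_le (hT : 0 < T) (ξ : P.P1 T) {t : ℝ} (ht : t ∈ Icc (-T) T)
    (κ : Ioi (0 : ℝ)) : T / (1 + ‖P.incl‖) *
      ((κ : ℝ) ^ (-(1 / 2) : ℝ) * ‖P.comp κ (P1.rep hT ξ t)‖ ^ 2) ≤
    2 * (∫ s in Icc (-T) T, (κ : ℝ)⁻¹ * ‖P.comp κ (P.incl (P1.val ξ s))‖ ^ 2) +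
      2 * (T / (1 + ‖P.incl‖)) ^ 2 * (∫ s in Icc (-T) T, ‖P.comp κ (P1.der ξ s)‖ ^ 2) := by
  have hκ0 : (0 : ℝ) < κ := κ.2
  set K := 1 + ‖P.incl‖ with hK
  have hK0 : 0 < K := by positivity
  have hnn1 : 0 ≤ ∫ s in Icc (-T) T, ‖P.comp κ (P.incl (P1.val ξ s))‖ ^ 2 :=
    integral_nonneg fun s => by positivity
  have hnn2 : 0 ≤ ∫ s in Icc (-T) T, ‖P.comp κ (P1.der ξ s)‖ ^ 2 :=
    integral_nonneg fun s => by positivity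
  rw [integral_const_mul]
  rcases lt_or_ge (‖P.incl‖ ^ 2) (κ : ℝ) with hκ | hκ
  · rw [comp_eq_zero_of_lt hκ]
    simp only [norm_zero]
    have : T / K * ((κ : ℝ) ^ (-(1 / 2) : ℝ) * 0 ^ 2) = 0 := by ring
    rw [this]
    positivity
  set q := √(κ : ℝ) with hq
  have hq0 : 0 < q := Real.sqrt_pos.2 hκ0
  have hqq : q ^ 2 = κ := Real.sq_sqrt hκ0.le
  have hqK : q ≤ K := by
    have : q ≤ ‖P.incl‖ := Real.sqrt_le_iff.2 ⟨norm_nonneg _, hκ⟩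
    linarith
  have hrpow : (κ : ℝ) ^ (-(1 / 2) : ℝ) = q⁻¹ := by
    rw [Real.rpow_neg hκ0.le, ← Real.sqrt_eq_rpow]
  set δ := T * q / K with hδ
  have hδ0 : 0 < δ := by positivity
  have hδT : δ ≤ T := by
    rw [hδ, div_le_iff₀ hK0]
    exact mul_le_mul_of_nonneg_left hqK hT.le
  obtain ⟨a, b, hab, hta, hsub⟩ : ∃ a b : ℝ, b - a = δ ∧ t ∈ Icc a b ∧
      Icc a b ⊆ Icc (-T) T := by
    rcases le_total 0 t with h0 | h0
    · exact ⟨t - δ, t, by ring, ⟨by linarith, le_rfl⟩,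
        Icc_subset_Icc (by linarith) ht.2⟩
    · exact ⟨t, t + δ, by ring, ⟨le_rfl, by linarith⟩,
        Icc_subset_Icc ht.1 (by linarith)⟩
  set c := P.comp κ with hc
  have hi1 : IntegrableOn (fun s => ‖c (P.incl (P1.val ξ s))‖ ^ 2) (Icc (-T) T) := by
    have := integrable_norm_sq ((c ∘L P.incl).compLp (P1.val ξ))
    refine this.congr ?_
    filter_upwards [(c ∘L P.incl).coeFn_compLp (P1.val ξ)] with s hs
    rw [hs]; rfl
  have hi2 : IntegrableOn (fun s => ‖c (P1.der ξ s)‖ ^ 2) (Icc (-T) T) := by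
    have := integrable_norm_sq (c.compLp (P1.der ξ))
    refine this.congr ?_
    filter_upwards [c.coeFn_compLp (P1.der ξ)] with s hs
    rw [hs]
  have hae : (fun s => ‖c (P.incl (P1.val ξ s))‖ ^ 2) =ᵐ[volume.restrict (Icc (-T) T)]
      fun s => ‖c (P1.rep hT ξ s)‖ ^ 2 := by
    filter_upwards [P1.rep_ae_eq hT ξ] with s hs
    rw [hs]
  have hmain := sq_norm_le_of_primitive (x := fun s => c (P1.rep hT ξ s))
    (v := fun s => c (P1.der ξ s)) (a := a) (b := b) (t := t) (by linarith) hta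
    ((c.integrable_comp (P1.integrableOn_der ξ)).mono_measure
      (Measure.restrict_mono hsub le_rfl))
    (hi2.mono_set hsub) ((hi1.congr hae).mono_measure (Measure.restrict_mono hsub le_rfl))
    (fun s hs => by
      rw [← map_sub, P1.rep_sub hT ξ (hsub hs) ht, ContinuousLinearMap.intervalIntegral_comp_comm]
      rw [intervalIntegrable_iff]
      exact (P1.integrableOn_der ξ).mono_set
        ((uIoc_subset_uIcc.trans (uIcc_subset_Icc hs hta)).trans hsub))
  rw [hab] at hmain
  have hm1 : ∫ s in Icc a b, ‖c (P1.rep hT ξ s)‖ ^ 2 ≤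
      ∫ s in Icc (-T) T, ‖c (P.incl (P1.val ξ s))‖ ^ 2 := by
    rw [integral_congr_ae hae]
    exact setIntegral_mono_set (hi1.congr hae) (.of_forall fun _ => by positivity)
      hsub.eventuallyLE
  have hm2 : ∫ s in Icc a b, ‖c (P1.der ξ s)‖ ^ 2 ≤
      ∫ s in Icc (-T) T, ‖c (P1.der ξ s)‖ ^ 2 :=
    setIntegral_mono_set hi2 (.of_forall fun _ => by positivity) hsub.eventuallyLE
  set I1 := ∫ s in Icc (-T) T, ‖c (P.incl (P1.val ξ s))‖ ^ 2
  set I2 := ∫ s in Icc (-T) T, ‖c (P1.der ξ s)‖ ^ 2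
  have hfin : δ * ‖c (P1.rep hT ξ t)‖ ^ 2 ≤ 2 * I1 + 2 * δ ^ 2 * I2 := by
    refine hmain.trans ?_
    gcongr
  have hscale : (κ : ℝ)⁻¹ * (δ * ‖c (P1.rep hT ξ t)‖ ^ 2) ≤
      (κ : ℝ)⁻¹ * (2 * I1 + 2 * δ ^ 2 * I2) :=
    mul_le_mul_of_nonneg_left hfin (by positivity)
  have e1 : (κ : ℝ)⁻¹ * (δ * ‖c (P1.rep hT ξ t)‖ ^ 2) =
      T / K * (q⁻¹ * ‖c (P1.rep hT ξ t)‖ ^ 2) := by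
    rw [← hqq, hδ]; field_simp
  have e2 : (κ : ℝ)⁻¹ * (2 * I1 + 2 * δ ^ 2 * I2) =
      2 * ((κ : ℝ)⁻¹ * I1) + 2 * (T / K) ^ 2 * I2 := by
    rw [← hqq, hδ]; field_simp
  rw [hrpow, ← e1, ← e2]
  exact hscale

/-- The constant in the trace estimate. -/
def traceConst (P : HilbertPair H₀ H₁) (T : ℝ) : ℝ :=
  (T / (1 + ‖P.incl‖))⁻¹ * (2 + 2 * (T / (1 + ‖P.incl‖)) ^ 2)

/-- The trace estimate: point values of paths in `P₁` lie in `H_{1/2}`. -/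
theorem P1.trace_le (hT : 0 < T) (ξ : P.P1 T) {t : ℝ} (ht : t ∈ Icc (-T) T)
    (F : Finset (Ioi (0 : ℝ))) :
    ∑ κ ∈ F, (κ : ℝ) ^ (-(1 / 2) : ℝ) * ‖P.comp κ (P1.rep hT ξ t)‖ ^ 2 ≤
      P.traceConst T * ‖ξ‖ ^ 2 := by
  set R := T / (1 + ‖P.incl‖) with hR
  have hR0 : 0 < R := by positivity
  have h1 := Finset.sum_le_sum fun κ (_ : κ ∈ F) => P1.comp_trace_le hT ξ ht κ
  rw [← Finset.mul_sum, Finset.sum_add_distrib, ← Finset.mul_sum, ← Finset.mul_sum] at h1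
  have hint1 : ∀ κ ∈ F, Integrable (fun s => (κ : ℝ)⁻¹ *
      ‖P.comp κ (P.incl (P1.val ξ s))‖ ^ 2) (volume.restrict (Icc (-T) T)) := fun κ _ => by
    refine Integrable.const_mul ?_ _
    refine (integrable_norm_sq ((P.comp κ ∘L P.incl).compLp (P1.val ξ))).congr ?_
    filter_upwards [(P.comp κ ∘L P.incl).coeFn_compLp (P1.val ξ)] with s hs
    rw [hs]; rfl
  have hint2 : ∀ κ ∈ F, Integrable (fun s => ‖P.comp κ (P1.der ξ s)‖ ^ 2)
      (volume.restrict (Icc (-T) T)) := fun κ _ => by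
    refine (integrable_norm_sq ((P.comp κ).compLp (P1.der ξ))).congr ?_
    filter_upwards [(P.comp κ).coeFn_compLp (P1.der ξ)] with s hs
    rw [hs]
  rw [← integral_finsetSum _ hint1, ← integral_finsetSum _ hint2] at h1
  have h2 : ∫ s in Icc (-T) T, ∑ κ ∈ F, (κ : ℝ)⁻¹ * ‖P.comp κ (P.incl (P1.val ξ s))‖ ^ 2 ≤
      ‖P1.val ξ‖ ^ 2 := by
    rw [Lp_norm_sq]
    exact integral_mono (integrable_finsetSum _ hint1) (integrable_norm_sq _)
      fun s => P.sum_norm_comp_incl_sq_le F _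
  have h3 : ∫ s in Icc (-T) T, ∑ κ ∈ F, ‖P.comp κ (P1.der ξ s)‖ ^ 2 ≤ ‖P1.der ξ‖ ^ 2 := by
    rw [Lp_norm_sq]
    exact integral_mono (integrable_finsetSum _ hint2) (integrable_norm_sq _)
      fun s => P.sum_norm_comp_sq_le F _
  have h4 := P1.norm_sq ξ
  have h5 : ‖P1.val ξ‖ ^ 2 ≤ ‖ξ‖ ^ 2 := by rw [h4]; exact le_add_of_nonneg_right (sq_nonneg _)
  have h6 : ‖P1.der ξ‖ ^ 2 ≤ ‖ξ‖ ^ 2 := by rw [h4]; exact le_add_of_nonneg_left (sq_nonneg _)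
  rw [traceConst, mul_assoc, ← hR, inv_mul_eq_div, le_div_iff₀ hR0, mul_comm]
  refine h1.trans ?_
  rw [add_mul]
  exact add_le_add (mul_le_mul_of_nonneg_left (h2.trans h5) (by norm_num))
    (mul_le_mul_of_nonneg_left (h3.trans h6) (by positivity))

/-- The evaluation map `P₁ → H_{1/2}`, `ξ ↦ ξ(t)`. -/
def P1.eval (hT : 0 < T) (t : ℝ) (ht : t ∈ Icc (-T) T) : P.P1 T →L[ℝ] P.Half :=
  LinearMap.mkContinuous
    ((P1.eval₀ hT t ht).codRestrict P.halfSubmodule fun ξ =>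
      summable_of_sum_le (fun κ => mul_nonneg (Real.rpow_nonneg κ.2.le _) (sq_nonneg _))
        (P1.trace_le hT ξ ht))
    (√(P.traceConst T)) fun ξ => by
      have h := Half.norm_sq_le (P := P) (x := (P1.eval₀ hT t ht).codRestrict P.halfSubmodule
        (fun ξ => summable_of_sum_le
          (fun κ => mul_nonneg (Real.rpow_nonneg κ.2.le _) (sq_nonneg _))
          (P1.trace_le hT ξ ht)) ξ) (P1.trace_le hT ξ ht)
      have hC : 0 ≤ P.traceConst T := by unfold traceConst; positivity
      rw [← Real.sqrt_sq (norm_nonneg ξ), ← Real.sqrt_mul hC]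
      exact Real.le_sqrt_of_sq_le h

theorem P1.halfIncl_eval (hT : 0 < T) (t : ℝ) (ht : t ∈ Icc (-T) T) (ξ : P.P1 T) :
    P.halfIncl (P1.eval hT t ht ξ) = P1.rep hT ξ t := rfl

/-! ### The augmented operators -/

set_option linter.unusedSectionVars false in
theorem memLp_mul {A : ℝ → H₁ →L[ℝ] H₀} (hA : ContinuousOn A (Icc (-T) T))
    (u : Lp H₁ 2 (volume.restrict (Icc (-T) T))) :
    MemLp (fun s => A s (u s)) 2 (volume.restrict (Icc (-T) T)) := by
  obtain ⟨C, hC⟩ := isCompact_Icc.exists_bound_of_continuousOn hA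
  refine (Lp.memLp u).of_le_mul (c := C) ?_ ?_
  · exact (ContinuousLinearMap.id ℝ (H₁ →L[ℝ] H₀)).aestronglyMeasurable_comp₂
      (hA.aestronglyMeasurable measurableSet_Icc) (Lp.aestronglyMeasurable u)
  · filter_upwards [ae_restrict_mem measurableSet_Icc] with s hs
    exact (A s).le_of_opNorm_le (hC s hs) _

/-- The operator `L²([-T, T], H₁) → L²([-T, T], H₀)`, `u ↦ A u`, for a continuous path `A`. -/
def mulOp {A : ℝ → H₁ →L[ℝ] H₀} (hA : ContinuousOn A (Icc (-T) T)) :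
    Lp H₁ 2 (volume.restrict (Icc (-T) T)) →L[ℝ] Lp H₀ 2 (volume.restrict (Icc (-T) T)) :=
  LinearMap.mkContinuousOfExistsBound
    { toFun := fun u => (memLp_mul hA u).toLp
      map_add' := fun u v => by
        rw [← MemLp.toLp_add, MemLp.toLp_eq_toLp_iff]
        filter_upwards [Lp.coeFn_add u v] with s hs
        rw [hs, Pi.add_apply, map_add, Pi.add_apply]
      map_smul' := fun c u => by
        rw [RingHom.id_apply, ← MemLp.toLp_const_smul, MemLp.toLp_eq_toLp_iff]
        filter_upwards [Lp.coeFn_smul c u] with s hs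
        simp [hs] }
    (by
      obtain ⟨C, hC⟩ := isCompact_Icc.exists_bound_of_continuousOn hA
      refine ⟨C, fun u => Lp.norm_le_mul_norm_of_ae_le_mul ?_⟩
      filter_upwards [(memLp_mul hA u).coeFn_toLp, ae_restrict_mem measurableSet_Icc] with s h hs
      change ‖(memLp_mul hA u).toLp _ s‖ ≤ _
      rw [h]
      exact (A s).le_of_opNorm_le (hC s hs) _)

variable (P)

/-- The operator `D_A : P₁ → P₀`, `ξ ↦ ∂ₛ ξ + A ξ`. -/
def opD {A : ℝ → H₁ →L[ℝ] H₀} (hA : ContinuousOn A (Icc (-T) T)) : P.P1 T →L[ℝ] P.P0 T :=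
  P1.der + mulOp hA ∘L P1.val

/-- The augmented operator `𝔇_A^l`, `l = (l₁, l₂)`, from `P₁` to
`P₀ × H⁺_{1/2}(A(-T) - l₁ ι) × H⁻_{1/2}(A(T) - l₂ ι)`, which sends `ξ` to
`(D_A ξ, π₊ ξ(-T), π₋ ξ(T))`. -/
def augmentedOp (hT : 0 < T) {A : ℝ → H₁ →L[ℝ] H₀} (hA : ContinuousOn A (Icc (-T) T))
    (l : ℝ × ℝ) : P.P1 T →L[ℝ]
      P.P0 T × P.halfPlus (P.shift (A (-T)) l.1) × P.halfMinus (P.shift (A T) l.2) :=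
  (P.opD hA).prod
    ((P.projPlus (P.shift (A (-T)) l.1) ∘L P1.eval hT (-T) ⟨le_rfl, by linarith⟩).prod
      (P.projMinus (P.shift (A T) l.2) ∘L P1.eval hT T ⟨by linarith, le_rfl⟩))

end HilbertPair

end

/-! If `A` is symmetrizable and `A - r ι` is bijective, then `ι (A - r ι)⁻¹` is compact and
symmetric for the symmetrizing inner product. The spectral theorem therefore yields a Riesz basis of
H₀ made of eigenvectors of `A` (`exists_eigenSystem`). The spectral projection to the eigenvalues
above `r` is bounded on H₀ and, after conjugation with `A - r ι`, on H₁. By interpolation it is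
bounded on H_{1/2} (`interpolation_le`, `exists_half_operator`), and this gives the topological
splitting (`EigenSystem.isTopCompl`).

For a constant path with invertible value `C`, the equation ∂ₛξ + Cξ = f decouples into scalar
equations w' + a w = f. In the integral of (w' + a w)² the mixed term is the boundary term a (w(T)²
- w(-T)²). It is harmless once w(-T) is controlled for a > 0, or w(T) for a < 0, which is exactly
what the projections π₊ at -T and π₋ at T do. Interpolation bounds the sum of |aᵢ| xᵢ² by the
squared norm of H_{1/2}, so the modes can be summed to an a priori estimate. Explicit exponential
solutions make the range dense, hence the model operator is an isomorphism
(`exists_augOp_const_equiv`), and so are the operators of nearby paths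
(`exists_augOp_equiv_of_near`).

For a general path, A(s) + K ι is close to an invertible symmetrizable operator for s near a given
time. At the two ends K is a multiple of the identity, so that the model has the prescribed spectral
projections; at inner times K is a projection onto the kernel, and this is where index zero enters
(`IsHessian.exists_perturbation`). Inverses of the local models, glued by a smooth partition of
unity, form a left and a right parametrix. The errors are of order zero and factor through P₁ → P₀,
which is a norm limit of finite rank operators (`isFiniteRankLimit_inclP`). Hence the augmented
operators are Fredholm (`isFredholm_augOp`).

For the index let l ≤ m. The projection π₊ for the shift m factors through the one for l, by a
surjection of H⁺ for l onto H⁺ for m whose kernel is spanned by the eigenvectors with eigenvalue in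
(l, m). So moving the left shift from l to m composes the augmented operator with a surjection whose
kernel has dimension ρ(l, m), and the index grows by this number (`fredholmIndex_augOp_left`). At
the right end H⁻ grows with the shift, which reverses the sign (`fredholmIndex_augOp_right`). -/

noncomputable section

/-! ### Norm limits of finite rank operators and Fredholm operators -/

section Fredholm

variable {E F G : Type*} [NormedAddCommGroup E] [NormedSpace ℝ E] [NormedAddCommGroup F]
  [NormedSpace ℝ F] [NormedAddCommGroup G] [NormedSpace ℝ G]

/-- An operator that can be approximated in norm by operators of finite rank. -/
def IsFiniteRankLimit (u : E →L[ℝ] F) : Prop :=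
  ∀ ε : ℝ, 0 < ε → ∃ Φ : E →L[ℝ] F, Φ.toLinearMap.HasFiniteRange ∧ ‖u - Φ‖ ≤ ε

theorem IsFiniteRankLimit.of_hasFiniteRange {u : E →L[ℝ] F} (hu : u.toLinearMap.HasFiniteRange) :
    IsFiniteRankLimit u := fun ε hε => ⟨u, hu, by simpa using hε.le⟩

theorem IsFiniteRankLimit.add {u v : E →L[ℝ] F} (hu : IsFiniteRankLimit u)
    (hv : IsFiniteRankLimit v) : IsFiniteRankLimit (u + v) := fun ε hε => by
  obtain ⟨Φ, h1, h2⟩ := hu (ε / 2) (half_pos hε)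
  obtain ⟨Ψ, h3, h4⟩ := hv (ε / 2) (half_pos hε)
  refine ⟨Φ + Ψ, h1.add h3, ?_⟩
  rw [add_sub_add_comm]
  exact (norm_add_le _ _).trans (by linarith)

theorem IsFiniteRankLimit.sum {κ : Type*} (s : Finset κ) {u : κ → E →L[ℝ] F}
    (hu : ∀ i ∈ s, IsFiniteRankLimit (u i)) : IsFiniteRankLimit (∑ i ∈ s, u i) :=
  Finset.sum_induction _ _ (fun _ _ => IsFiniteRankLimit.add)
    (.of_hasFiniteRange LinearMap.HasFiniteRange.zero) hu

theorem IsFiniteRankLimit.clm_comp {u : E →L[ℝ] F} (hu : IsFiniteRankLimit u) (v : F →L[ℝ] G) :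
    IsFiniteRankLimit (v ∘L u) := fun ε hε => by
  obtain ⟨Φ, h1, h2⟩ := hu (ε / (‖v‖ + 1)) (by positivity)
  refine ⟨v ∘L Φ, h1.comp_left v.toLinearMap, ?_⟩
  rw [← ContinuousLinearMap.comp_sub]
  refine (ContinuousLinearMap.opNorm_comp_le _ _).trans ?_
  calc ‖v‖ * ‖u - Φ‖ ≤ (‖v‖ + 1) * (ε / (‖v‖ + 1)) := by gcongr; linarith
    _ = ε := by field_simp

theorem IsFiniteRankLimit.comp_clm {v : F →L[ℝ] G} (hv : IsFiniteRankLimit v) (u : E →L[ℝ] F) :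
    IsFiniteRankLimit (v ∘L u) := fun ε hε => by
  obtain ⟨Φ, h1, h2⟩ := hv (ε / (‖u‖ + 1)) (by positivity)
  refine ⟨Φ ∘L u, h1.comp_right u.toLinearMap, ?_⟩
  rw [← ContinuousLinearMap.sub_comp]
  refine (ContinuousLinearMap.opNorm_comp_le _ _).trans ?_
  calc ‖v - Φ‖ * ‖u‖ ≤ (ε / (‖u‖ + 1)) * (‖u‖ + 1) := by gcongr; linarith
    _ = ε := by field_simp

open scoped LinearMap.FiniteRangeSetoid in
-- If `Φ` has finite rank and `‖u - Φ‖ ≤ 1/2`, then `1 - (u - Φ)` is invertible by the Neumann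
-- series. It differs from `1 - u` by `Φ`, so its inverse is a quasi-inverse of `1 - u`.
theorem IsFiniteRankLimit.exists_isQuasiInverse [CompleteSpace E] {u : E →L[ℝ] E}
    (hu : IsFiniteRankLimit u) :
    ∃ Q : E →L[ℝ] E, Q.toLinearMap.IsQuasiInverse (1 - u).toLinearMap := by
  obtain ⟨Φ, h1, h2⟩ := hu (1 / 2) (by norm_num)
  let U := Units.oneSub (u - Φ) (h2.trans_lt (by norm_num))
  have hU : (U : E →L[ℝ] E) = 1 - (u - Φ) := rfl
  refine ⟨(U⁻¹ : (E →L[ℝ] E)ˣ), LinearMap.IsQuasiInverse.congr (v := (U : E →L[ℝ] E).toLinearMap)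
    ⟨?_, ?_⟩ (Setoid.refl _) ?_⟩
  · have : (((U⁻¹ : (E →L[ℝ] E)ˣ) : E →L[ℝ] E).toLinearMap ∘ₗ (U : E →L[ℝ] E).toLinearMap) =
        LinearMap.id := congrArg ContinuousLinearMap.toLinearMap U.inv_mul
    rw [LinearMap.IsLeftQuasiInverse, this]
  · have : ((U : E →L[ℝ] E).toLinearMap ∘ₗ ((U⁻¹ : (E →L[ℝ] E)ˣ) : E →L[ℝ] E).toLinearMap) =
        LinearMap.id := congrArg ContinuousLinearMap.toLinearMap U.mul_inv
    rw [LinearMap.IsRightQuasiInverse, this]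
  · rw [LinearMap.FiniteRangeSetoid.equiv_iff_hasFiniteRange]
    have : (1 - u).toLinearMap - (U : E →L[ℝ] E).toLinearMap = -Φ.toLinearMap := by
      ext x
      simp [hU]
    rw [this]
    exact h1.neg

open scoped LinearMap.FiniteRangeSetoid in
/-- An operator with a left and a right parametrix is Fredholm. -/
theorem isFredholm_of_parametrix [CompleteSpace E] [CompleteSpace F] {D : E →L[ℝ] F}
    {L R : F →L[ℝ] E} {k : E →L[ℝ] E} {k' : F →L[ℝ] F} (hL : L ∘L D = 1 - k)
    (hR : D ∘L R = 1 - k') (hk : IsFiniteRankLimit k) (hk' : IsFiniteRankLimit k') :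
    D.IsFredholm := by
  obtain ⟨Q, hQ⟩ := hk.exists_isQuasiInverse
  obtain ⟨Q', hQ'⟩ := hk'.exists_isQuasiInverse
  rw [← hL] at hQ
  rw [← hR] at hQ'
  have h1 : (Q ∘L L).toLinearMap ∘ₗ D.toLinearMap ≈ LinearMap.id := hQ.1
  have h2 : D.toLinearMap ∘ₗ (R ∘L Q').toLinearMap ≈ LinearMap.id := hQ'.2
  refine ContinuousLinearMap.IsFredholm.of_isQuasiInverse (v := Q ∘L L) ⟨h1, ?_⟩
  -- A left and a right quasi-inverse agree modulo finite rank: both are equivalent to the triple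
  -- product with `D` in the middle.
  have h3 : (Q ∘L L).toLinearMap ≈ (R ∘L Q').toLinearMap := by
    have h4 := LinearMap.FiniteRangeSetoid.equiv_comp_left (u' := (Q ∘L L).toLinearMap) h2
    have h5 := LinearMap.FiniteRangeSetoid.equiv_comp_right (u := (R ∘L Q').toLinearMap) h1
    rw [LinearMap.comp_id] at h4
    rw [LinearMap.id_comp, LinearMap.comp_assoc] at h5
    exact Setoid.trans (Setoid.symm h4) h5
  exact Setoid.trans (LinearMap.FiniteRangeSetoid.equiv_comp_left h3) h2

/-- Composing with a surjection adds the dimension of its kernel to the index. -/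
theorem fredholmIndex_comp_of_surjective {D : E →L[ℝ] F} (hD : D.IsFredholm) {p : F →L[ℝ] G}
    (hp : Function.Surjective p) [FiniteDimensional ℝ (LinearMap.ker p.toLinearMap)] :
    fredholmIndex (p ∘L D) = fredholmIndex D +
      Module.finrank ℝ (LinearMap.ker p.toLinearMap) := by
  have := hD.finite_ker
  have : FiniteDimensional ℝ (F ⧸ D.toLinearMap.range) := hD.finite_coker
  have hr : p.toLinearMap.range = ⊤ := LinearMap.range_eq_top.2 hp
  have : FiniteDimensional ℝ (G ⧸ p.toLinearMap.range) := by rw [hr]; infer_instance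
  have h := LinearMap.index_comp (f := D.toLinearMap) p.toLinearMap
  rw [LinearMap.index_of_surjective (f := p.toLinearMap) hp, LinearMap.index_eq_finrank_sub,
    LinearMap.index_eq_finrank_sub, add_comm] at h
  exact h

end Fredholm

/-! ### The Hilbert space of a symmetrizing inner product -/

section Symmetrizer

universe u

/-- A copy of a vector space without its norm. -/
def SpaceCopy (H : Type*) : Type _ := H

instance {H : Type*} [NormedAddCommGroup H] : AddCommGroup (SpaceCopy H) :=
  inferInstanceAs (AddCommGroup H)

instance {H : Type*} [NormedAddCommGroup H] [InnerProductSpace ℝ H] : Module ℝ (SpaceCopy H) :=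
  inferInstanceAs (Module ℝ H)

/-- An equivalent inner product is the pullback of the inner product of a Hilbert space under a
topological isomorphism. -/
theorem exists_hilbertSpace_of_equivalent {H : Type u} [NormedAddCommGroup H]
    [InnerProductSpace ℝ H] [CompleteSpace H] (B : LinearMap.BilinForm ℝ H)
    (hsymm : ∀ x y, B x y = B y x) {c : ℝ} (hc : 0 < c)
    (hB : ∀ x, c⁻¹ * ‖x‖ ≤ √(B x x) ∧ √(B x x) ≤ c * ‖x‖) :
    ∃ (K : Type u) (_ : NormedAddCommGroup K) (_ : InnerProductSpace ℝ K) (_ : CompleteSpace K)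
      (e : H ≃L[ℝ] K), ∀ x y, inner ℝ (e x) (e y) = B x y := by
  -- The square root of a negative number is `0` by convention, so the lower bound would force a
  -- vector with `B x x < 0` to vanish.
  have hnn : ∀ x, 0 ≤ B x x := fun x => by
    by_contra hneg
    have h1 := (hB x).1
    rw [Real.sqrt_eq_zero_of_nonpos (not_le.1 hneg).le] at h1
    have h2 : ‖x‖ ≤ 0 := nonpos_of_mul_nonpos_right h1 (by positivity)
    rw [norm_le_zero_iff] at h2
    simp [h2] at hneg
  have hdef : ∀ x, B x x = 0 → x = 0 := fun x hx => by
    have h1 := (hB x).1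
    rw [hx, Real.sqrt_zero] at h1
    exact norm_le_zero_iff.1 (nonpos_of_mul_nonpos_right h1 (by positivity))
  let core : InnerProductSpace.Core ℝ (SpaceCopy H) :=
    { inner := fun x y => B x y
      conj_inner_symm := fun x y => by simpa using hsymm y x
      re_inner_nonneg := fun x => by simpa using hnn x
      add_left := fun x y z => LinearMap.map_add₂ B (x : H) y z
      smul_left := fun x y r => LinearMap.map_smul₂ B r (x : H) y
      definite := hdef }
  let i1 : NormedAddCommGroup (SpaceCopy H) := core.toNormedAddCommGroup
  let i2 : InnerProductSpace ℝ (SpaceCopy H) := InnerProductSpace.ofCore core.toCore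
  let e₀ : H ≃ₗ[ℝ] SpaceCopy H := LinearEquiv.refl ℝ H
  have h1 : Continuous e₀ := (LinearMap.mkContinuous e₀.toLinearMap c fun x => (hB x).2).continuous
  have h2 : Continuous e₀.symm :=
    (LinearMap.mkContinuous e₀.symm.toLinearMap c fun x => by
      have := (hB x).1
      rw [inv_mul_le_iff₀ hc] at this
      exact this).continuous
  let e : H ≃L[ℝ] SpaceCopy H := ⟨e₀, h1, h2⟩
  have hcomp : CompleteSpace (SpaceCopy H) :=
    (completeSpace_congr (e := e.toEquiv) e.isUniformEmbedding).1 inferInstance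
  exact ⟨SpaceCopy H, i1, i2, hcomp, e, fun x y => rfl⟩

end Symmetrizer
end
noncomputable section

/-! ### Eigensystems of symmetrizable operators -/

/-- Each ball of radius `ε / 2` contains at most one of the points, and finitely many such balls
cover the compact set. -/
theorem finite_of_separated {E n : Type*} [NormedAddCommGroup E]
    {s : Set n} {f : n → E} {S : Set E} (hS : IsCompact S)
    {ε : ℝ} (hε : 0 < ε) (hf : ∀ i ∈ s, f i ∈ S)
    (hsep : ∀ i ∈ s, ∀ j ∈ s, i ≠ j → ε ≤ ‖f i - f j‖) : s.Finite := by
  obtain ⟨t, -, ht, hcov⟩ := hS.finite_cover_balls (half_pos hε)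
  have hsub : s ⊆ ⋃ x ∈ t, {i ∈ s | f i ∈ Metric.ball x (ε / 2)} := fun i hi => by
    obtain ⟨x, hx, hix⟩ := mem_iUnion₂.1 (hcov (hf i hi))
    exact mem_iUnion₂.2 ⟨x, hx, hi, hix⟩
  refine (ht.biUnion fun x _ => Set.Subsingleton.finite ?_).subset hsub
  rintro i ⟨hi, hi'⟩ j ⟨hj, hj'⟩
  by_contra hij
  have h1 := hsep i hi j hj hij
  have h2 := dist_triangle_right (f i) (f j) x
  rw [Metric.mem_ball] at hi' hj'
  rw [dist_eq_norm] at h2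
  linarith

namespace HilbertPair

variable {H₀ H₁ : Type*} [NormedAddCommGroup H₀] [InnerProductSpace ℝ H₀] [CompleteSpace H₀]
  [NormedAddCommGroup H₁] [InnerProductSpace ℝ H₁] [CompleteSpace H₁] (P : HilbertPair H₀ H₁)

/-- A complete system of eigenvectors `v i` of `A` with eigenvalues `a i`, together with the
coordinate functionals `coef i`. The vectors `ι (v i)` form a Riesz basis of `H₀`. -/
structure EigenSystem (A : H₁ →L[ℝ] H₀) where
  idx : Type
  a : idx → ℝ
  v : idx → H₁
  coef : idx → H₀ →L[ℝ] ℝ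
  c : ℝ
  c_pos : 0 < c
  eigen : ∀ i, A (v i) = a i • P.incl (v i)
  coef_self : ∀ i, coef i (P.incl (v i)) = 1
  coef_ne : ∀ i j, i ≠ j → coef i (P.incl (v j)) = 0
  coef_op : ∀ i x, coef i (A x) = a i * coef i (P.incl x)
  bessel : ∀ (F : Finset idx) x, ∑ i ∈ F, coef i x ^ 2 ≤ c * ‖x‖ ^ 2
  parseval : ∀ x, ‖x‖ ^ 2 ≤ c * ∑' i, coef i x ^ 2
  dense_span : (Submodule.span ℝ (range fun i => P.incl (v i))).topologicalClosure = ⊤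
  exists_proj : ∀ s : Set idx, ∃ S : H₀ →L[ℝ] H₀, ∀ x i,
    (i ∈ s → coef i (S x) = coef i x) ∧ (i ∉ s → coef i (S x) = 0)
  finite : ∀ M : ℝ, {i | |a i| ≤ M}.Finite

variable {P}

theorem resolventSet_bijective {A : H₁ →L[ℝ] H₀} {r : ℝ} (hr : r ∈ P.resolventSet A) :
    Function.Bijective (P.shift A r) := not_not.1 hr

theorem IsSymmetrizable.shift {A : H₁ →L[ℝ] H₀} (hA : P.IsSymmetrizable A) (r : ℝ) :
    P.IsSymmetrizable (P.shift A r) := by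
  obtain ⟨B, hs, hc, hB⟩ := hA
  refine ⟨B, hs, hc, fun x y => ?_⟩
  simp [HilbertPair.shift, hB]

/-- The inverse of a bijective bounded operator. -/
theorem exists_equiv_of_bijective {C : H₁ →L[ℝ] H₀} (hC : Function.Bijective C) :
    ∃ Ceq : H₁ ≃L[ℝ] H₀, (Ceq : H₁ →L[ℝ] H₀) = C :=
  ⟨ContinuousLinearEquiv.ofBijective C (LinearMap.ker_eq_bot.2 hC.1)
    (LinearMap.range_eq_top.2 hC.2), by ext; rfl⟩

/-- In the Hilbert space `K` of the symmetrizing inner product, the inverse of `A - r ι` followed by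
`ι` becomes a compact, symmetric, injective operator `W`. An orthonormal basis of eigenvectors of
`W` with eigenvalues w consists of eigenvectors of `A` with eigenvalues w⁻¹ + r. The topological
isomorphism `e` turns the orthonormal basis into a Riesz basis of H₀. -/
theorem exists_eigenSystem {A : H₁ →L[ℝ] H₀} (hA : P.IsSymmetrizable A) {r : ℝ}
    (hr : Function.Bijective (P.shift A r)) : Nonempty (P.EigenSystem A) := by
  obtain ⟨B, hs, ⟨c₀, hc₀, hBc⟩, hB⟩ := hA
  obtain ⟨K, _, _, _, e, he⟩ := exists_hilbertSpace_of_equivalent B hs hc₀ hBc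
  obtain ⟨Ceq, hC⟩ := exists_equiv_of_bijective hr
  have hCx : ∀ x, Ceq x = A x - r • P.incl x := fun x => by
    change (Ceq : H₁ →L[ℝ] H₀) x = _
    rw [hC]; rfl
  have hAsymm : ∀ x y, inner ℝ (e (A x)) (e (P.incl y)) = inner ℝ (e (P.incl x)) (e (A y)) :=
    fun x y => by rw [he, he, hB]
  let W : K →L[ℝ] K := (e : H₀ →L[ℝ] K) ∘L P.incl ∘L (Ceq.symm : H₀ →L[ℝ] H₁) ∘L
    (e.symm : K →L[ℝ] H₀)
  have hWe : ∀ x, W (e (Ceq x)) = e (P.incl x) := fun x => by simp [W]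
  have hWc : IsCompactOperator W :=
    (P.incl_compact.comp_clm ((Ceq.symm : H₀ →L[ℝ] H₁) ∘L (e.symm : K →L[ℝ] H₀))).clm_comp
      (e : H₀ →L[ℝ] K)
  have hWs : (W : K →ₗ[ℝ] K).IsSymmetric := fun x y => by
    obtain ⟨x, rfl⟩ := e.surjective x
    obtain ⟨x, rfl⟩ := Ceq.surjective x
    obtain ⟨y, rfl⟩ := e.surjective y
    obtain ⟨y, rfl⟩ := Ceq.surjective y
    change inner ℝ (W _) _ = inner ℝ _ (W _)
    rw [hWe, hWe, hCx, hCx, map_sub, map_sub, map_smul, map_smul, inner_sub_left,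
      inner_sub_right, hAsymm, real_inner_smul_left, real_inner_smul_right]
  have hWinj : ∀ x, W x = 0 → x = 0 := fun x hx => by
    obtain ⟨x, rfl⟩ := e.surjective x
    obtain ⟨x, rfl⟩ := Ceq.surjective x
    rw [hWe, map_eq_zero_iff _ e.injective, map_eq_zero_iff _ P.incl_injective] at hx
    simp [hx]
  -- Compactness covers `w ≠ 0` only; for `w = 0` the eigenspace is trivial by injectivity.
  have hfin : ∀ w : ℝ, FiniteDimensional ℝ (Module.End.eigenspace (W : K →ₗ[ℝ] K) w) := fun w => by
    by_cases hw : w = 0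
    · have : Module.End.eigenspace (W : K →ₗ[ℝ] K) w = ⊥ := by
        rw [hw, Module.End.eigenspace_zero, LinearMap.ker_eq_bot']
        exact hWinj
      rw [this]; infer_instance
    · exact ContinuousLinearMap.finite_dimensional_eigenspace hWc w hw
  have hon := hWs.orthogonalFamily_eigenspaces.orthonormal_sigma_orthonormal
    (v_family := fun w => stdOrthonormalBasis ℝ (Module.End.eigenspace (W : K →ₗ[ℝ] K) w))
    fun w => (stdOrthonormalBasis ℝ _).orthonormal
  let n := Σ w : ℝ, Fin (Module.finrank ℝ (Module.End.eigenspace (W : K →ₗ[ℝ] K) w))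
  have hspan : (Submodule.span ℝ (range fun i : n => (Module.End.eigenspace (W : K →ₗ[ℝ] K)
      i.1).subtypeₗᵢ (stdOrthonormalBasis ℝ _ i.2)))ᗮ = ⊥ := by
    rw [eq_bot_iff, ← ContinuousLinearMap.orthogonalComplement_iSup_eigenspaces_eq_bot hWc hWs]
    refine Submodule.orthogonal_le (iSup_le fun w x hx => ?_)
    have h1 := (stdOrthonormalBasis ℝ (Module.End.eigenspace (W : K →ₗ[ℝ] K) w)).sum_repr ⟨x, hx⟩
    have h2 : (∑ j, (stdOrthonormalBasis ℝ (Module.End.eigenspace (W : K →ₗ[ℝ] K) w)).repr ⟨x, hx⟩ j •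
        (stdOrthonormalBasis ℝ (Module.End.eigenspace (W : K →ₗ[ℝ] K) w) j : K)) = x := by
      simpa using congrArg Subtype.val h1
    rw [← h2]
    exact Submodule.sum_mem _ fun j _ => Submodule.smul_mem _ _
      (Submodule.subset_span ⟨⟨w, j⟩, rfl⟩)
  let b : HilbertBasis n ℝ K := HilbertBasis.mkOfOrthogonalEqBot hon hspan
  have hbW : ∀ i, W (b i) = i.1 • b i := fun i => by
    have : b i ∈ Module.End.eigenspace (W : K →ₗ[ℝ] K) i.1 := by
      rw [HilbertBasis.coe_mkOfOrthogonalEqBot]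
      exact Subtype.property _
    exact Module.End.mem_eigenspace_iff.1 this
  have hb0 : ∀ i, b i ≠ 0 := fun i => b.orthonormal.ne_zero i
  have hi0 : ∀ i : n, i.1 ≠ 0 := fun i h => hb0 i (hWinj _ (by rw [hbW, h, zero_smul]))
  -- The factor `i.1⁻¹` normalizes the eigenvector so that its image under `e ∘ ι` is exactly `b i`.
  let v : n → H₁ := fun i => Ceq.symm (e.symm (i.1⁻¹ • b i))
  have hev : ∀ i, e (P.incl (v i)) = b i := fun i => by
    change W (i.1⁻¹ • b i) = b i
    rw [map_smul, hbW, smul_smul, inv_mul_cancel₀ (hi0 i), one_smul]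
  have hCv : ∀ i, Ceq (v i) = i.1⁻¹ • P.incl (v i) := fun i => by
    apply e.injective
    rw [map_smul e, hev]
    simp only [v, ContinuousLinearEquiv.apply_symm_apply]
  have hAv : ∀ i, A (v i) = (i.1⁻¹ + r) • P.incl (v i) := fun i => by
    rw [add_smul, ← hCv, hCx]; abel
  let coef : n → H₀ →L[ℝ] ℝ := fun i => (innerSL ℝ (b i)) ∘L (e : H₀ →L[ℝ] K)
  have hcoef : ∀ i x, coef i x = inner ℝ (b i) (e x) := fun i x => rfl
  -- One constant that bounds the squared norms of both `e` and its inverse; the summand 1 keeps it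
  -- positive.
  set c : ℝ := (‖(e : H₀ →L[ℝ] K)‖ + ‖(e.symm : K →L[ℝ] H₀)‖ + 1) ^ 2 with hc
  have hc0 : 0 < c := by positivity
  have hle : ∀ x, ‖e x‖ ^ 2 ≤ c * ‖x‖ ^ 2 := fun x => by
    rw [hc, ← mul_pow]
    gcongr
    refine ((e : H₀ →L[ℝ] K).le_opNorm x).trans ?_
    gcongr
    linarith [norm_nonneg (e.symm : K →L[ℝ] H₀)]
  have hge : ∀ x, ‖x‖ ^ 2 ≤ c * ‖e x‖ ^ 2 := fun x => by
    rw [hc, ← mul_pow]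
    have := (e.symm : K →L[ℝ] H₀).le_opNorm (e x)
    simp only [ContinuousLinearEquiv.coe_coe, ContinuousLinearEquiv.symm_apply_apply] at this
    gcongr
    refine this.trans ?_
    gcongr
    linarith [norm_nonneg (e : H₀ →L[ℝ] K)]
  have hpars : ∀ x, ∑' i, coef i x ^ 2 = ‖e x‖ ^ 2 := fun x => by
    rw [← real_inner_self_eq_norm_sq, ← b.tsum_inner_mul_inner]
    refine tsum_congr fun i => ?_
    rw [hcoef, pow_two, real_inner_comm]
  have hbess : ∀ (F : Finset n) x, ∑ i ∈ F, coef i x ^ 2 ≤ c * ‖x‖ ^ 2 := fun F x => by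
    refine le_trans ?_ (hle x)
    have := b.orthonormal.sum_inner_products_le (e x) (s := F)
    simpa [hcoef] using this
  have hself : ∀ i, coef i (P.incl (v i)) = 1 := fun i => by
    rw [hcoef, hev, real_inner_self_eq_norm_sq, b.orthonormal.1, one_pow]
  have hne : ∀ i j, i ≠ j → coef i (P.incl (v j)) = 0 := fun i j hij => by
    rw [hcoef, hev, b.orthonormal.2 hij]
  refine ⟨⟨n, fun i => i.1⁻¹ + r, v, coef, c, hc0, hAv, hself, hne, fun i x => ?_, hbess,
    fun x => ?_, ?_, fun s => ?_, fun M => ?_⟩⟩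
  · rw [hcoef, hcoef, real_inner_comm, ← hev, hAsymm, hAv, map_smul, real_inner_smul_right,
      real_inner_comm]
  · rw [hpars]; exact hge x
  · have h1 : (Submodule.span ℝ (range fun i => P.incl (v i))).map (e : H₀ →L[ℝ] K).toLinearMap =
        Submodule.span ℝ (range b) := by
      rw [Submodule.map_span, ← range_comp]
      congr 2
      funext i
      exact hev i
    rw [eq_top_iff]
    intro x _
    have h2 : e x ∈ closure (e '' (Submodule.span ℝ (range fun i => P.incl (v i)) : Set H₀)) := by
      have h3 : (e '' (Submodule.span ℝ (range fun i => P.incl (v i)) : Set H₀)) =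
          (Submodule.span ℝ (range b) : Set K) := by rw [← h1]; rfl
      rw [h3, ← Submodule.topologicalClosure_coe, b.dense_span]
      trivial
    change e x ∈ closure (e.toHomeomorph '' _) at h2
    rw [← e.toHomeomorph.image_closure] at h2
    obtain ⟨y, hy, hxy⟩ := h2
    rw [← e.injective hxy]
    exact hy
  -- The projection is the orthogonal projection of `K` onto the closed span of the chosen basis
  -- vectors, carried back to H₀ by `e`.
  · let V : Submodule ℝ K := (Submodule.span ℝ (b '' s)).topologicalClosure
    have hVc : CompleteSpace V := (Submodule.isClosed_topologicalClosure _).completeSpace_coe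
    refine ⟨(e.symm : K →L[ℝ] H₀) ∘L V.starProjection ∘L (e : H₀ →L[ℝ] K), fun x i => ⟨fun hi => ?_,
      fun hi => ?_⟩⟩
    · rw [hcoef, hcoef]
      simp only [ContinuousLinearMap.comp_apply, ContinuousLinearEquiv.coe_coe,
        ContinuousLinearEquiv.apply_symm_apply]
      have hm : b i ∈ V := Submodule.le_topologicalClosure _ (Submodule.subset_span ⟨i, hi, rfl⟩)
      rw [← Submodule.inner_starProjection_left_eq_right,
        Submodule.starProjection_eq_self_iff.2 hm]
    · rw [hcoef]
      simp only [ContinuousLinearMap.comp_apply, ContinuousLinearEquiv.coe_coe,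
        ContinuousLinearEquiv.apply_symm_apply]
      have hm : V ≤ (ℝ ∙ b i)ᗮ := by
        refine Submodule.topologicalClosure_minimal _ (Submodule.span_le.2 ?_)
          (Submodule.isClosed_orthogonal _)
        rintro _ ⟨j, hj, rfl⟩
        rw [SetLike.mem_coe, Submodule.mem_orthogonal_singleton_iff_inner_right]
        exact b.orthonormal.2 fun h => hi (h ▸ hj)
      exact Submodule.mem_orthogonal_singleton_iff_inner_right.1
        (hm (Submodule.starProjection_apply_mem _ _))
  -- If `|a i| ≤ M`, then `v i`, the inverse of `A - r ι` applied to a bounded vector, is bounded in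
  -- H₁, so `ι (v i)` stays in a compact set. Bessel's inequality for `ι (v i) - ι (v j)`, whose
  -- `i`-th coordinate is 1, keeps these vectors apart.
  · obtain ⟨S, hS, hsub⟩ := IsCompactOperator.image_closedBall_subset_compact
      (𝕜₁ := ℝ) (f := P.incl.toLinearMap) P.incl_compact
      (‖(Ceq.symm : H₀ →L[ℝ] H₁)‖ * ((M + |r|) * √c))
    have hbd : ∀ i, ‖P.incl (v i)‖ ≤ √c := fun i => by
      refine Real.le_sqrt_of_sq_le ((hge _).trans ?_)
      rw [hev, b.orthonormal.1]; simp
    refine finite_of_separated (f := fun i => P.incl (v i)) hS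
      (ε := √c⁻¹) (Real.sqrt_pos.2 (inv_pos.2 hc0)) (fun i hi => hsub ⟨v i, ?_, rfl⟩)
      (fun i _ j _ hij => ?_)
    · rw [mem_closedBall_zero_iff]
      have h1 : v i = (Ceq.symm : H₀ →L[ℝ] H₁) (i.1⁻¹ • P.incl (v i)) := by
        rw [← hCv]; simp
      rw [h1]
      refine (ContinuousLinearMap.le_opNorm _ _).trans ?_
      gcongr
      rw [norm_smul]
      have h2 : ‖i.1⁻¹‖ ≤ M + |r| := by
        have h3 : |i.1⁻¹ + r| ≤ M := hi
        rw [Real.norm_eq_abs]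
        have h4 := abs_sub (i.1⁻¹ + r) r
        rw [add_sub_cancel_right] at h4
        linarith
      exact mul_le_mul h2 (hbd i) (norm_nonneg _) ((norm_nonneg _).trans h2)
    · refine Real.sqrt_le_iff.2 ⟨norm_nonneg _, ?_⟩
      have h1 := hbess {i} (P.incl (v i) - P.incl (v j))
      rw [Finset.sum_singleton, map_sub, hself, hne i j hij] at h1
      rw [inv_le_iff_one_le_mul₀ hc0]
      linarith

end HilbertPair
end
noncomputable section

/-! ### The interpolation inequality -/

theorem integrableOn_Ioi_sq_div {N : ℝ} (hN : 0 ≤ N) :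
    IntegrableOn (fun t : ℝ => N ^ 2 * (1 + (N * t) ^ 2)⁻¹) (Ioi 0) := by
  rcases hN.eq_or_lt with rfl | hN
  · simp
  refine Integrable.const_mul ?_ _
  have := (integrableOn_Ioi_comp_mul_left_iff (fun t : ℝ => (1 + t ^ 2)⁻¹) 0 hN).2
    (integrable_inv_one_add_sq.integrableOn)
  exact this

/-- This writes the weight `N` as a superposition over `t` of the weights N² / (1 + N² t²). These
come from minimizing the sum of an H₀-norm and `t` times an H₁-norm, which is how H_{1/2} arises
from H₀ and H₁. -/
theorem integral_Ioi_sq_div {N : ℝ} (hN : 0 ≤ N) :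
    ∫ t in Ioi (0 : ℝ), N ^ 2 * (1 + (N * t) ^ 2)⁻¹ = N * (Real.pi / 2) := by
  rcases hN.eq_or_lt with rfl | hN
  · simp
  rw [integral_const_mul, integral_comp_mul_left_Ioi (fun t : ℝ => (1 + t ^ 2)⁻¹) 0 hN, mul_zero,
    integral_Ioi_inv_one_add_sq, Real.arctan_zero, sub_zero, smul_eq_mul]
  field_simp

namespace HilbertPair

variable {H₀ H₁ : Type*} [NormedAddCommGroup H₀] [InnerProductSpace ℝ H₀] [CompleteSpace H₀]
  [NormedAddCommGroup H₁] [InnerProductSpace ℝ H₁] [CompleteSpace H₁] (P : HilbertPair H₀ H₁)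

theorem comp_comp_self (κ : Ioi (0 : ℝ)) (x : H₀) : P.comp κ (P.comp κ x) = P.comp κ x :=
  Submodule.starProjection_eq_self_iff.2 (P.comp_mem κ x)

theorem comp_comp_of_ne {κ κ' : Ioi (0 : ℝ)} (h : κ ≠ κ') (x : H₀) :
    P.comp κ (P.comp κ' x) = 0 := by
  have h1 := P.inner_comp_self κ (P.comp κ' x)
  rw [P.inner_comp_of_ne h] at h1
  simpa using h1.symm

/-- The expansion of a vector of `H₀` into eigenvectors of the growth operator. -/
theorem hasSum_comp (x : H₀) : HasSum (fun κ : Ioi (0 : ℝ) => P.comp κ x) x := by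
  have hV : OrthogonalFamily ℝ (fun κ : Ioi (0 : ℝ) => P.growthEigenspace κ)
      fun κ => (P.growthEigenspace κ).subtypeₗᵢ := fun κ κ' hne y z => by
    have h1 : P.comp κ y = y := Submodule.starProjection_eq_self_iff.2 y.2
    have h2 : P.comp κ' z = z := Submodule.starProjection_eq_self_iff.2 z.2
    change inner ℝ (y : H₀) (z : H₀) = 0
    rw [← h1, ← h2, P.inner_comp_of_ne hne]
  have hs : Summable fun κ : Ioi (0 : ℝ) => P.comp κ x := by
    refine (hV.summable_iff_norm_sq_summable fun κ => ⟨P.comp κ x, P.comp_mem κ x⟩).2 ?_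
    exact summable_of_sum_le (fun κ => sq_nonneg _) fun F => P.sum_norm_comp_sq_le F x
  have h0 : x - ∑' κ : Ioi (0 : ℝ), P.comp κ x = 0 := by
    refine P.eq_zero_of_comp_eq_zero fun κ => ?_
    rw [map_sub, (P.comp κ).map_tsum hs, tsum_eq_single κ fun κ' h => P.comp_comp_of_ne h.symm x,
      comp_comp_self, sub_self]
  have := hs.hasSum
  rwa [← sub_eq_zero.1 h0] at this

theorem hasSum_norm_comp_sq (x : H₀) :
    HasSum (fun κ : Ioi (0 : ℝ) => ‖P.comp κ x‖ ^ 2) (‖x‖ ^ 2) := by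
  have h := (innerSL ℝ x).hasSum (P.hasSum_comp x)
  rw [innerSL_apply_apply, real_inner_self_eq_norm_sq] at h
  refine h.congr_fun fun κ => ?_
  rw [innerSL_apply_apply, real_inner_comm, inner_comp_self]

variable {P} in
theorem sqrt_le_of_comp_ne_zero {κ : Ioi (0 : ℝ)} {x : H₀} (h : P.comp κ x ≠ 0) :
    √(κ : ℝ) ≤ ‖P.incl‖ := by
  refine Real.sqrt_le_iff.2 ⟨norm_nonneg _, ?_⟩
  by_contra hlt
  exact h (comp_eq_zero_of_lt (not_le.1 hlt) x)

theorem rpow_neg_half (κ : Ioi (0 : ℝ)) : (κ : ℝ) ^ (-(1 / 2) : ℝ) = (√(κ : ℝ))⁻¹ := by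
  have hκ : (0 : ℝ) < κ := κ.2
  rw [Real.rpow_neg hκ.le, ← Real.sqrt_eq_rpow]

variable {P} in
theorem summable_half (x : P.Half) : Summable fun κ : Ioi (0 : ℝ) =>
    (κ : ℝ) ^ (-(1 / 2) : ℝ) * ‖P.comp κ (P.halfIncl x)‖ ^ 2 := x.2

variable {P} in
-- Only components with √κ ≤ ‖ι‖ are nonzero, and for these κ^{-1/2} is at least ‖ι‖⁻¹.
theorem norm_halfIncl_sq_le (x : P.Half) : ‖P.halfIncl x‖ ^ 2 ≤ ‖P.incl‖ * ‖x‖ ^ 2 := by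
  rw [Half.norm_sq, ← (P.hasSum_norm_comp_sq _).tsum_eq, ← tsum_mul_left]
  refine (P.hasSum_norm_comp_sq _).summable.tsum_le_tsum (fun κ => ?_)
    ((summable_half x).mul_left _)
  have hκ : (0 : ℝ) < κ := κ.2
  by_cases h : P.comp κ (P.halfIncl x) = 0
  · simp [h]
  · rw [rpow_neg_half, ← mul_assoc]
    refine le_mul_of_one_le_left (sq_nonneg _) ?_
    rw [← div_eq_mul_inv, one_le_div (Real.sqrt_pos.2 hκ)]
    exact sqrt_le_of_comp_ne_zero h

/-- The continuous inclusion `H_{1/2} → H₀`. -/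
def halfInclL : P.Half →L[ℝ] H₀ :=
  LinearMap.mkContinuous P.halfIncl (√‖P.incl‖) fun x => by
    rw [← Real.sqrt_sq (norm_nonneg x), ← Real.sqrt_mul (norm_nonneg _)]
    exact Real.le_sqrt_of_sq_le (norm_halfIncl_sq_le x)

variable {P} in
-- On nonzero components κ^{-1/2} ≤ ‖ι‖ κ⁻¹, and κ⁻¹ is the weight of H₁.
theorem sum_half_incl_le (y : H₁) (F : Finset (Ioi (0 : ℝ))) :
    ∑ κ ∈ F, (κ : ℝ) ^ (-(1 / 2) : ℝ) * ‖P.comp κ (P.incl y)‖ ^ 2 ≤ ‖P.incl‖ * ‖y‖ ^ 2 := by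
  refine le_trans ?_ (mul_le_mul_of_nonneg_left (P.sum_norm_comp_incl_sq_le F y) (norm_nonneg _))
  rw [Finset.mul_sum]
  refine Finset.sum_le_sum fun κ _ => ?_
  have hκ : (0 : ℝ) < κ := κ.2
  by_cases h : P.comp κ (P.incl y) = 0
  · simp [h]
  · rw [rpow_neg_half, ← mul_assoc]
    refine mul_le_mul_of_nonneg_right ?_ (sq_nonneg _)
    rw [← div_eq_mul_inv, inv_eq_one_div, div_le_div_iff₀ (Real.sqrt_pos.2 hκ) hκ, one_mul]
    nth_rewrite 1 [← Real.mul_self_sqrt hκ.le]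
    exact mul_le_mul_of_nonneg_right (sqrt_le_of_comp_ne_zero h) (Real.sqrt_nonneg _)

/-- The continuous inclusion `H₁ → H_{1/2}`. -/
def toHalf : H₁ →L[ℝ] P.Half :=
  LinearMap.mkContinuous
    (P.incl.toLinearMap.codRestrict P.halfSubmodule fun y =>
      summable_of_sum_le (fun κ => mul_nonneg (Real.rpow_nonneg κ.2.le _) (sq_nonneg _))
        (sum_half_incl_le y))
    (√‖P.incl‖) fun y => by
      rw [← Real.sqrt_sq (norm_nonneg y), ← Real.sqrt_mul (norm_nonneg _)]
      exact Real.le_sqrt_of_sq_le (Half.norm_sq_le P (sum_half_incl_le y))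

theorem halfIncl_toHalf (y : H₁) : P.halfIncl (P.toHalf y) = P.incl y := rfl

/-- Every component x_κ is the image of κ⁻¹ ι* x_κ in H₁. The components sum to x in H_{1/2},
because `halfCoord` is an isometry into ℓ² under which they become the entries of a sequence. -/
theorem toHalf_denseRange : DenseRange P.toHalf := by
  intro x
  let g : Ioi (0 : ℝ) → H₁ := fun κ =>
    (κ : ℝ)⁻¹ • ContinuousLinearMap.adjoint P.incl (P.comp κ (P.halfIncl x))
  have hg : ∀ κ, P.incl (g κ) = P.comp κ (P.halfIncl x) := fun κ => by
    simp only [g]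
    rw [map_smul, incl_adjoint_comp, smul_smul, inv_mul_cancel₀ (ne_of_gt κ.2), one_smul]
  have hiso : Isometry P.halfCoord := fun y z => rfl
  have h1 : ∀ κ, P.halfCoord (P.toHalf (g κ)) = lp.single 2 κ (P.halfCoord x κ) := fun κ => by
    ext κ'
    change P.coord (P.incl (g κ)) κ' = _
    rw [lp.single_apply, hg, coord]
    rcases eq_or_ne κ' κ with rfl | hne
    · rw [Pi.single_eq_same, comp_comp_self]; rfl
    · rw [Pi.single_eq_of_ne hne, P.comp_comp_of_ne hne, smul_zero]
  have h2 := lp.hasSum_single (p := 2) (by norm_num) (P.halfCoord x)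
  have h3 : HasSum (fun κ => P.toHalf (g κ)) x := by
    rw [HasSum, hiso.isEmbedding.isInducing.tendsto_nhds_iff]
    refine Filter.Tendsto.congr (fun F => ?_) h2
    rw [Function.comp_apply, map_sum]
    exact Finset.sum_congr rfl fun κ _ => (h1 κ).symm
  refine mem_closure_of_tendsto h3 (.of_forall fun F => ⟨∑ κ ∈ F, g κ, map_sum _ _ _⟩)

variable {P} in
-- The left side is the minimum of α² + m β² subject to α + β = γ.
theorem interpolation_pointwise {α β m γ : ℝ} (hm : 0 ≤ m) (hγ : 0 ≤ γ) (h : γ ≤ α + β) :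
    m / (1 + m) * γ ^ 2 ≤ α ^ 2 + m * β ^ 2 := by
  have h1 : γ ^ 2 ≤ (α + β) ^ 2 := pow_le_pow_left₀ hγ h 2
  rw [div_mul_eq_mul_div, div_le_iff₀ (by positivity)]
  nlinarith [sq_nonneg (α - m * β), mul_le_mul_of_nonneg_left h1 hm]

variable {P} in
/-- Interpolation of a family of operators between `H₀` and `H₁`: the case of finite sums. -/
theorem interpolation_finite {n E : Type*} [NormedAddCommGroup E] [NormedSpace ℝ E]
    {L : n → H₀ →L[ℝ] E} {N : n → ℝ} (hN : ∀ i, 0 ≤ N i) {F : Finset n} {c : ℝ}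
    (h0 : ∀ y, ∑ i ∈ F, ‖L i y‖ ^ 2 ≤ c * ‖y‖ ^ 2)
    (h1 : ∀ z, ∑ i ∈ F, N i ^ 2 * ‖L i (P.incl z)‖ ^ 2 ≤ c * ‖z‖ ^ 2) (G : Finset (Ioi (0 : ℝ)))
    (x : H₀) : ∑ i ∈ F, N i * ‖L i (∑ κ ∈ G, P.comp κ x)‖ ^ 2 ≤
      c * ∑ κ ∈ G, (κ : ℝ) ^ (-(1 / 2) : ℝ) * ‖P.comp κ x‖ ^ 2 := by
  set xG := ∑ κ ∈ G, P.comp κ x with hxG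
  let M : Ioi (0 : ℝ) → ℝ := fun κ => (κ : ℝ) ^ (-(1 / 2) : ℝ)
  have hM0 : ∀ κ, 0 ≤ M κ := fun κ => Real.rpow_nonneg κ.2.le _
  have hM2 : ∀ κ, M κ ^ 2 = (κ : ℝ)⁻¹ := fun κ => by
    simp only [M]
    rw [rpow_neg_half, inv_pow, Real.sq_sqrt κ.2.le]
  -- Both sides are compared with the quadratic functional ‖x_G - ι z‖² + t² ‖z‖² at one well chosen
  -- `z`.
  have key : ∀ t ∈ Ioi (0 : ℝ),
      ∑ i ∈ F, N i ^ 2 * (1 + (N i * t) ^ 2)⁻¹ * ‖L i xG‖ ^ 2 ≤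
        ∑ κ ∈ G, M κ ^ 2 * (1 + (M κ * t) ^ 2)⁻¹ * (c * ‖P.comp κ x‖ ^ 2) := by
    intro t ht
    have ht0 : 0 < t := ht
    -- With this choice `z` is the minimizer of that functional: each component is multiplied by κ /
    -- (κ + t²).
    let w : H₀ := ∑ κ ∈ G, ((κ : ℝ) + t ^ 2)⁻¹ • P.comp κ x
    let z : H₁ := ContinuousLinearMap.adjoint P.incl w
    have hιz : P.incl z = ∑ κ ∈ G, ((κ : ℝ) * ((κ : ℝ) + t ^ 2)⁻¹) • P.comp κ x := by
      simp only [z, w, map_sum, map_smul]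
      refine Finset.sum_congr rfl fun κ _ => ?_
      rw [incl_adjoint_comp, smul_smul, mul_comm]
    have hz : ‖z‖ ^ 2 = ∑ κ ∈ G, (κ : ℝ) * (((κ : ℝ) + t ^ 2)⁻¹) ^ 2 * ‖P.comp κ x‖ ^ 2 := by
      rw [← real_inner_self_eq_norm_sq, ContinuousLinearMap.adjoint_inner_right, hιz,
        P.inner_sum_comp]
      exact Finset.sum_congr rfl fun κ _ => by ring
    have hy : ‖xG - P.incl z‖ ^ 2 =
        ∑ κ ∈ G, (t ^ 2 * ((κ : ℝ) + t ^ 2)⁻¹) ^ 2 * ‖P.comp κ x‖ ^ 2 := by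
      have : xG - P.incl z = ∑ κ ∈ G, (t ^ 2 * ((κ : ℝ) + t ^ 2)⁻¹) • P.comp κ x := by
        rw [hιz, hxG, ← Finset.sum_sub_distrib]
        refine Finset.sum_congr rfl fun κ _ => ?_
        have hκ : (0 : ℝ) < κ := κ.2
        nth_rewrite 1 [← one_smul ℝ (P.comp κ x)]
        rw [← sub_smul]
        congr 1
        field_simp
        ring
      rw [this, ← real_inner_self_eq_norm_sq, P.inner_sum_comp]
      exact Finset.sum_congr rfl fun κ _ => by ring
    have hlow : t ^ 2 * ∑ i ∈ F, N i ^ 2 * (1 + (N i * t) ^ 2)⁻¹ * ‖L i xG‖ ^ 2 ≤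
        c * (‖xG - P.incl z‖ ^ 2 + t ^ 2 * ‖z‖ ^ 2) := by
      calc t ^ 2 * ∑ i ∈ F, N i ^ 2 * (1 + (N i * t) ^ 2)⁻¹ * ‖L i xG‖ ^ 2
          ≤ ∑ i ∈ F, (‖L i (xG - P.incl z)‖ ^ 2 + t ^ 2 * (N i ^ 2 * ‖L i (P.incl z)‖ ^ 2)) := by
            rw [Finset.mul_sum]
            refine Finset.sum_le_sum fun i _ => ?_
            have h3 := interpolation_pointwise (m := (N i * t) ^ 2) (γ := ‖L i xG‖)
              (α := ‖L i (xG - P.incl z)‖) (β := ‖L i (P.incl z)‖) (sq_nonneg _) (norm_nonneg _)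
              (by
                refine le_trans (le_of_eq ?_) (norm_add_le _ _)
                rw [← map_add, sub_add_cancel])
            calc _ = (N i * t) ^ 2 / (1 + (N i * t) ^ 2) * ‖L i xG‖ ^ 2 := by
                  rw [div_eq_mul_inv]; ring
              _ ≤ _ := h3
              _ = _ := by ring
        _ ≤ c * ‖xG - P.incl z‖ ^ 2 + t ^ 2 * (c * ‖z‖ ^ 2) := by
            rw [Finset.sum_add_distrib, ← Finset.mul_sum]
            exact add_le_add (h0 _) (mul_le_mul_of_nonneg_left (h1 z) (sq_nonneg _))
        _ = _ := by ring
    -- The minimal value: on each component t⁴ / (κ + t²)² + t² κ / (κ + t²)² = t² / (κ + t²), which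
    -- is t² M² / (1 + M² t²) for M² = κ⁻¹.
    have hup : c * (‖xG - P.incl z‖ ^ 2 + t ^ 2 * ‖z‖ ^ 2) = t ^ 2 *
        ∑ κ ∈ G, M κ ^ 2 * (1 + (M κ * t) ^ 2)⁻¹ * (c * ‖P.comp κ x‖ ^ 2) := by
      rw [hy, hz, Finset.mul_sum, ← Finset.sum_add_distrib, Finset.mul_sum, Finset.mul_sum]
      refine Finset.sum_congr rfl fun κ _ => ?_
      have hκ : (0 : ℝ) < κ := κ.2
      rw [mul_pow (M κ), hM2]
      field_simp
      ring
    rw [hup] at hlow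
    exact le_of_mul_le_mul_left hlow (by positivity)
  have hint : ∀ (K : ℝ) (b : ℝ), 0 ≤ K →
      IntegrableOn (fun t : ℝ => K ^ 2 * (1 + (K * t) ^ 2)⁻¹ * b) (Ioi 0) := fun K b hK =>
    (integrableOn_Ioi_sq_div hK).mul_const b
  -- Integration over `t` turns both families of weights into `N i` and `M κ`, up to the common
  -- factor π/2.
  have hfin := setIntegral_mono_on
    (integrable_finsetSum F fun i _ => hint (N i) (‖L i xG‖ ^ 2) (hN i))
    (integrable_finsetSum G fun κ _ => hint (M κ) (c * ‖P.comp κ x‖ ^ 2) (hM0 κ))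
    measurableSet_Ioi key
  rw [integral_finsetSum F fun i _ => hint (N i) (‖L i xG‖ ^ 2) (hN i),
    integral_finsetSum G fun κ _ => hint (M κ) (c * ‖P.comp κ x‖ ^ 2) (hM0 κ)] at hfin
  simp only [integral_mul_const, integral_Ioi_sq_div (hN _), integral_Ioi_sq_div (hM0 _)] at hfin
  have hpi : 0 < Real.pi / 2 := by positivity
  refine le_of_mul_le_mul_left ?_ hpi
  calc _ = ∑ i ∈ F, N i * (Real.pi / 2) * ‖L i xG‖ ^ 2 := by
        rw [Finset.mul_sum]
        exact Finset.sum_congr rfl fun i _ => by ring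
    _ ≤ _ := hfin
    _ = _ := by
        rw [Finset.mul_sum, Finset.mul_sum]
        exact Finset.sum_congr rfl fun i _ => by ring

variable {P} in
/-- Interpolation of a family of operators between `H₀` and `H₁`. -/
theorem interpolation_le {n E : Type*} [NormedAddCommGroup E] [NormedSpace ℝ E]
    {L : n → H₀ →L[ℝ] E} {N : n → ℝ} (hN : ∀ i, 0 ≤ N i) {F : Finset n} {c : ℝ} (hc : 0 ≤ c)
    (h0 : ∀ y, ∑ i ∈ F, ‖L i y‖ ^ 2 ≤ c * ‖y‖ ^ 2)
    (h1 : ∀ z, ∑ i ∈ F, N i ^ 2 * ‖L i (P.incl z)‖ ^ 2 ≤ c * ‖z‖ ^ 2) (x : P.Half) :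
    ∑ i ∈ F, N i * ‖L i (P.halfIncl x)‖ ^ 2 ≤ c * ‖x‖ ^ 2 := by
  have hcont : Continuous fun y : H₀ => ∑ i ∈ F, N i * ‖L i y‖ ^ 2 := by fun_prop
  refine le_of_tendsto ((hcont.tendsto _).comp (P.hasSum_comp (P.halfIncl x)))
    (.of_forall fun G => ?_)
  refine (interpolation_finite hN h0 h1 G (P.halfIncl x)).trans
    (mul_le_mul_of_nonneg_left ?_ hc)
  rw [Half.norm_sq]
  exact (summable_half x).sum_le_tsum G fun κ _ =>
    mul_nonneg (Real.rpow_nonneg κ.2.le _) (sq_nonneg _)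

/-- An operator which is bounded on `H₀` and on `H₁` is bounded on `H_{1/2}`. -/
theorem exists_half_operator {S : H₀ →L[ℝ] H₀} {S₁ : H₁ →L[ℝ] H₁}
    (h : ∀ z, S (P.incl z) = P.incl (S₁ z)) :
    ∃ S' : P.Half →L[ℝ] P.Half, ∀ x, P.halfIncl (S' x) = S (P.halfIncl x) := by
  set c : ℝ := ‖S‖ ^ 2 + ‖S₁‖ ^ 2 with hc
  have hc0 : 0 ≤ c := by positivity
  have hbd : ∀ (x : P.Half) (F : Finset (Ioi (0 : ℝ))),
      ∑ κ ∈ F, (κ : ℝ) ^ (-(1 / 2) : ℝ) * ‖P.comp κ (S (P.halfIncl x))‖ ^ 2 ≤ c * ‖x‖ ^ 2 := by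
    intro x F
    -- The norm of `S x` in H_{1/2} is itself a weighted sum over components, so the interpolation
    -- inequality applies with weights κ^{-1/2}; their squares κ⁻¹ give the norm of H₁.
    refine interpolation_le (P := P) (L := fun κ : Ioi (0 : ℝ) => P.comp κ ∘L S)
      (N := fun κ => (κ : ℝ) ^ (-(1 / 2) : ℝ)) (fun κ => Real.rpow_nonneg κ.2.le _) hc0
      (fun y => (P.sum_norm_comp_sq_le F (S y)).trans ?_) (fun z => ?_) x
    · refine (pow_le_pow_left₀ (norm_nonneg _) (S.le_opNorm y) 2).trans ?_
      rw [mul_pow]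
      gcongr
      linarith [sq_nonneg ‖S₁‖]
    · refine le_trans (le_of_eq ?_) ((P.sum_norm_comp_incl_sq_le F (S₁ z)).trans ?_)
      · refine Finset.sum_congr rfl fun κ _ => ?_
        rw [rpow_neg_half, inv_pow, Real.sq_sqrt κ.2.le, ContinuousLinearMap.comp_apply, h]
      · refine (pow_le_pow_left₀ (norm_nonneg _) (S₁.le_opNorm z) 2).trans ?_
        rw [mul_pow]
        gcongr
        linarith [sq_nonneg ‖S‖]
  refine ⟨LinearMap.mkContinuous ((S.toLinearMap ∘ₗ P.halfIncl).codRestrict P.halfSubmodule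
    fun x => summable_of_sum_le
      (fun κ => mul_nonneg (Real.rpow_nonneg κ.2.le _) (sq_nonneg _)) (hbd x)) (√c) fun x => ?_,
    fun x => rfl⟩
  rw [← Real.sqrt_sq (norm_nonneg x), ← Real.sqrt_mul hc0]
  exact Real.le_sqrt_of_sq_le (Half.norm_sq_le P (hbd x))

end HilbertPair
end
noncomputable section

/-! ### The spectral splitting of `H_{1/2}` -/

namespace HilbertPair

variable {H₀ H₁ : Type*} [NormedAddCommGroup H₀] [InnerProductSpace ℝ H₀] [CompleteSpace H₀]
  [NormedAddCommGroup H₁] [InnerProductSpace ℝ H₁] [CompleteSpace H₁] {P : HilbertPair H₀ H₁}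

section Projections

variable {A : H₁ →L[ℝ] H₀} (h : Submodule.IsTopCompl (P.halfPlus A) (P.halfMinus A))
include h

theorem projPlus_of_mem_plus {x : P.Half} (hx : x ∈ P.halfPlus A) :
    (P.projPlus A x : P.Half) = x := by
  rw [projPlus, dif_pos h]
  exact congrArg Subtype.val (Submodule.projectionOntoL_apply_left h ⟨x, hx⟩)

theorem projPlus_of_mem_minus {x : P.Half} (hx : x ∈ P.halfMinus A) : P.projPlus A x = 0 := by
  rw [projPlus, dif_pos h]
  exact (Submodule.projectionOntoL_apply_eq_zero_iff h).2 hx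

theorem projMinus_of_mem_minus {x : P.Half} (hx : x ∈ P.halfMinus A) :
    (P.projMinus A x : P.Half) = x := by
  rw [projMinus, dif_pos h.symm]
  exact congrArg Subtype.val (Submodule.projectionOntoL_apply_left h.symm ⟨x, hx⟩)

theorem projMinus_of_mem_plus {x : P.Half} (hx : x ∈ P.halfPlus A) : P.projMinus A x = 0 := by
  rw [projMinus, dif_pos h.symm]
  exact (Submodule.projectionOntoL_apply_eq_zero_iff h.symm).2 hx

theorem sub_projPlus_mem (x : P.Half) : x - P.projPlus A x ∈ P.halfMinus A := by
  have h1 := (Submodule.projectionOntoL_apply_eq_zero_iff h (x := x - P.projPlus A x)).1 (by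
    rw [projPlus, dif_pos h, map_sub, Submodule.projectionOntoL_apply_left, sub_self])
  exact h1

theorem sub_projMinus_mem (x : P.Half) : x - P.projMinus A x ∈ P.halfPlus A := by
  have h1 := (Submodule.projectionOntoL_apply_eq_zero_iff h.symm (x := x - P.projMinus A x)).1 (by
    rw [projMinus, dif_pos h.symm, map_sub, Submodule.projectionOntoL_apply_left, sub_self])
  exact h1

theorem projPlus_eq_zero_iff {x : P.Half} : P.projPlus A x = 0 ↔ x ∈ P.halfMinus A := by
  rw [projPlus, dif_pos h, Submodule.projectionOntoL_apply_eq_zero_iff]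

theorem projMinus_eq_zero_iff {x : P.Half} : P.projMinus A x = 0 ↔ x ∈ P.halfPlus A := by
  rw [projMinus, dif_pos h.symm, Submodule.projectionOntoL_apply_eq_zero_iff]

end Projections

namespace EigenSystem

variable {A : H₁ →L[ℝ] H₀} (S : P.EigenSystem A)

/-- The coordinate functionals on `H_{1/2}`. -/
def coefHalf (i : S.idx) : P.Half →L[ℝ] ℝ := S.coef i ∘L P.halfInclL

theorem coefHalf_apply (i : S.idx) (x : P.Half) : S.coefHalf i x = S.coef i (P.halfIncl x) := rfl

theorem coefHalf_self (i : S.idx) : S.coefHalf i (P.toHalf (S.v i)) = 1 := S.coef_self i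

theorem coefHalf_ne {i j : S.idx} (h : i ≠ j) : S.coefHalf i (P.toHalf (S.v j)) = 0 :=
  S.coef_ne i j h

theorem v_ne_zero (i : S.idx) : S.v i ≠ 0 := fun h => by
  have := S.coef_self i
  rw [h, map_zero, map_zero] at this
  exact zero_ne_one this

theorem eq_zero_of_coef {x : H₀} (h : ∀ i, S.coef i x = 0) : x = 0 := by
  have := S.parseval x
  simp only [h] at this
  simpa using this

theorem ext_coef {x y : H₀} (h : ∀ i, S.coef i x = S.coef i y) : x = y :=
  sub_eq_zero.1 (S.eq_zero_of_coef fun i => by rw [map_sub, h, sub_self])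

theorem half_ext {x y : P.Half} (h : ∀ i, S.coefHalf i x = S.coefHalf i y) : x = y :=
  P.halfIncl_injective (S.ext_coef h)

theorem coef_eigenvector {a : ℝ} {w : H₁} (hw : A w = a • P.incl w) {i : S.idx} (hi : S.a i ≠ a) :
    S.coef i (P.incl w) = 0 := by
  have h1 := S.coef_op i w
  rw [hw, map_smul, smul_eq_mul] at h1
  have h2 : (S.a i - a) * S.coef i (P.incl w) = 0 := by linarith
  exact (mul_eq_zero.1 h2).resolve_left (sub_ne_zero.2 hi)

theorem coef_shift (r : ℝ) (i : S.idx) (x : H₁) :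
    S.coef i (P.shift A r x) = (S.a i - r) * S.coef i (P.incl x) := by
  change S.coef i (A x - r • P.incl x) = _
  rw [map_sub, S.coef_op, map_smul, smul_eq_mul, sub_mul]

theorem shift_v (r : ℝ) (i : S.idx) : P.shift A r (S.v i) = (S.a i - r) • P.incl (S.v i) := by
  change A (S.v i) - r • P.incl (S.v i) = _
  rw [S.eigen, sub_smul]

/-- The coordinate is continuous and vanishes on eigenvectors of any other eigenvalue, hence on
their closed span. -/
theorem coefHalf_of_mem_halfPlus {r : ℝ} {x : P.Half} (hx : x ∈ P.halfPlus (P.shift A r))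
    {i : S.idx} (hi : S.a i ≤ r) : S.coefHalf i x = 0 := by
  have : P.halfPlus (P.shift A r) ≤ LinearMap.ker (S.coefHalf i).toLinearMap := by
    refine Submodule.topologicalClosure_minimal _ (Submodule.span_le.2 ?_)
      (S.coefHalf i).isClosed_ker
    rintro y ⟨a, ha, w, hw, hy⟩
    have h1 : A w = (a + r) • P.incl w := by
      have h2 : A w - r • P.incl w = a • P.incl w := hw
      rw [add_smul, ← h2, sub_add_cancel]
    change S.coef i (P.halfIncl y) = 0
    rw [hy]
    exact S.coef_eigenvector h1 (by linarith)
  exact this hx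

theorem coefHalf_of_mem_halfMinus {r : ℝ} {x : P.Half} (hx : x ∈ P.halfMinus (P.shift A r))
    {i : S.idx} (hi : r ≤ S.a i) : S.coefHalf i x = 0 := by
  have : P.halfMinus (P.shift A r) ≤ LinearMap.ker (S.coefHalf i).toLinearMap := by
    refine Submodule.topologicalClosure_minimal _ (Submodule.span_le.2 ?_)
      (S.coefHalf i).isClosed_ker
    rintro y ⟨a, ha, w, hw, hy⟩
    have h1 : A w = (a + r) • P.incl w := by
      have h2 : A w - r • P.incl w = a • P.incl w := hw
      rw [add_smul, ← h2, sub_add_cancel]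
    change S.coef i (P.halfIncl y) = 0
    rw [hy]
    exact S.coef_eigenvector h1 (by linarith)
  exact this hx

theorem toHalf_v_mem_halfPlus {r : ℝ} {i : S.idx} (hi : r < S.a i) :
    P.toHalf (S.v i) ∈ P.halfPlus (P.shift A r) :=
  Submodule.le_topologicalClosure _ (Submodule.subset_span
    ⟨S.a i - r, sub_pos.2 hi, S.v i, S.shift_v r i, rfl⟩)

theorem toHalf_v_mem_halfMinus {r : ℝ} {i : S.idx} (hi : S.a i < r) :
    P.toHalf (S.v i) ∈ P.halfMinus (P.shift A r) :=
  Submodule.le_topologicalClosure _ (Submodule.subset_span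
    ⟨S.a i - r, sub_neg.2 hi, S.v i, S.shift_v r i, rfl⟩)

section Shift

variable {r : ℝ} (hr : Function.Bijective (P.shift A r))
include S hr

theorem a_ne (i : S.idx) : S.a i ≠ r := fun h => S.v_ne_zero i (hr.1 (by
  rw [S.shift_v, h, sub_self, zero_smul, map_zero]))

/-- The map H₀ → H₁ → H_{1/2}, the inverse of `A - r ι` followed by the inclusion, is continuous
with dense range. It sends the eigenvectors, which span a dense subspace of H₀, to multiples of
themselves. -/
theorem half_dense_span :
    (Submodule.span ℝ (range fun i => P.toHalf (S.v i))).topologicalClosure = ⊤ := by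
  obtain ⟨C, hC⟩ := exists_equiv_of_bijective hr
  set U := (Submodule.span ℝ (range fun i => P.toHalf (S.v i))).topologicalClosure with hU
  have hUc : IsClosed (U : Set P.Half) := Submodule.isClosed_topologicalClosure _
  let Φ : H₀ →L[ℝ] P.Half := P.toHalf ∘L (C.symm : H₀ →L[ℝ] H₁)
  have h1 : (⊤ : Submodule ℝ H₀) ≤ U.comap Φ.toLinearMap := by
    rw [← S.dense_span]
    refine Submodule.topologicalClosure_minimal _ (Submodule.span_le.2 ?_)
      (hUc.preimage Φ.continuous)
    rintro _ ⟨i, rfl⟩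
    have h2 : C (S.v i) = (S.a i - r) • P.incl (S.v i) := by
      rw [← S.shift_v, ← hC]; rfl
    have h3 : C.symm (P.incl (S.v i)) = (S.a i - r)⁻¹ • S.v i := by
      rw [C.symm_apply_eq, map_smul, h2, smul_smul,
        inv_mul_cancel₀ (sub_ne_zero.2 (S.a_ne hr i)), one_smul]
    change P.toHalf (C.symm (P.incl (S.v i))) ∈ U
    rw [h3, map_smul]
    exact Submodule.smul_mem _ _ (Submodule.le_topologicalClosure _
      (Submodule.subset_span ⟨i, rfl⟩))
  rw [eq_top_iff]
  intro x _
  have h4 : range P.toHalf ⊆ U := by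
    rintro _ ⟨y, rfl⟩
    have h5 := h1 (Submodule.mem_top (x := C y))
    change P.toHalf (C.symm (C y)) ∈ U at h5
    rwa [C.symm_apply_apply] at h5
  exact closure_minimal h4 hUc (P.toHalf_denseRange x)

/-- The spectral projection of H₀ is interpolated to H_{1/2}. It suffices to know the values of `Q`
on eigenvectors, since these span a dense subspace and the target subspaces are closed. -/
theorem exists_half_proj : ∃ Q : P.Half →L[ℝ] P.Half,
    (∀ x, Q x ∈ P.halfPlus (P.shift A r)) ∧ ∀ x, x - Q x ∈ P.halfMinus (P.shift A r) := by
  obtain ⟨C, hC⟩ := exists_equiv_of_bijective hr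
  obtain ⟨R, hR⟩ := S.exists_proj {i | r < S.a i}
  have hCc : ∀ i y, S.coef i y = (S.a i - r) * S.coef i (P.incl (C.symm y)) := fun i y => by
    rw [← S.coef_shift, ← hC]
    simp
  -- On H₁ the projection acts as `C⁻¹ R C`. It is compatible with `R` under `ι` because `C`
  -- multiplies the coordinate `i` by the nonzero number `S.a i - r`.
  obtain ⟨Q, hQ⟩ := P.exists_half_operator (S := R)
    (S₁ := (C.symm : H₀ →L[ℝ] H₁) ∘L R ∘L (C : H₁ →L[ℝ] H₀)) (fun z => by
      refine S.ext_coef fun i => ?_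
      have h0 := sub_ne_zero.2 (S.a_ne hr i)
      refine mul_left_cancel₀ h0 ?_
      change _ = (S.a i - r) * S.coef i (P.incl (C.symm (R (C z))))
      rw [← hCc]
      have h1 := hCc i (C z)
      rw [C.symm_apply_apply] at h1
      by_cases hi : i ∈ {i | r < S.a i}
      · rw [(hR _ i).1 hi, (hR _ i).1 hi, h1]
      · rw [(hR _ i).2 hi, (hR _ i).2 hi, mul_zero])
  have hv1 : ∀ i, r < S.a i → Q (P.toHalf (S.v i)) = P.toHalf (S.v i) := fun i hi => by
    refine S.half_ext fun j => ?_
    rw [coefHalf_apply, hQ]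
    by_cases hj : j ∈ {i | r < S.a i}
    · rw [(hR _ j).1 hj]; rfl
    · rw [(hR _ j).2 hj, S.coefHalf_ne]
      rintro rfl
      exact hj hi
  have hv2 : ∀ i, S.a i < r → Q (P.toHalf (S.v i)) = 0 := fun i hi => by
    refine S.half_ext fun j => ?_
    rw [coefHalf_apply, hQ, map_zero]
    by_cases hj : j ∈ {i | r < S.a i}
    · rw [(hR _ j).1 hj]
      refine S.coef_ne _ _ ?_
      rintro rfl
      exact lt_asymm hi hj
    · exact (hR _ j).2 hj
  have hgen : ∀ (V : Submodule ℝ P.Half) (Ψ : P.Half →L[ℝ] P.Half), IsClosed (V : Set P.Half) →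
      (∀ i, Ψ (P.toHalf (S.v i)) ∈ V) → ∀ x, Ψ x ∈ V := by
    intro V Ψ hV hi x
    have : (⊤ : Submodule ℝ P.Half) ≤ V.comap Ψ.toLinearMap := by
      rw [← S.half_dense_span hr]
      refine Submodule.topologicalClosure_minimal _ (Submodule.span_le.2 ?_)
        (hV.preimage Ψ.continuous)
      rintro _ ⟨i, rfl⟩
      exact hi i
    exact this Submodule.mem_top
  refine ⟨Q, hgen _ Q (Submodule.isClosed_topologicalClosure _) fun i => ?_,
    hgen _ (ContinuousLinearMap.id ℝ P.Half - Q) (Submodule.isClosed_topologicalClosure _)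
      fun i => ?_⟩
  · rcases lt_or_gt_of_ne (S.a_ne hr i) with hi | hi
    · rw [hv2 i hi]; exact Submodule.zero_mem _
    · rw [hv1 i hi]; exact S.toHalf_v_mem_halfPlus hi
  · change P.toHalf (S.v i) - Q (P.toHalf (S.v i)) ∈ _
    rcases lt_or_gt_of_ne (S.a_ne hr i) with hi | hi
    · rw [hv2 i hi, sub_zero]; exact S.toHalf_v_mem_halfMinus hi
    · rw [hv1 i hi, sub_self]; exact Submodule.zero_mem _

/-- A common vector has all coordinates zero, and `Q` splits every vector. The algebraic projection
equals `Q`, which is where its continuity comes from. -/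
theorem isTopCompl : Submodule.IsTopCompl (P.halfPlus (P.shift A r))
    (P.halfMinus (P.shift A r)) := by
  obtain ⟨Q, hQ1, hQ2⟩ := S.exists_half_proj hr
  have hc : IsCompl (P.halfPlus (P.shift A r)) (P.halfMinus (P.shift A r)) := by
    constructor
    · rw [Submodule.disjoint_def]
      intro x hx hx'
      refine S.half_ext fun i => ?_
      rw [map_zero]
      rcases le_total (S.a i) r with hi | hi
      · exact S.coefHalf_of_mem_halfPlus hx hi
      · exact S.coefHalf_of_mem_halfMinus hx' hi
    · rw [codisjoint_iff, eq_top_iff]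
      intro x _
      exact Submodule.mem_sup.2 ⟨Q x, hQ1 x, x - Q x, hQ2 x, add_sub_cancel _ _⟩
  refine ⟨hc, ?_⟩
  have : ⇑((P.halfPlus (P.shift A r)).projection (P.halfMinus (P.shift A r)) hc) = Q := by
    funext x
    have h1 : x = Q x + (x - Q x) := (add_sub_cancel _ _).symm
    nth_rewrite 1 [h1]
    rw [map_add, Submodule.projection_apply_of_mem_left hc (hQ1 x),
      Submodule.projection_apply_of_mem_right hc (hQ2 x), add_zero]
  rw [this]
  exact Q.continuous

/-- The description by coordinates makes the dependence on the shift `r` visible; the monotonicity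
of the spectral subspaces in `r` rests on it. If the coordinates below `r` vanish, so do all
coordinates of the component in H⁻. -/
theorem mem_halfPlus_iff {x : P.Half} : x ∈ P.halfPlus (P.shift A r) ↔
    ∀ i, S.a i < r → S.coefHalf i x = 0 := by
  refine ⟨fun hx i hi => S.coefHalf_of_mem_halfPlus hx hi.le, fun hx => ?_⟩
  have h := S.isTopCompl hr
  rw [← projMinus_eq_zero_iff h]
  refine Subtype.ext (S.half_ext fun i => ?_)
  rw [ZeroMemClass.coe_zero, map_zero]
  rcases lt_or_gt_of_ne (S.a_ne hr i) with hi | hi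
  · have h1 := S.coefHalf_of_mem_halfPlus (sub_projMinus_mem h x) hi.le
    rw [map_sub, hx i hi] at h1
    linarith
  · exact S.coefHalf_of_mem_halfMinus (Subtype.property _) hi.le

theorem mem_halfMinus_iff {x : P.Half} : x ∈ P.halfMinus (P.shift A r) ↔
    ∀ i, r < S.a i → S.coefHalf i x = 0 := by
  refine ⟨fun hx i hi => S.coefHalf_of_mem_halfMinus hx hi.le, fun hx => ?_⟩
  have h := S.isTopCompl hr
  rw [← projPlus_eq_zero_iff h]
  refine Subtype.ext (S.half_ext fun i => ?_)
  rw [ZeroMemClass.coe_zero, map_zero]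
  rcases lt_or_gt_of_ne (S.a_ne hr i) with hi | hi
  · exact S.coefHalf_of_mem_halfPlus (Subtype.property _) hi.le
  · have h1 := S.coefHalf_of_mem_halfMinus (sub_projPlus_mem h x) hi.le
    rw [map_sub, hx i hi] at h1
    linarith

theorem coefHalf_projPlus (x : P.Half) {i : S.idx} (hi : r < S.a i) :
    S.coefHalf i (P.projPlus (P.shift A r) x) = S.coefHalf i x := by
  have h1 := S.coefHalf_of_mem_halfMinus (sub_projPlus_mem (S.isTopCompl hr) x) hi.le
  rw [map_sub] at h1
  linarith

theorem coefHalf_projMinus (x : P.Half) {i : S.idx} (hi : S.a i < r) :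
    S.coefHalf i (P.projMinus (P.shift A r) x) = S.coefHalf i x := by
  have h1 := S.coefHalf_of_mem_halfPlus (sub_projMinus_mem (S.isTopCompl hr) x) hi.le
  rw [map_sub] at h1
  linarith

end Shift

/-- The quadratic form of `|A|` is bounded on `H_{1/2}`. -/
theorem exists_half_bessel : ∃ c : ℝ, 0 ≤ c ∧ ∀ (F : Finset S.idx) (x : P.Half),
    ∑ i ∈ F, |S.a i| * S.coefHalf i x ^ 2 ≤ c * ‖x‖ ^ 2 := by
  have hc := S.c_pos
  refine ⟨S.c * (1 + ‖A‖ ^ 2), by positivity, fun F x => ?_⟩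
  -- The bound on H₁ with weights `|S.a i|²` is Bessel's inequality for `A z`, whose coordinates are
  -- those of `ι z` times `S.a i`.
  have h := interpolation_le (P := P) (L := S.coef) (N := fun i => |S.a i|)
    (fun i => abs_nonneg _) (F := F) (c := S.c * (1 + ‖A‖ ^ 2)) (by positivity) (fun y => ?_)
    (fun z => ?_) x
  · simpa [coefHalf_apply] using h
  · simp only [Real.norm_eq_abs, sq_abs]
    refine (S.bessel F y).trans ?_
    gcongr
    nlinarith [sq_nonneg ‖A‖]
  · simp only [Real.norm_eq_abs, sq_abs, ← mul_pow, ← S.coef_op]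
    refine (S.bessel F (A z)).trans ?_
    have h1 : ‖A z‖ ^ 2 ≤ ‖A‖ ^ 2 * ‖z‖ ^ 2 := by
      rw [← mul_pow]
      exact pow_le_pow_left₀ (norm_nonneg _) (A.le_opNorm z) 2
    rw [mul_assoc]
    refine mul_le_mul_of_nonneg_left (h1.trans ?_) hc.le
    nlinarith [sq_nonneg ‖z‖]

/-- Countability is needed to interchange sums over modes with integrals and to merge exceptional
null sets, one for each mode. -/
instance : Countable S.idx := by
  have : (univ : Set S.idx) = ⋃ n : ℕ, {i | |S.a i| ≤ n} := by
    ext i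
    simpa using exists_nat_ge |S.a i|
  rw [← countable_univ_iff, this]
  exact countable_iUnion fun n => (S.finite n).countable

end EigenSystem

end HilbertPair
end
noncomputable section

/-! ### Analysis of path spaces -/

/-- The Cauchy–Schwarz inequality against the constant 1: expand the integral of the square of ‖v‖
minus its mean. -/
theorem sq_integral_norm_le {E : Type*} [NormedAddCommGroup E] {v : ℝ → E} {a b : ℝ} (hab : a ≤ b)
    (hv : IntegrableOn v (Icc a b)) (hv2 : IntegrableOn (fun s => ‖v s‖ ^ 2) (Icc a b)) :
    (∫ s in Icc a b, ‖v s‖) ^ 2 ≤ (b - a) * ∫ s in Icc a b, ‖v s‖ ^ 2 := by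
  rcases hab.eq_or_lt with rfl | hab
  · simp
  set M := ∫ s in Icc a b, ‖v s‖ with hM
  set Q := ∫ s in Icc a b, ‖v s‖ ^ 2 with hQ
  set δ := b - a with hδ
  have hδ0 : 0 < δ := sub_pos.2 hab
  have hconst : ∀ k : ℝ, ∫ _ in Icc a b, k = δ * k := fun k => by
    rw [setIntegral_const, Real.volume_real_Icc_of_le hab.le, smul_eq_mul]
  have h1 : 0 ≤ ∫ s in Icc a b, (‖v s‖ ^ 2 - 2 * (M / δ) * ‖v s‖ + (M / δ) ^ 2) :=
    integral_nonneg fun s => by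
      change 0 ≤ ‖v s‖ ^ 2 - 2 * (M / δ) * ‖v s‖ + (M / δ) ^ 2
      nlinarith [sq_nonneg (‖v s‖ - M / δ)]
  have hi : IntegrableOn (fun s => 2 * (M / δ) * ‖v s‖) (Icc a b) := hv.norm.const_mul _
  have hi' : IntegrableOn (fun s => ‖v s‖ ^ 2 - 2 * (M / δ) * ‖v s‖) (Icc a b) := hv2.sub hi
  rw [integral_add hi' (integrableOn_const (by simp)), integral_sub hv2 hi,
    integral_const_mul, hconst, ← hM, ← hQ] at h1
  have h2 : Q - 2 * (M / δ) * M + δ * (M / δ) ^ 2 = Q - M ^ 2 / δ := by field_simp; ring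
  rw [h2, sub_nonneg, div_le_iff₀ hδ0] at h1
  linarith

/-- The inclusion of a compact dense subspace is nearly of finite rank. -/
theorem exists_finiteRank_projection {E F : Type*} [NormedAddCommGroup E] [NormedSpace ℝ E]
    [NormedAddCommGroup F] [InnerProductSpace ℝ F] {u : E →L[ℝ] F} (hu : IsCompactOperator u)
    {ε : ℝ} (hε : 0 < ε) : ∃ Q : F →L[ℝ] F, Q.toLinearMap.HasFiniteRange ∧ ‖Q‖ ≤ 1 ∧
      ‖u - Q ∘L u‖ ≤ ε := by
  obtain ⟨S, hS, hsub⟩ := IsCompactOperator.image_closedBall_subset_compact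
    (𝕜₁ := ℝ) (f := u.toLinearMap) hu 1
  obtain ⟨t, -, ht, hcov⟩ := hS.finite_cover_balls hε
  let V : Submodule ℝ F := Submodule.span ℝ t
  have hV : FiniteDimensional ℝ V := FiniteDimensional.span_of_finite ℝ ht
  refine ⟨V.starProjection, ?_, V.starProjection_norm_le, ?_⟩
  · rw [LinearMap.HasFiniteRange]
    have : V.starProjection.toLinearMap.range = V := Submodule.range_starProjection V
    rw [this]
    exact Module.Finite.iff_fg.1 hV
  · refine ContinuousLinearMap.opNorm_le_of_unit_norm hε.le fun x hx => ?_
    obtain ⟨y, hy, hxy⟩ := mem_iUnion₂.1 (hcov (hsub ⟨x, by simp [hx], rfl⟩))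
    rw [Metric.mem_ball, dist_eq_norm] at hxy
    refine le_trans ?_ hxy.le
    have := Submodule.starProjection_minimal (U := V) (y := u x)
    change ‖u x - V.starProjection (u x)‖ ≤ ‖u x - y‖
    rw [this]
    exact ciInf_le ⟨0, by rintro _ ⟨_, rfl⟩; exact norm_nonneg _⟩
      (⟨y, Submodule.subset_span hy⟩ : V)

theorem integrableOn_Lp {E : Type*} [NormedAddCommGroup E] {T : ℝ}
    (u : Lp E 2 (volume.restrict (Icc (-T) T))) : IntegrableOn u (Icc (-T) T) :=
  (Lp.memLp u).integrable (by norm_num)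

section Lp

variable {E F : Type*} [NormedAddCommGroup E] [InnerProductSpace ℝ E] [CompleteSpace E]
  [NormedAddCommGroup F] [InnerProductSpace ℝ F] [CompleteSpace F] {T : ℝ}

theorem integral_norm_Lp_le (u : Lp E 2 (volume.restrict (Icc (-T) T))) {a b : ℝ}
    (hab : a ≤ b) (hsub : Icc a b ⊆ Icc (-T) T) :
    ∫ s in Icc a b, ‖u s‖ ≤ √(b - a) * ‖u‖ := by
  have h2 := HilbertPair.integrable_norm_sq u
  have h3 := sq_integral_norm_le hab ((integrableOn_Lp u).mono_set hsub) (h2.mono_set hsub)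
  have h4 : ∫ s in Icc a b, ‖u s‖ ^ 2 ≤ ‖u‖ ^ 2 := by
    rw [HilbertPair.Lp_norm_sq]
    exact setIntegral_mono_set h2 (.of_forall fun _ => by positivity) hsub.eventuallyLE
  refine abs_le_of_sq_le_sq' ?_ (by positivity) |>.2
  rw [mul_pow, Real.sq_sqrt (by linarith)]
  exact h3.trans (mul_le_mul_of_nonneg_left h4 (by linarith))

/-- Integration against a continuous function, as an operator on `L²`. -/
def integralSmul (hT : 0 < T) {φ : ℝ → ℝ} (hφ : Continuous φ) :
    Lp E 2 (volume.restrict (Icc (-T) T)) →L[ℝ] E :=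
  LinearMap.mkContinuousOfExistsBound
    { toFun := fun u => ∫ s in Icc (-T) T, φ s • u s
      map_add' := fun u v => by
        rw [← integral_add (IsTestFunction.integrableOn_smul hφ (integrableOn_Lp u))
          (IsTestFunction.integrableOn_smul hφ (integrableOn_Lp v))]
        refine integral_congr_ae ?_
        filter_upwards [Lp.coeFn_add u v] with s hs
        rw [hs, Pi.add_apply, smul_add]
      map_smul' := fun c u => by
        rw [RingHom.id_apply, ← integral_smul]
        refine integral_congr_ae ?_
        filter_upwards [Lp.coeFn_smul c u] with s hs
        rw [hs, Pi.smul_apply, smul_comm] }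
    (by
      obtain ⟨C, hC⟩ := isCompact_Icc.exists_bound_of_continuousOn (hφ.continuousOn (s := Icc (-T) T))
      have hC0 : 0 ≤ C := (norm_nonneg _).trans (hC T ⟨by linarith, le_rfl⟩)
      refine ⟨C * √(T - -T), fun u => ?_⟩
      calc ‖∫ s in Icc (-T) T, φ s • u s‖ ≤ ∫ s in Icc (-T) T, C * ‖u s‖ := by
            refine norm_integral_le_of_norm_le ((integrableOn_Lp u).norm.const_mul C) ?_
            filter_upwards [ae_restrict_mem measurableSet_Icc] with s hs
            rw [norm_smul]
            exact mul_le_mul_of_nonneg_right (hC s hs) (norm_nonneg _)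
        _ ≤ C * (√(T - -T) * ‖u‖) := by
            rw [integral_const_mul]
            exact mul_le_mul_of_nonneg_left
              (integral_norm_Lp_le u (by linarith) subset_rfl) hC0
        _ = _ := by ring)

/-- Multiplication by a continuous function on `L²`. -/
def smulOp {χ : ℝ → ℝ} (hχ : Continuous χ) :
    Lp E 2 (volume.restrict (Icc (-T) T)) →L[ℝ] Lp E 2 (volume.restrict (Icc (-T) T)) :=
  HilbertPair.mulOp (A := fun s => χ s • ContinuousLinearMap.id ℝ E)
    (hχ.smul continuous_const).continuousOn

theorem coeFn_mulOp {A : ℝ → E →L[ℝ] F} (hA : ContinuousOn A (Icc (-T) T))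
    (u : Lp E 2 (volume.restrict (Icc (-T) T))) :
    HilbertPair.mulOp hA u =ᵐ[volume.restrict (Icc (-T) T)] fun s => A s (u s) :=
  (HilbertPair.memLp_mul hA u).coeFn_toLp

theorem coeFn_smulOp {χ : ℝ → ℝ} (hχ : Continuous χ)
    (u : Lp E 2 (volume.restrict (Icc (-T) T))) :
    smulOp hχ u =ᵐ[volume.restrict (Icc (-T) T)] fun s => χ s • u s :=
  coeFn_mulOp _ u

/-- The operator `x ↦ 1_s x` from a Hilbert space to `L²`. -/
def indicatorOp (E : Type*) [NormedAddCommGroup E] [InnerProductSpace ℝ E] [CompleteSpace E]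
    (T : ℝ) {s : Set ℝ} (hs : MeasurableSet s) :
    E →L[ℝ] Lp E 2 (volume.restrict (Icc (-T) T)) :=
  LinearMap.mkContinuous
    { toFun := fun x => indicatorConstLp 2 hs (by finiteness) x
      map_add' := fun x y => indicatorConstLp_add.symm
      map_smul' := fun c x => by
        refine Lp.ext ?_
        filter_upwards [indicatorConstLp_coeFn (μ := volume.restrict (Icc (-T) T)) (p := 2)
            (hs := hs) (hμs := by finiteness) (c := x),
          indicatorConstLp_coeFn (μ := volume.restrict (Icc (-T) T)) (p := 2)
            (hs := hs) (hμs := by finiteness) (c := c • x),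
          Lp.coeFn_smul c (indicatorConstLp (μ := volume.restrict (Icc (-T) T)) 2 hs
            (by finiteness) x)] with t h1 h2 h3
        rw [RingHom.id_apply, h2, h3, Pi.smul_apply, h1]
        by_cases ht : t ∈ s <;> simp [ht] }
    ((volume.restrict (Icc (-T) T)).real s ^ (1 / (2 : ℝ≥0∞).toReal)) fun x => by
      rw [mul_comm]; exact norm_indicatorConstLp_le (hs := hs) (hμs := by finiteness)

theorem coeFn_indicatorOp {s : Set ℝ} (hs : MeasurableSet s) (x : E) :
    indicatorOp E T hs x =ᵐ[volume.restrict (Icc (-T) T)] s.indicator fun _ => x :=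
  indicatorConstLp_coeFn (hs := hs) (hμs := by finiteness)

end Lp

namespace HilbertPair

variable {H₀ H₁ : Type*} [NormedAddCommGroup H₀] [InnerProductSpace ℝ H₀] [CompleteSpace H₀]
  [NormedAddCommGroup H₁] [InnerProductSpace ℝ H₁] [CompleteSpace H₁] {P : HilbertPair H₀ H₁}
  {T : ℝ}

/-- For each test function the defining identity of the weak derivative is the vanishing of a
continuous linear map, so P₁ is an intersection of closed kernels. -/
theorem P1.isClosed (hT : 0 < T) : IsClosed (P.P1 T : Set (WithLp 2
    (Lp H₁ 2 (volume.restrict (Icc (-T) T)) × Lp H₀ 2 (volume.restrict (Icc (-T) T))))) := by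
  let Λ : ∀ φ : ℝ → ℝ, IsTestFunction T φ → (WithLp 2 (Lp H₁ 2 (volume.restrict (Icc (-T) T)) ×
      Lp H₀ 2 (volume.restrict (Icc (-T) T)))) →L[ℝ] H₀ := fun φ hφ =>
    P.incl ∘L integralSmul hT (hφ.contDiff.continuous_deriv (by simp)) ∘L WithLp.fstL 2 ℝ _ _ +
      integralSmul hT hφ.contDiff.continuous ∘L WithLp.sndL 2 ℝ _ _
  have : (P.P1 T : Set (WithLp 2 (Lp H₁ 2 (volume.restrict (Icc (-T) T)) ×
      Lp H₀ 2 (volume.restrict (Icc (-T) T))))) = ⋂ φ, ⋂ hφ : IsTestFunction T φ,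
        {ξ | Λ φ hφ ξ = 0} := by
    ext ξ
    simp only [mem_iInter, SetLike.mem_coe]
    refine forall₂_congr fun φ hφ => ?_
    have hd : Continuous (deriv φ) := hφ.contDiff.continuous_deriv (by simp)
    have h1 : Λ φ hφ ξ = (∫ s in Icc (-T) T, deriv φ s • P.incl (ξ.fst s)) +
        ∫ s in Icc (-T) T, φ s • ξ.snd s := by
      change P.incl (∫ s in Icc (-T) T, deriv φ s • ξ.fst s) + _ = _
      rw [← P.incl.integral_comp_comm
        (IsTestFunction.integrableOn_smul hd (integrableOn_Lp ξ.fst))]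
      simp only [map_smul]
      rfl
    rw [mem_ofPred_eq, h1, add_eq_zero_iff_eq_neg]
  rw [this]
  exact isClosed_iInter fun φ => isClosed_iInter fun hφ =>
    isClosed_eq (Λ φ hφ).continuous continuous_const

theorem P1.completeSpace (hT : 0 < T) : CompleteSpace (P.P1 T) :=
  (P1.isClosed hT).completeSpace_coe

/-- The inclusion `P₁ → P₀`. -/
def inclP : P.P1 T →L[ℝ] P.P0 T := P.incl.compLpL 2 _ ∘L P1.val

theorem coeFn_inclP (ξ : P.P1 T) :
    inclP ξ =ᵐ[volume.restrict (Icc (-T) T)] fun s => P.incl (P1.val ξ s) :=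
  P.incl.coeFn_compLpL _

theorem P1.norm_val_le (ξ : P.P1 T) : ‖P1.val ξ‖ ≤ ‖ξ‖ := by
  refine abs_le_of_sq_le_sq' ?_ (norm_nonneg _) |>.2
  rw [P1.norm_sq]
  exact le_add_of_nonneg_right (sq_nonneg _)

theorem P1.norm_der_le (ξ : P.P1 T) : ‖P1.der ξ‖ ≤ ‖ξ‖ := by
  refine abs_le_of_sq_le_sq' ?_ (norm_nonneg _) |>.2
  rw [P1.norm_sq]
  exact le_add_of_nonneg_left (sq_nonneg _)

theorem P1.norm_rep_sub_le (hT : 0 < T) (ξ : P.P1 T) {s t : ℝ} (hs : s ∈ Icc (-T) T)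
    (ht : t ∈ Icc (-T) T) (hst : s ≤ t) :
    ‖P1.rep hT ξ t - P1.rep hT ξ s‖ ≤ √(t - s) * ‖ξ‖ := by
  rw [P1.rep_sub hT ξ hs ht]
  have hsub : Icc s t ⊆ Icc (-T) T := Icc_subset_Icc hs.1 ht.2
  refine (intervalIntegral.norm_integral_le_integral_norm hst).trans ?_
  rw [intervalIntegral.integral_of_le hst, ← integral_Icc_eq_integral_Ioc]
  exact (integral_norm_Lp_le (P1.der ξ) hst hsub).trans
    (mul_le_mul_of_nonneg_left (P1.norm_der_le ξ) (Real.sqrt_nonneg _))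

/-- The Rellich theorem: the inclusion `P₁ → P₀` is a norm limit of finite rank operators. -/
theorem isFiniteRankLimit_inclP (hT : 0 < T) :
    IsFiniteRankLimit (inclP : P.P1 T →L[ℝ] P.P0 T) := by
  intro ε hε
  -- Half of `ε` pays for replacing `ι` by the finite rank operator `Q ι` in space, the other half
  -- for replacing the path by a step function in time.
  obtain ⟨Q, hQfin, hQ1, hQε⟩ := exists_finiteRank_projection P.incl_compact (half_pos hε)
  set m : ℝ := (measureUnivNNReal (volume.restrict (Icc (-T) T)) : ℝ) ^ (2 : ℝ≥0∞).toReal⁻¹ with hm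
  have hm0 : 0 ≤ m := by positivity
  -- Paths in P₁ are Hölder continuous of exponent 1/2 into H₀, so mesh `2 * T / N` gives a uniform
  -- error of its square root; `m` converts uniform bounds into L² bounds.
  obtain ⟨N, hN0, hN⟩ : ∃ N : ℕ, 0 < N ∧ m * √(2 * T / N) ≤ ε / 2 := by
    have h1 : Filter.Tendsto (fun N : ℕ => m * √(2 * T / N)) Filter.atTop (nhds (m * √0)) :=
      (((continuous_const.mul Real.continuous_sqrt).tendsto 0).comp
        (tendsto_const_div_atTop_nhds_zero_nat (2 * T)))
    rw [Real.sqrt_zero, mul_zero] at h1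
    have h2 := (h1.eventually_le_const (half_pos hε)).and (Filter.eventually_gt_atTop 0)
    obtain ⟨N, h3, h4⟩ := h2.exists
    exact ⟨N, h4, h3⟩
  set δ : ℝ := 2 * T / N with hδ
  have hNr : (0 : ℝ) < N := Nat.cast_pos.2 hN0
  have hδ0 : 0 < δ := by positivity
  have hNδ : N * δ = 2 * T := by rw [hδ]; field_simp
  let τ : ℕ → ℝ := fun j => -T + j * δ
  have hτ : ∀ j ∈ Finset.range N, τ j ∈ Icc (-T) T := fun j hj => by
    have h1 : (j : ℝ) ≤ N := by exact_mod_cast (Finset.mem_range.1 hj).le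
    have h2 : j * δ ≤ N * δ := mul_le_mul_of_nonneg_right h1 hδ0.le
    exact ⟨le_add_of_nonneg_right (by positivity), by simp only [τ]; linarith⟩
  -- The step function with value `Q ξ(τ j)` on the `j`-th interval: finitely many values in a
  -- finite dimensional space.
  let Ψ : P.P1 T →L[ℝ] P.P0 T := ∑ j ∈ (Finset.range N).attach,
    indicatorOp H₀ T (measurableSet_Ioc (a := τ j) (b := τ (j + 1))) ∘L Q ∘L P.halfInclL ∘L
      P1.eval hT (τ j) (hτ j j.2)
  refine ⟨Ψ, ?_, ContinuousLinearMap.opNorm_le_bound _ hε.le fun ξ => ?_⟩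
  · simp only [Ψ]
    have hsum : ∀ s : Finset (Finset.range N), (∑ j ∈ s,
        indicatorOp H₀ T (measurableSet_Ioc (a := τ j) (b := τ (j + 1))) ∘L Q ∘L P.halfInclL ∘L
        P1.eval hT (τ j) (hτ j j.2)).toLinearMap.HasFiniteRange := fun s =>
      Finset.sum_induction _ (fun u : P.P1 T →L[ℝ] P.P0 T => u.toLinearMap.HasFiniteRange)
        (fun _ _ h1 h2 => h1.add h2) LinearMap.HasFiniteRange.zero fun j _ =>
          (hQfin.comp_right (P.halfInclL ∘L P1.eval hT (τ j) (hτ j j.2)).toLinearMap).comp_left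
            (indicatorOp H₀ T (measurableSet_Ioc (a := τ j) (b := τ (j + 1)))).toLinearMap
    exact hsum _
  · have h1 : inclP ξ - Ψ ξ = (P.incl - Q ∘L P.incl).compLpL 2 _ (P1.val ξ) +
        ((Q ∘L P.incl).compLpL 2 _ (P1.val ξ) - Ψ ξ) := by
      have : (P.incl - Q ∘L P.incl).compLpL 2 (volume.restrict (Icc (-T) T)) (P1.val ξ) =
          inclP ξ - (Q ∘L P.incl).compLpL 2 _ (P1.val ξ) := by
        refine Lp.ext ?_
        filter_upwards [Lp.coeFn_sub (inclP ξ) ((Q ∘L P.incl).compLpL 2 _ (P1.val ξ)),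
          coeFn_inclP ξ, (Q ∘L P.incl).coeFn_compLpL (P1.val ξ),
          (P.incl - Q ∘L P.incl).coeFn_compLpL (P1.val ξ)] with s h1 h2 h3 h4
        rw [h1, h4, Pi.sub_apply, h2, h3]
        rfl
      rw [this]; abel
    have hA : ‖(P.incl - Q ∘L P.incl).compLpL 2 (volume.restrict (Icc (-T) T)) (P1.val ξ)‖ ≤
        ε / 2 * ‖ξ‖ :=
      (ContinuousLinearMap.norm_compLp_le _ _).trans
        (mul_le_mul hQε (P1.norm_val_le ξ) (norm_nonneg _) (half_pos hε).le)
    have hΨ : Ψ ξ =ᵐ[volume.restrict (Icc (-T) T)] fun s => ∑ j ∈ Finset.range N,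
        (Ioc (τ j) (τ (j + 1))).indicator (fun _ => Q (P1.rep hT ξ (τ j))) s := by
      have h2 : Ψ ξ = ∑ j ∈ (Finset.range N).attach,
          indicatorOp H₀ T (measurableSet_Ioc (a := τ j) (b := τ (j + 1)))
            (Q (P1.rep hT ξ (τ j))) := by
        simp only [Ψ, _root_.sum_apply]
        rfl
      rw [h2]
      have h3 : ∀ s : Finset (Finset.range N), (⇑(∑ j ∈ s,
          indicatorOp H₀ T (measurableSet_Ioc (a := τ j) (b := τ (j + 1)))
            (Q (P1.rep hT ξ (τ j)))) : ℝ → H₀) =ᵐ[volume.restrict (Icc (-T) T)]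
          fun t => ∑ j ∈ s,
            (Ioc (τ j) (τ (j + 1))).indicator (fun _ => Q (P1.rep hT ξ (τ j))) t := by
        intro s
        induction s using Finset.induction_on with
        | empty =>
          simp only [Finset.sum_empty]
          exact Lp.coeFn_zero _ _ _
        | insert j s hj ih =>
          rw [Finset.sum_insert hj]
          filter_upwards [Lp.coeFn_add (indicatorOp H₀ T (measurableSet_Ioc (a := τ j)
              (b := τ (j + 1))) (Q (P1.rep hT ξ (τ j)))) (∑ j ∈ s,
              indicatorOp H₀ T (measurableSet_Ioc (a := τ j) (b := τ (j + 1)))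
              (Q (P1.rep hT ξ (τ j)))), ih, coeFn_indicatorOp (T := T)
              (measurableSet_Ioc (a := τ j) (b := τ (j + 1))) (Q (P1.rep hT ξ (τ j)))]
            with t h4 h5 h6
          rw [h4, Pi.add_apply, h5, h6, Finset.sum_insert hj]
      refine (h3 _).trans (.of_forall fun t => ?_)
      exact Finset.sum_attach (Finset.range N) fun j =>
        (Ioc (τ j) (τ (j + 1))).indicator (fun _ => Q (P1.rep hT ξ (τ j))) t
    have hB : ‖(Q ∘L P.incl).compLpL 2 (volume.restrict (Icc (-T) T)) (P1.val ξ) - Ψ ξ‖ ≤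
        m * (√δ * ‖ξ‖) := by
      refine Lp.norm_le_of_ae_bound (by positivity) ?_
      -- The intervals `Ioc (τ j) (τ (j + 1))` miss the left end point.
      have hne : ∀ᵐ s ∂volume.restrict (Icc (-T) T), s ≠ -T :=
        Measure.ae_ne _ _
      filter_upwards [Lp.coeFn_sub ((Q ∘L P.incl).compLpL 2 _ (P1.val ξ)) (Ψ ξ), hΨ,
        (Q ∘L P.incl).coeFn_compLpL (P1.val ξ), P1.rep_ae_eq hT ξ,
        ae_restrict_mem measurableSet_Icc, hne] with s h2 h3 h4 h5 hs hs'
      have hs0 : 0 < s + T := by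
        have := lt_of_le_of_ne hs.1 hs'.symm
        linarith
      -- Intervals are open on the left and closed on the right, so the index of the interval
      -- containing `s` is the ceiling minus one.
      obtain ⟨j, hj⟩ : ∃ j : ℕ, ⌈(s + T) / δ⌉₊ = j + 1 :=
        Nat.exists_eq_succ_of_ne_zero (Nat.ceil_pos.2 (by positivity)).ne'
      have hj1 : (j : ℝ) < (s + T) / δ := by
        rw [← Nat.lt_ceil]; omega
      have hj2 : (s + T) / δ ≤ j + 1 := by
        have := Nat.le_ceil ((s + T) / δ)
        rw [hj] at this
        exact_mod_cast this
      rw [lt_div_iff₀ hδ0] at hj1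
      rw [div_le_iff₀ hδ0] at hj2
      have hjN : j ∈ Finset.range N := by
        rw [Finset.mem_range]
        have : (j : ℝ) * δ < N * δ := by linarith [hs.2]
        exact_mod_cast lt_of_mul_lt_mul_right this hδ0.le
      have hsum : ∑ j ∈ Finset.range N,
          (Ioc (τ j) (τ (j + 1))).indicator (fun _ => Q (P1.rep hT ξ (τ j))) s =
            Q (P1.rep hT ξ (τ j)) := by
        rw [Finset.sum_eq_single j]
        · rw [indicator_of_mem]
          constructor
          · simp only [τ]; linarith
          · simp only [τ]; push_cast; linarith
        · intro k _ hk
          refine indicator_of_notMem (fun hks => hk ?_) _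
          have h6 : (k : ℝ) * δ < (j + 1) * δ := by
            have := hks.1; simp only [τ] at this; linarith
          have h7 : (j : ℝ) * δ < (k + 1) * δ := by
            have := hks.2; simp only [τ] at this; push_cast at this; linarith
          have h8 := lt_of_mul_lt_mul_right h6 hδ0.le
          have h9 := lt_of_mul_lt_mul_right h7 hδ0.le
          have h8' : k < j + 1 := by exact_mod_cast h8
          have h9' : j < k + 1 := by exact_mod_cast h9
          omega
        · exact fun h => absurd hjN h
      rw [h2, Pi.sub_apply, h3, hsum, h4, ContinuousLinearMap.comp_apply, h5, ← map_sub]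
      refine (Q.le_of_opNorm_le hQ1 _).trans ?_
      rw [one_mul]
      have hjs : τ j ≤ s := by simp only [τ]; linarith
      refine (P1.norm_rep_sub_le hT ξ (hτ j hjN) hs hjs).trans ?_
      gcongr
      simp only [τ]; linarith
    rw [_root_.sub_apply, h1]
    refine (norm_add_le _ _).trans ?_
    have h2 : m * (√δ * ‖ξ‖) ≤ ε / 2 * ‖ξ‖ := by
      rw [← mul_assoc]
      exact mul_le_mul_of_nonneg_right hN (norm_nonneg _)
    linarith

/-! ### Multiplication of paths by smooth functions -/

/-- The product of `χ` with a test function is again a test function, to which the weak derivative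
of `ξ` is applied. -/
theorem isWeakDeriv_smul {χ : ℝ → ℝ} (hχ : ContDiff ℝ ∞ χ) (ξ : P.P1 T) :
    IsWeakDeriv T (fun s => χ s • P.incl (P1.val ξ s))
      (fun s => deriv χ s • P.incl (P1.val ξ s) + χ s • P1.der ξ s) := by
  intro φ hφ
  have hdχ : Continuous (deriv χ) := hχ.continuous_deriv (by simp)
  have hdφ : Continuous (deriv φ) := hφ.contDiff.continuous_deriv (by simp)
  have htest : IsTestFunction T fun s => φ s * χ s :=
    ⟨hφ.contDiff.mul hχ, hφ.hasCompactSupport.mul_right,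
      (tsupport_mul_subset_left).trans hφ.tsupport_subset⟩
  have hder : ∀ s, deriv (fun s => φ s * χ s) s = deriv φ s * χ s + φ s * deriv χ s := fun s =>
    deriv_fun_mul ((hφ.contDiff.differentiable (by simp)) s) ((hχ.differentiable (by simp)) s)
  have hw := P1.integrableOn_val ξ
  have hv := P1.integrableOn_der ξ
  have i1 : IntegrableOn (fun s => (deriv φ s * χ s) • P.incl (P1.val ξ s)) (Icc (-T) T) :=
    IsTestFunction.integrableOn_smul (hdφ.mul hχ.continuous) hw
  have i2 : IntegrableOn (fun s => (φ s * deriv χ s) • P.incl (P1.val ξ s)) (Icc (-T) T) :=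
    IsTestFunction.integrableOn_smul (hφ.contDiff.continuous.mul hdχ) hw
  have i3 : IntegrableOn (fun s => (φ s * χ s) • P1.der ξ s) (Icc (-T) T) :=
    IsTestFunction.integrableOn_smul (hφ.contDiff.continuous.mul hχ.continuous) hv
  have h := P1.isWeakDeriv ξ _ htest
  simp only [hder, add_smul] at h
  rw [integral_add i1 i2] at h
  simp only [smul_smul, smul_add]
  rw [integral_add i2 i3, eq_neg_iff_add_eq_zero] at *
  rw [← h]; abel

/-- Multiplication of a path by a smooth function. -/
def P1.smulSmooth {χ : ℝ → ℝ} (hχ : ContDiff ℝ ∞ χ) : P.P1 T →L[ℝ] P.P1 T :=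
  ((WithLp.prodContinuousLinearEquiv 2 ℝ (Lp H₁ 2 (volume.restrict (Icc (-T) T)))
      (Lp H₀ 2 (volume.restrict (Icc (-T) T)))).symm.toContinuousLinearMap ∘L
    ((smulOp hχ.continuous ∘L P1.val).prod
      (smulOp (hχ.continuous_deriv (by simp)) ∘L inclP + smulOp hχ.continuous ∘L P1.der))).codRestrict
    (P.P1 T) fun ξ => by
      intro φ hφ
      have h := isWeakDeriv_smul hχ ξ φ hφ
      refine Eq.trans (integral_congr_ae ?_) (h.trans (congrArg Neg.neg (integral_congr_ae ?_)))
      · filter_upwards [coeFn_smulOp hχ.continuous (P1.val ξ)] with s hs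
        change deriv φ s • P.incl (smulOp hχ.continuous (P1.val ξ) s) = _
        rw [hs, map_smul]
      · filter_upwards [Lp.coeFn_add (smulOp (hχ.continuous_deriv (by simp)) (inclP ξ))
            (smulOp hχ.continuous (P1.der ξ)), coeFn_smulOp hχ.continuous (P1.der ξ),
          coeFn_smulOp (hχ.continuous_deriv (by simp)) (inclP ξ), coeFn_inclP ξ] with s h1 h2 h3 h4
        change _ = φ s • (smulOp (hχ.continuous_deriv (by simp)) (inclP ξ) +
            smulOp hχ.continuous (P1.der ξ) : P.P0 T) s
        rw [h1, Pi.add_apply, h2, h3, h4]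

theorem P1.val_smulSmooth {χ : ℝ → ℝ} (hχ : ContDiff ℝ ∞ χ) (ξ : P.P1 T) :
    P1.val (P1.smulSmooth hχ ξ) = smulOp hχ.continuous (P1.val ξ) := rfl

theorem P1.der_smulSmooth {χ : ℝ → ℝ} (hχ : ContDiff ℝ ∞ χ) (ξ : P.P1 T) :
    P1.der (P1.smulSmooth hχ ξ) = smulOp (hχ.continuous_deriv (by simp)) (inclP ξ) +
      smulOp hχ.continuous (P1.der ξ) := rfl

theorem P1.eval_smulSmooth (hT : 0 < T) {χ : ℝ → ℝ} (hχ : ContDiff ℝ ∞ χ) (ξ : P.P1 T) {t : ℝ}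
    (ht : t ∈ Icc (-T) T) :
    P1.eval hT t ht (P1.smulSmooth hχ ξ) = χ t • P1.eval hT t ht ξ := by
  apply P.halfIncl_injective
  rw [map_smul, P1.halfIncl_eval, P1.halfIncl_eval]
  refine P1.rep_unique hT _ (g := fun s => χ s • P1.rep hT ξ s)
    (hχ.continuous.continuousOn.smul (P1.continuousOn_rep hT ξ)) ?_ ht
  filter_upwards [coeFn_smulOp hχ.continuous (P1.val ξ), P1.rep_ae_eq hT ξ] with s h1 h2
  rw [P1.val_smulSmooth, h1, map_smul, h2]

/-- The operators `A s` commute with scalars, so only the derivative contributes to the commutator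
with the cut-off, and the commutator is of order zero. -/
theorem opD_smulSmooth {A : ℝ → H₁ →L[ℝ] H₀} (hA : ContinuousOn A (Icc (-T) T)) {χ : ℝ → ℝ}
    (hχ : ContDiff ℝ ∞ χ) (ξ : P.P1 T) :
    P.opD hA (P1.smulSmooth hχ ξ) = smulOp (hχ.continuous_deriv (by simp)) (inclP ξ) +
      smulOp hχ.continuous (P.opD hA ξ) := by
  change P1.der (P1.smulSmooth hχ ξ) + mulOp hA (P1.val (P1.smulSmooth hχ ξ)) =
    _ + smulOp hχ.continuous (P1.der ξ + mulOp hA (P1.val ξ))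
  rw [P1.der_smulSmooth, P1.val_smulSmooth, map_add, add_assoc]
  congr 2
  refine Lp.ext ?_
  filter_upwards [coeFn_mulOp hA (smulOp hχ.continuous (P1.val ξ)),
    coeFn_smulOp hχ.continuous (P1.val ξ), coeFn_smulOp hχ.continuous (mulOp hA (P1.val ξ)),
    coeFn_mulOp hA (P1.val ξ)] with s h1 h2 h3 h4
  rw [h1, h2, h3, h4, map_smul]

/-- The constant path. -/
def P1.const (hT : 0 < T) (v : H₁) : P.P1 T :=
  ⟨WithLp.toLp 2 ((memLp_const v).toLp, 0), by
    intro φ hφ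
    have h := isWeakDeriv_primitive hT (v := fun _ => (0 : H₀)) integrableOn_zero (P.incl v) φ hφ
    refine Eq.trans (integral_congr_ae ?_) (h.trans (congrArg Neg.neg (integral_congr_ae ?_)))
    · filter_upwards [(memLp_const (p := 2) (μ := volume.restrict (Icc (-T) T)) v).coeFn_toLp]
        with s hs
      change deriv φ s • P.incl ((memLp_const v).toLp (fun _ => v) s) = _
      rw [hs]; simp
    · filter_upwards [Lp.coeFn_zero H₀ 2 (volume.restrict (Icc (-T) T))] with s hs
      change _ = φ s • (0 : P.P0 T) s
      rw [hs]; rfl⟩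

theorem P1.coeFn_val_const (hT : 0 < T) (v : H₁) :
    P1.val (P1.const hT v : P.P1 T) =ᵐ[volume.restrict (Icc (-T) T)] fun _ => v :=
  (memLp_const v).coeFn_toLp

theorem P1.der_const (hT : 0 < T) (v : H₁) : P1.der (P1.const hT v : P.P1 T) = 0 := rfl

theorem P1.eval_const (hT : 0 < T) (v : H₁) {t : ℝ} (ht : t ∈ Icc (-T) T) :
    P1.eval hT t ht (P1.const hT v : P.P1 T) = P.toHalf v := by
  apply P.halfIncl_injective
  rw [P1.halfIncl_eval, halfIncl_toHalf]
  refine P1.rep_unique hT _ (g := fun _ => P.incl v) continuousOn_const ?_ ht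
  filter_upwards [P1.coeFn_val_const (P := P) hT v] with s hs
  rw [hs]

end HilbertPair
end
noncomputable section

/-! ### The model operator of a constant path -/

/-- Integration by parts for the square of a primitive. -/
theorem two_mul_integral_mul_primitive {T : ℝ} (hT : 0 < T) {w v : ℝ → ℝ}
    (hv : IntegrableOn v (Icc (-T) T))
    (h : ∀ t ∈ Icc (-T) T, w t - w (-T) = ∫ r in (-T)..t, v r) :
    2 * ∫ s in Icc (-T) T, v s * w s = w T ^ 2 - w (-T) ^ 2 := by
  have hle : -T ≤ T := by linarith
  have hvi : IntervalIntegrable v volume (-T) T :=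
    (intervalIntegrable_iff_integrableOn_Icc_of_le hle).2 hv
  set g : ℝ → ℝ := fun t => ∫ r in (-T)..t, v r with hg
  have hac : AbsolutelyContinuousOnInterval g (-T) T :=
    hvi.absolutelyContinuousOnInterval_intervalIntegral (by simp)
  have h1 := hac.integral_deriv_mul_eq_sub hac
  have h2 : ∫ x in (-T)..T, deriv g x * g x + g x * deriv g x = ∫ x in (-T)..T, 2 * (v x * g x) := by
    refine intervalIntegral.integral_congr_ae ?_
    filter_upwards [hvi.ae_hasDerivAt_integral] with x hx hx'
    rw [(hx (uIoc_subset_uIcc hx') (-T) (by simp)).deriv]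
    ring
  have h3 : ∫ s in Icc (-T) T, v s * w s = ∫ x in (-T)..T, (v x * w (-T) + v x * g x) := by
    rw [intervalIntegral.integral_of_le hle, ← integral_Icc_eq_integral_Ioc]
    refine setIntegral_congr_fun measurableSet_Icc fun s hs => ?_
    have : w s = w (-T) + g s := by linarith [h s hs]
    simp only [this]; ring
  have hvg : IntervalIntegrable (fun x => v x * g x) volume (-T) T :=
    hvi.mul_continuousOn hac.continuousOn
  rw [h2, intervalIntegral.integral_const_mul] at h1
  rw [h3, intervalIntegral.integral_add (hvi.mul_const _) hvg,
    intervalIntegral.integral_mul_const]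
  have hg0 : g (-T) = 0 := by simp [hg]
  have hgT : ∫ r in (-T)..T, v r = g T := rfl
  have hwT : w T = w (-T) + g T := by rw [← hgT, ← h T ⟨hle, le_rfl⟩]; ring
  rw [hg0] at h1
  rw [hgT, hwT]
  linarith

/-- The a priori estimate for the scalar equation `w' + a w = f`. -/
theorem scalar_estimate {T : ℝ} (hT : 0 < T) {w v : ℝ → ℝ} (hw : ContinuousOn w (Icc (-T) T))
    (hv : IntegrableOn v (Icc (-T) T)) (hv2 : IntegrableOn (fun s => v s ^ 2) (Icc (-T) T))
    (h : ∀ t ∈ Icc (-T) T, w t - w (-T) = ∫ r in (-T)..t, v r) (a : ℝ) :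
    (∫ s in Icc (-T) T, v s ^ 2) + ∫ s in Icc (-T) T, (a * w s) ^ 2 ≤
      (∫ s in Icc (-T) T, (v s + a * w s) ^ 2) +
        |a| * (if 0 < a then w (-T) ^ 2 else w T ^ 2) := by
  have hibp := two_mul_integral_mul_primitive hT hv h
  have i1 : IntegrableOn (fun s => (a * w s) ^ 2) (Icc (-T) T) :=
    ((continuousOn_const.mul hw).pow 2).integrableOn_Icc
  have i3 : IntegrableOn (fun s => v s ^ 2 + (a * w s) ^ 2) (Icc (-T) T) := hv2.add i1
  have i2 : IntegrableOn (fun s => 2 * a * (v s * w s)) (Icc (-T) T) :=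
    (hv.mul_continuousOn hw isCompact_Icc).const_mul _
  -- The mixed term is the integral of a total derivative, hence a boundary term.
  have h1 : ∫ s in Icc (-T) T, (v s + a * w s) ^ 2 =
      (∫ s in Icc (-T) T, v s ^ 2) + (∫ s in Icc (-T) T, (a * w s) ^ 2) +
        a * (w T ^ 2 - w (-T) ^ 2) := by
    rw [← hibp, ← integral_add hv2 i1, ← mul_assoc, mul_comm a 2, ← integral_const_mul,
      ← integral_add i3 i2]
    refine integral_congr_ae (.of_forall fun s => ?_)
    ring
  rw [h1]
  -- For `a > 0` the term at `T` has the good sign and only the value at `-T` has to be added;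
  -- otherwise the ends change roles.
  split_ifs with ha
  · rw [abs_of_pos ha]; nlinarith [sq_nonneg (w T)]
  · rw [abs_of_nonpos (not_lt.1 ha)]; nlinarith [sq_nonneg (w (-T)), not_lt.1 ha]

namespace HilbertPair

variable {H₀ H₁ : Type*} [NormedAddCommGroup H₀] [InnerProductSpace ℝ H₀] [CompleteSpace H₀]
  [NormedAddCommGroup H₁] [InnerProductSpace ℝ H₁] [CompleteSpace H₁] {P : HilbertPair H₀ H₁}
  {T : ℝ}

variable (P) in
/-- The augmented operator `ξ ↦ (∂ₛ ξ + A ξ, π₊ ξ(-T), π₋ ξ(T))`, with the spectral projections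
of `Cl` and `Cr` respectively. -/
def augOp (hT : 0 < T) {A : ℝ → H₁ →L[ℝ] H₀} (hA : ContinuousOn A (Icc (-T) T))
    (Cl Cr : H₁ →L[ℝ] H₀) : P.P1 T →L[ℝ] P.P0 T × P.halfPlus Cl × P.halfMinus Cr :=
  (P.opD hA).prod ((P.projPlus Cl ∘L P1.eval hT (-T) ⟨le_rfl, by linarith⟩).prod
    (P.projMinus Cr ∘L P1.eval hT T ⟨by linarith, le_rfl⟩))

theorem shift_zero (C : H₁ →L[ℝ] H₀) : P.shift C 0 = C := by
  rw [shift, zero_smul, sub_zero]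

theorem coeFn_opD {A : ℝ → H₁ →L[ℝ] H₀} (hA : ContinuousOn A (Icc (-T) T)) (ξ : P.P1 T) :
    P.opD hA ξ =ᵐ[volume.restrict (Icc (-T) T)] fun s => P1.der ξ s + A s (P1.val ξ s) := by
  filter_upwards [Lp.coeFn_add (P1.der ξ) (mulOp hA (P1.val ξ)), coeFn_mulOp hA (P1.val ξ)]
    with s h1 h2
  change (P1.der ξ + mulOp hA (P1.val ξ) : P.P0 T) s = _
  rw [h1, Pi.add_apply, h2]

theorem integrable_sq_clm (L : H₀ →L[ℝ] ℝ) (f : P.P0 T) :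
    IntegrableOn (fun s => L (f s) ^ 2) (Icc (-T) T) := by
  refine (integrable_norm_sq (L.compLp f)).congr ?_
  filter_upwards [L.coeFn_compLp f] with s hs
  rw [hs, Real.norm_eq_abs, sq_abs]

namespace EigenSystem

variable {C : H₁ →L[ℝ] H₀} (S : P.EigenSystem C)

theorem summable_coef_sq (x : H₀) : Summable fun i => S.coef i x ^ 2 :=
  summable_of_sum_le (fun _ => sq_nonneg _) fun F => S.bessel F x

/-- Parseval's inequality is integrated in time and Tonelli interchanges sum and integral. Working
in `ℝ≥0∞` avoids any summability question, and the supremum over finite sets of modes is bounded by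
assumption. -/
theorem norm_sq_le_of_integral_coef (f : P.P0 T) {M : ℝ}
    (h : ∀ F : Finset S.idx, ∑ i ∈ F, ∫ s in Icc (-T) T, S.coef i (f s) ^ 2 ≤ M) :
    ‖f‖ ^ 2 ≤ S.c * M := by
  have hM : 0 ≤ M := by simpa using h ∅
  have hc := S.c_pos
  rw [Lp_norm_sq, ← ENNReal.ofReal_le_ofReal_iff (by positivity),
    ofReal_integral_eq_lintegral_ofReal (integrable_norm_sq f) (.of_forall fun _ => sq_nonneg _)]
  calc ∫⁻ s in Icc (-T) T, ENNReal.ofReal (‖f s‖ ^ 2)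
      ≤ ∫⁻ s in Icc (-T) T, ENNReal.ofReal S.c * ∑' i, ENNReal.ofReal (S.coef i (f s) ^ 2) := by
        refine lintegral_mono fun s => ?_
        rw [← ENNReal.ofReal_tsum_of_nonneg (fun _ => sq_nonneg _) (S.summable_coef_sq _),
          ← ENNReal.ofReal_mul hc.le]
        exact ENNReal.ofReal_le_ofReal (S.parseval _)
    _ = ENNReal.ofReal S.c * ∑' i, ∫⁻ s in Icc (-T) T, ENNReal.ofReal (S.coef i (f s) ^ 2) := by
        rw [lintegral_const_mul' _ _ ENNReal.ofReal_ne_top, lintegral_tsum]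
        exact fun i => (integrable_sq_clm (S.coef i) f).aestronglyMeasurable.aemeasurable.ennreal_ofReal
    _ ≤ ENNReal.ofReal S.c * ENNReal.ofReal M := by
        gcongr
        rw [ENNReal.tsum_eq_iSup_sum]
        refine iSup_le fun F => ?_
        refine le_trans (le_of_eq ?_) (ENNReal.ofReal_le_ofReal (h F))
        rw [ENNReal.ofReal_sum_of_nonneg fun i _ => integral_nonneg fun s => sq_nonneg _]
        refine Finset.sum_congr rfl fun i _ => ?_
        exact (ofReal_integral_eq_lintegral_ofReal (integrable_sq_clm (S.coef i) f)
          (.of_forall fun _ => sq_nonneg _)).symm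
    _ = ENNReal.ofReal (S.c * M) := (ENNReal.ofReal_mul hc.le).symm

section Model

variable (hC : Function.Bijective C)
include hC

theorem bijective_shift_zero : Function.Bijective (P.shift C 0) := by rwa [shift_zero]

theorem coefHalf_projPlus_zero (x : P.Half) {i : S.idx} (hi : 0 < S.a i) :
    S.coefHalf i (P.projPlus C x) = S.coefHalf i x := by
  have := S.coefHalf_projPlus (bijective_shift_zero hC) x hi
  rwa [shift_zero] at this

theorem coefHalf_projMinus_zero (x : P.Half) {i : S.idx} (hi : S.a i < 0) :
    S.coefHalf i (P.projMinus C x) = S.coefHalf i x := by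
  have := S.coefHalf_projMinus (bijective_shift_zero hC) x hi
  rwa [shift_zero] at this

include S in
theorem isTopCompl_zero : Submodule.IsTopCompl (P.halfPlus C) (P.halfMinus C) := by
  have := S.isTopCompl (bijective_shift_zero hC)
  rwa [shift_zero] at this

theorem projMinus_v {i : S.idx} (hi : 0 < S.a i) : P.projMinus C (P.toHalf (S.v i)) = 0 := by
  refine projMinus_of_mem_plus (S.isTopCompl_zero hC) ?_
  have := S.toHalf_v_mem_halfPlus hi
  rwa [shift_zero] at this

theorem projPlus_v {i : S.idx} (hi : S.a i < 0) : P.projPlus C (P.toHalf (S.v i)) = 0 := by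
  refine projPlus_of_mem_minus (S.isTopCompl_zero hC) ?_
  have := S.toHalf_v_mem_halfMinus hi
  rwa [shift_zero] at this

/-- The `i`-th coordinate of the path satisfies a scalar equation with coefficient `S.a i`, so
`scalar_estimate` applies. The boundary value it asks for is a coordinate of π₊ ξ(-T) or of π₋ ξ(T),
according to the sign of `S.a i`; both terms are kept on the right. -/
theorem mode_estimate (hT : 0 < T) (ξ : P.P1 T) (i : S.idx) :
    (∫ s in Icc (-T) T, S.coef i (P1.der ξ s) ^ 2) + (∫ s in Icc (-T) T,
        S.coef i (mulOp (continuousOn_const (c := C)) (P1.val ξ) s) ^ 2) ≤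
      (∫ s in Icc (-T) T, S.coef i (P.opD (continuousOn_const (c := C)) ξ s) ^ 2) +
        (|S.a i| * S.coefHalf i (P.projPlus C (P1.eval hT (-T) ⟨le_rfl, by linarith⟩ ξ)) ^ 2 +
        |S.a i| * S.coefHalf i (P.projMinus C (P1.eval hT T ⟨by linarith, le_rfl⟩ ξ)) ^ 2) := by
  have h := scalar_estimate hT (w := fun s => S.coef i (P1.rep hT ξ s))
    (v := fun s => S.coef i (P1.der ξ s))
    ((S.coef i).continuous.comp_continuousOn (P1.continuousOn_rep hT ξ))
    ((S.coef i).integrable_comp (P1.integrableOn_der ξ)) (integrable_sq_clm _ _)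
    (fun t ht => by
      rw [← map_sub, P1.rep_sub hT ξ ⟨le_rfl, by linarith⟩ ht,
        ContinuousLinearMap.intervalIntegral_comp_comm]
      rw [intervalIntegrable_iff_integrableOn_Icc_of_le ht.1]
      exact (P1.integrableOn_der ξ).mono_set (Icc_subset_Icc_right ht.2)) (S.a i)
  have hCv : ∀ᵐ s ∂volume.restrict (Icc (-T) T), S.coef i (mulOp (continuousOn_const (c := C))
      (P1.val ξ) s) = S.a i * S.coef i (P1.rep hT ξ s) := by
    filter_upwards [coeFn_mulOp (continuousOn_const (c := C)) (P1.val ξ), P1.rep_ae_eq hT ξ]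
      with s h1 h2
    rw [h1, S.coef_op, h2]
  have hD : ∀ᵐ s ∂volume.restrict (Icc (-T) T), S.coef i (P.opD (continuousOn_const (c := C)) ξ s) =
      S.coef i (P1.der ξ s) + S.a i * S.coef i (P1.rep hT ξ s) := by
    filter_upwards [coeFn_opD (continuousOn_const (c := C)) ξ, P1.rep_ae_eq hT ξ] with s h1 h2
    rw [h1, map_add, S.coef_op, h2]
  rw [integral_congr_ae (hCv.mono fun s hs => congrArg (· ^ 2) hs),
    integral_congr_ae (hD.mono fun s hs => congrArg (· ^ 2) hs)]
  refine h.trans (add_le_add le_rfl ?_)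
  split_ifs with ha
  · rw [S.coefHalf_projPlus_zero hC _ ha]
    exact le_add_of_nonneg_right (by positivity)
  · have ha' : S.a i < 0 := lt_of_le_of_ne (not_lt.1 ha) (S.a_ne (bijective_shift_zero hC) i)
    rw [S.coefHalf_projMinus_zero hC _ ha']
    exact le_add_of_nonneg_left (by positivity)

include S in
-- The mode estimates are summed; Bessel's inequality bounds the interior terms and
-- `exists_half_bessel` the boundary terms. This controls ∂ₛξ and Cξ in L² with values in H₀, and
-- invertibility of `C` converts the latter into a bound of ξ with values in H₁.
theorem exists_antilipschitz (hT : 0 < T) :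
    ∃ K, AntilipschitzWith K (P.augOp hT (continuousOn_const (c := C)) C C) := by
  obtain ⟨c', hc', hb⟩ := S.exists_half_bessel
  obtain ⟨Ceq, hCeq⟩ := exists_equiv_of_bijective hC
  have hc := S.c_pos
  set k : ℝ := ‖(Ceq.symm : H₀ →L[ℝ] H₁)‖ with hk
  set m : ℝ := S.c * (S.c + 2 * c') with hm
  have hm0 : 0 ≤ m := by positivity
  have key : ∀ ξ : P.P1 T, ‖ξ‖ ≤
      √((k ^ 2 + 1) * m) * ‖P.augOp hT (continuousOn_const (c := C)) C C ξ‖ := by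
    intro ξ
    set N := ‖P.augOp hT (continuousOn_const (c := C)) C C ξ‖ with hN
    set f := P.opD (continuousOn_const (c := C)) ξ with hf
    set x := P.projPlus C (P1.eval hT (-T) ⟨le_rfl, by linarith⟩ ξ) with hx
    set y := P.projMinus C (P1.eval hT T ⟨by linarith, le_rfl⟩ ξ) with hy
    have hfN : ‖f‖ ≤ N := norm_fst_le (P.augOp hT (continuousOn_const (c := C)) C C ξ)
    have hxN : ‖(x : P.Half)‖ ≤ N :=
      (norm_fst_le (P.augOp hT (continuousOn_const (c := C)) C C ξ).2).trans (norm_snd_le _)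
    have hyN : ‖(y : P.Half)‖ ≤ N :=
      (norm_snd_le (P.augOp hT (continuousOn_const (c := C)) C C ξ).2).trans (norm_snd_le _)
    have hsum : ∀ F : Finset S.idx, ∑ i ∈ F, ((∫ s in Icc (-T) T, S.coef i (P1.der ξ s) ^ 2) +
        (∫ s in Icc (-T) T, S.coef i (mulOp (continuousOn_const (c := C)) (P1.val ξ) s) ^ 2)) ≤
        (S.c + 2 * c') * N ^ 2 := by
      intro F
      refine (Finset.sum_le_sum fun i _ => S.mode_estimate hC hT ξ i).trans ?_
      rw [Finset.sum_add_distrib, Finset.sum_add_distrib]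
      have h1 : ∑ i ∈ F, ∫ s in Icc (-T) T, S.coef i (f s) ^ 2 ≤ S.c * ‖f‖ ^ 2 := by
        rw [← integral_finsetSum _ fun i _ => integrable_sq_clm (S.coef i) f, Lp_norm_sq,
          ← integral_const_mul]
        exact integral_mono (integrable_finsetSum _ fun i _ => integrable_sq_clm (S.coef i) f)
          ((integrable_norm_sq f).const_mul _) fun s => S.bessel F (f s)
      have h2 := hb F (x : P.Half)
      have h3 := hb F (y : P.Half)
      have h4 : S.c * ‖f‖ ^ 2 ≤ S.c * N ^ 2 := by gcongr
      have h5 : c' * ‖(x : P.Half)‖ ^ 2 ≤ c' * N ^ 2 := by gcongr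
      have h6 : c' * ‖(y : P.Half)‖ ^ 2 ≤ c' * N ^ 2 := by gcongr
      linarith
    have h1 : ‖P1.der ξ‖ ^ 2 ≤ m * N ^ 2 := by
      rw [hm, mul_assoc]
      exact S.norm_sq_le_of_integral_coef _ fun F => (Finset.sum_le_sum fun i _ =>
        le_add_of_nonneg_right (integral_nonneg fun s => sq_nonneg _)).trans (hsum F)
    have h2 : ‖mulOp (continuousOn_const (c := C)) (P1.val ξ)‖ ^ 2 ≤ m * N ^ 2 := by
      rw [hm, mul_assoc]
      exact S.norm_sq_le_of_integral_coef _ fun F => (Finset.sum_le_sum fun i _ =>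
        le_add_of_nonneg_left (integral_nonneg fun s => sq_nonneg _)).trans (hsum F)
    have h3 : ‖P1.val ξ‖ ≤ k * ‖mulOp (continuousOn_const (c := C)) (P1.val ξ)‖ := by
      refine Lp.norm_le_mul_norm_of_ae_le_mul ?_
      filter_upwards [coeFn_mulOp (continuousOn_const (c := C)) (P1.val ξ)] with s hs
      have h4 := (Ceq.symm : H₀ →L[ℝ] H₁).le_opNorm (C (P1.val ξ s))
      rw [← hCeq] at h4
      simp only [ContinuousLinearEquiv.coe_coe, ContinuousLinearEquiv.symm_apply_apply] at h4
      rw [hs, ← hCeq]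
      exact h4
    have h4 : ‖P1.val ξ‖ ^ 2 ≤ k ^ 2 * (m * N ^ 2) := by
      refine (pow_le_pow_left₀ (norm_nonneg _) h3 2).trans ?_
      rw [mul_pow]
      gcongr
    refine abs_le_of_sq_le_sq' ?_ (by positivity) |>.2
    rw [P1.norm_sq, mul_pow, Real.sq_sqrt (by positivity)]
    linarith
  refine ⟨Real.toNNReal (√((k ^ 2 + 1) * m)),
    ContinuousLinearMap.antilipschitz_of_bound _ fun ξ => ?_⟩
  rw [Real.coe_toNNReal _ (Real.sqrt_nonneg _)]
  exact key ξ

end Model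

end EigenSystem

end HilbertPair
end
-- Explicit solutions and surjectivity of the model operator
noncomputable section

/-- Smooth solutions of the scalar equation `u' + a u = φ` with zero initial value at `c`. -/
theorem exists_smooth_solution {φ : ℝ → ℝ} (hφ : ContDiff ℝ ∞ φ) (a c : ℝ) :
    ∃ u : ℝ → ℝ, ContDiff ℝ ∞ u ∧ u c = 0 ∧ ∀ s, deriv u s + a * u s = φ s := by
  have hk : ContDiff ℝ ∞ fun r => Real.exp (a * r) * φ r :=
    (Real.contDiff_exp.comp (contDiff_const.mul contDiff_id)).mul hφ
  -- Variation of constants: the solution is the decaying exponential times this primitive.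
  set g : ℝ → ℝ := fun t => ∫ r in c..t, Real.exp (a * r) * φ r with hg
  have hderiv : ∀ t, HasDerivAt g (Real.exp (a * t) * φ t) t := fun t =>
    intervalIntegral.integral_hasDerivAt_right (hk.continuous.intervalIntegrable _ _)
      (hk.continuous.stronglyMeasurableAtFilter _ _) hk.continuous.continuousAt
  have hdg : deriv g = fun r => Real.exp (a * r) * φ r := funext fun t => (hderiv t).deriv
  have hgc : ContDiff ℝ ∞ g :=
    contDiff_infty_iff_deriv.2 ⟨fun t => (hderiv t).differentiableAt, hdg ▸ hk⟩
  refine ⟨fun t => Real.exp (-(a * t)) * g t,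
    (Real.contDiff_exp.comp (contDiff_const.mul contDiff_id).neg).mul hgc, by simp [hg],
    fun s => ?_⟩
  have he : HasDerivAt (fun t => Real.exp (-(a * t))) (Real.exp (-(a * s)) * -a) s := by
    have := (((hasDerivAt_id s).const_mul a).fun_neg).exp
    simpa using this
  rw [(he.fun_mul (hderiv s)).deriv]
  have : Real.exp (-(a * s)) * Real.exp (a * s) = 1 := by rw [← Real.exp_add]; simp
  linear_combination φ s * this

/-- Smooth solutions of the scalar equation `u' + a u = 0` with value one at `c`. -/
theorem exists_smooth_homogeneous (a c : ℝ) :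
    ∃ u : ℝ → ℝ, ContDiff ℝ ∞ u ∧ u c = 1 ∧ ∀ s, deriv u s + a * u s = 0 := by
  refine ⟨fun t => Real.exp (-(a * (t - c))),
    Real.contDiff_exp.comp (contDiff_const.mul (contDiff_id.sub contDiff_const)).neg, by simp,
    fun s => ?_⟩
  have he : HasDerivAt (fun t => Real.exp (-(a * (t - c)))) (Real.exp (-(a * (s - c))) * -a) s := by
    have := ((((hasDerivAt_id s).sub_const c).const_mul a).fun_neg).exp
    simpa using this
  rw [he.deriv]
  ring

theorem neg_mem_Icc {T : ℝ} (hT : 0 < T) : -T ∈ Icc (-T) T := ⟨le_rfl, by linarith⟩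

theorem self_mem_Icc {T : ℝ} (hT : 0 < T) : T ∈ Icc (-T) T := ⟨by linarith, le_rfl⟩

namespace HilbertPair

variable {H₀ H₁ : Type*} [NormedAddCommGroup H₀] [InnerProductSpace ℝ H₀] [CompleteSpace H₀]
  [NormedAddCommGroup H₁] [InnerProductSpace ℝ H₁] [CompleteSpace H₁] {P : HilbertPair H₀ H₁}
  {T : ℝ}

theorem opD_smulSmooth_const (hT : 0 < T) {C : H₁ →L[ℝ] H₀} {a : ℝ} {v : H₁}
    (hv : C v = a • P.incl v) {u φ : ℝ → ℝ} (hu : ContDiff ℝ ∞ u)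
    (h : ∀ s, deriv u s + a * u s = φ s) :
    P.opD (T := T) (continuousOn_const (c := C)) (P1.smulSmooth hu (P1.const hT v)) =ᵐ[
      volume.restrict (Icc (-T) T)] fun s => φ s • P.incl v := by
  rw [opD_smulSmooth]
  filter_upwards [Lp.coeFn_add (smulOp (hu.continuous_deriv (by simp))
      (inclP (P1.const hT v : P.P1 T))) (smulOp hu.continuous
      (P.opD (continuousOn_const (c := C)) (P1.const hT v))),
    coeFn_smulOp (hu.continuous_deriv (by simp)) (inclP (P1.const hT v : P.P1 T)),
    coeFn_smulOp hu.continuous (P.opD (continuousOn_const (c := C)) (P1.const hT v)),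
    coeFn_inclP (P1.const hT v : P.P1 T), coeFn_opD (continuousOn_const (c := C)) (P1.const hT v),
    P1.coeFn_val_const (P := P) hT v, Lp.coeFn_zero H₀ 2 (volume.restrict (Icc (-T) T))]
    with s h1 h2 h3 h4 h5 h6 h7
  rw [h1, Pi.add_apply, h2, h3, h4, h5, P1.der_const, h6, h7, Pi.zero_apply, zero_add, hv,
    smul_smul, ← add_smul, ← h]
  congr 1; ring

namespace EigenSystem

variable {C : H₁ →L[ℝ] H₀} (S : P.EigenSystem C)

section Model

variable (hC : Function.Bijective C)
include hC

/-- A path `u • v i` sees only one boundary projection: π₋ if the eigenvalue is negative, π₊ if it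
is positive. The scalar equation is solved with zero value at that end, so both boundary components
vanish. -/
theorem mem_range_augOp_path (hT : 0 < T) (i : S.idx) {φ : ℝ → ℝ} (hφ : ContDiff ℝ ∞ φ) :
    ∃ f : P.P0 T, (f =ᵐ[volume.restrict (Icc (-T) T)] fun s => φ s • P.incl (S.v i)) ∧
      (f, 0, 0) ∈ (P.augOp hT (continuousOn_const (c := C)) C C).range := by
  rcases lt_or_gt_of_ne (S.a_ne (bijective_shift_zero hC) i) with ha | ha
  · obtain ⟨u, hu, hu0, h⟩ := exists_smooth_solution hφ (S.a i) T
    refine ⟨_, opD_smulSmooth_const hT (S.eigen i) hu h,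
      P1.smulSmooth hu (P1.const hT (S.v i)), Prod.ext rfl (Prod.ext ?_ ?_)⟩
    · change P.projPlus C (P1.eval hT (-T) (neg_mem_Icc hT) _) = 0
      rw [P1.eval_smulSmooth, P1.eval_const, map_smul, S.projPlus_v hC ha, smul_zero]
    · change P.projMinus C (P1.eval hT T (self_mem_Icc hT) _) = 0
      rw [P1.eval_smulSmooth, hu0, zero_smul, map_zero]
  · obtain ⟨u, hu, hu0, h⟩ := exists_smooth_solution hφ (S.a i) (-T)
    refine ⟨_, opD_smulSmooth_const hT (S.eigen i) hu h,
      P1.smulSmooth hu (P1.const hT (S.v i)), Prod.ext rfl (Prod.ext ?_ ?_)⟩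
    · change P.projPlus C (P1.eval hT (-T) (neg_mem_Icc hT) _) = 0
      rw [P1.eval_smulSmooth, hu0, zero_smul, map_zero]
    · change P.projMinus C (P1.eval hT T (self_mem_Icc hT) _) = 0
      rw [P1.eval_smulSmooth, P1.eval_const, map_smul, S.projMinus_v hC ha, smul_zero]

/-- For a positive eigenvalue the exponential solution starting at `v i` at time `-T` has the
required data, and π₋ does not see it at `T`. For a negative eigenvalue the claimed vector is zero.
-/
theorem mem_range_augOp_plus (hT : 0 < T) (i : S.idx) :
    ((0 : P.P0 T), P.projPlus C (P.toHalf (S.v i)), (0 : P.halfMinus C)) ∈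
      (P.augOp hT (continuousOn_const (c := C)) C C).range := by
  rcases lt_or_gt_of_ne (S.a_ne (bijective_shift_zero hC) i) with ha | ha
  · rw [S.projPlus_v hC ha]
    exact zero_mem _
  · obtain ⟨u, hu, hu0, h⟩ := exists_smooth_homogeneous (S.a i) (-T)
    refine ⟨P1.smulSmooth hu (P1.const hT (S.v i)), Prod.ext ?_ (Prod.ext ?_ ?_)⟩
    · refine Lp.ext ?_
      filter_upwards [opD_smulSmooth_const hT (S.eigen i) hu h,
        Lp.coeFn_zero H₀ 2 (volume.restrict (Icc (-T) T))] with s h1 h2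
      rw [h2]
      exact h1.trans (zero_smul _ _)
    · change P.projPlus C (P1.eval hT (-T) (neg_mem_Icc hT) _) = _
      rw [P1.eval_smulSmooth, hu0, one_smul, P1.eval_const]
    · change P.projMinus C (P1.eval hT T (self_mem_Icc hT) _) = 0
      rw [P1.eval_smulSmooth, P1.eval_const, map_smul, S.projMinus_v hC ha, smul_zero]

theorem mem_range_augOp_minus (hT : 0 < T) (i : S.idx) :
    ((0 : P.P0 T), (0 : P.halfPlus C), P.projMinus C (P.toHalf (S.v i))) ∈
      (P.augOp hT (continuousOn_const (c := C)) C C).range := by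
  rcases lt_or_gt_of_ne (S.a_ne (bijective_shift_zero hC) i) with ha | ha
  · obtain ⟨u, hu, hu0, h⟩ := exists_smooth_homogeneous (S.a i) T
    refine ⟨P1.smulSmooth hu (P1.const hT (S.v i)), Prod.ext ?_ (Prod.ext ?_ ?_)⟩
    · refine Lp.ext ?_
      filter_upwards [opD_smulSmooth_const hT (S.eigen i) hu h,
        Lp.coeFn_zero H₀ 2 (volume.restrict (Icc (-T) T))] with s h1 h2
      rw [h2]
      exact h1.trans (zero_smul _ _)
    · change P.projPlus C (P1.eval hT (-T) (neg_mem_Icc hT) _) = 0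
      rw [P1.eval_smulSmooth, P1.eval_const, map_smul, S.projPlus_v hC ha, smul_zero]
    · change P.projMinus C (P1.eval hT T (self_mem_Icc hT) _) = _
      rw [P1.eval_smulSmooth, hu0, one_smul, P1.eval_const]
  · rw [S.projMinus_v hC ha]
    exact zero_mem _

theorem eq_top_of_toHalf_v_mem {U : Submodule ℝ P.Half} (hU : IsClosed (U : Set P.Half))
    (h : ∀ i, P.toHalf (S.v i) ∈ U) : U = ⊤ := by
  rw [eq_top_iff, ← S.half_dense_span (bijective_shift_zero hC)]
  refine Submodule.topologicalClosure_minimal _ (Submodule.span_le.2 ?_) hU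
  rintro _ ⟨i, rfl⟩
  exact h i

omit hC in
-- Let `g` be orthogonal to `U`. Testing with `φ • ι (v i)` for all smooth `φ` shows that `g s` is
-- orthogonal to `ι (v i)` for almost every `s`, and the `ι (v i)` span a dense subspace of H₀.
theorem eq_top_of_path_mem {U : Submodule ℝ (P.P0 T)} (hU : IsClosed (U : Set (P.P0 T)))
    (h : ∀ (i : S.idx) (φ : ℝ → ℝ), ContDiff ℝ ∞ φ → ∃ f ∈ U,
      f =ᵐ[volume.restrict (Icc (-T) T)] fun s => φ s • P.incl (S.v i)) : U = ⊤ := by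
  have hUc : CompleteSpace U := hU.completeSpace_coe
  rw [← Submodule.orthogonal_eq_bot_iff, eq_bot_iff]
  intro g hg
  have h1 : ∀ i, ∀ᵐ s, s ∈ Ioo (-T) T → inner ℝ (P.incl (S.v i)) (g s) = 0 := by
    intro i
    have hint : IntegrableOn (fun s => inner ℝ (P.incl (S.v i)) (g s)) (Icc (-T) T) :=
      (innerSL ℝ (P.incl (S.v i))).integrable_comp (integrableOn_Lp g)
    refine isOpen_Ioo.ae_eq_zero_of_integral_contDiff_smul_eq_zero
      (hint.mono_set Ioo_subset_Icc_self).locallyIntegrableOn fun φ hφ _ hφs => ?_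
    obtain ⟨f, hfU, hf⟩ := h i φ hφ
    have h2 := Submodule.mem_orthogonal _ _ |>.1 hg f hfU
    rw [L2.inner_def] at h2
    rw [← h2, ← setIntegral_eq_integral_of_forall_compl_eq_zero (s := Icc (-T) T)]
    · refine integral_congr_ae ?_
      filter_upwards [hf] with s hs
      rw [hs, real_inner_smul_left, smul_eq_mul]
    · intro s hs
      rw [image_eq_zero_of_notMem_tsupport fun h' => hs (Ioo_subset_Icc_self (hφs h')), zero_smul]
  rw [Submodule.mem_bot]
  refine Lp.ext ?_
  -- One null set for all modes at once, as there are countably many.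
  have h2 : ∀ᵐ s ∂volume.restrict (Icc (-T) T), ∀ i, inner ℝ (P.incl (S.v i)) (g s) = 0 := by
    filter_upwards [ae_restrict_of_ae (ae_all_iff.2 h1), ae_restrict_mem measurableSet_Icc,
      Measure.ae_ne _ (-T), Measure.ae_ne _ T] with s hs hsI hs1 hs2 i
    exact hs i ⟨lt_of_le_of_ne hsI.1 hs1.symm, lt_of_le_of_ne hsI.2 hs2⟩
  filter_upwards [h2, Lp.coeFn_zero H₀ 2 (volume.restrict (Icc (-T) T))] with s hs h0
  rw [h0, Pi.zero_apply]
  have h3 : (Submodule.span ℝ (range fun i => P.incl (S.v i))).topologicalClosure ≤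
      (ℝ ∙ g s)ᗮ := by
    refine Submodule.topologicalClosure_minimal _ (Submodule.span_le.2 ?_)
      (Submodule.isClosed_orthogonal _)
    rintro _ ⟨i, rfl⟩
    rw [SetLike.mem_coe, Submodule.mem_orthogonal_singleton_iff_inner_left]
    exact hs i
  rw [S.dense_span] at h3
  have h4 := Submodule.mem_orthogonal_singleton_iff_inner_left.1 (h3 (Submodule.mem_top (x := g s)))
  exact inner_self_eq_zero.1 h4

end Model

end EigenSystem

theorem projPlus_surjective {C : H₁ →L[ℝ] H₀}
    (h : Submodule.IsTopCompl (P.halfPlus C) (P.halfMinus C)) :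
    Function.Surjective (P.projPlus C) := fun x =>
  ⟨x, Subtype.ext (projPlus_of_mem_plus h x.2)⟩

theorem projMinus_surjective {C : H₁ →L[ℝ] H₀}
    (h : Submodule.IsTopCompl (P.halfPlus C) (P.halfMinus C)) :
    Function.Surjective (P.projMinus C) := fun x =>
  ⟨x, Subtype.ext (projMinus_of_mem_minus h x.2)⟩

/-- The augmented operator of a constant path of invertible symmetrizable operators is a
topological isomorphism. -/
theorem exists_augOp_const_equiv (hT : 0 < T) {C : H₁ →L[ℝ] H₀} (hs : P.IsSymmetrizable C)
    (hC : Function.Bijective C) : ∃ Φ : P.P1 T ≃L[ℝ] P.P0 T × P.halfPlus C × P.halfMinus C,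
      (Φ : P.P1 T →L[ℝ] _) = P.augOp hT (continuousOn_const (c := C)) C C := by
  obtain ⟨S⟩ := exists_eigenSystem hs (r := 0) (by rwa [shift_zero])
  obtain ⟨K, hK⟩ := S.exists_antilipschitz hC hT
  have hc := P1.completeSpace (P := P) hT
  set D := P.augOp hT (continuousOn_const (c := C)) C C with hD
  -- The a priori estimate and completeness of P₁ make the range closed, so it is enough to reach a
  -- dense set in each of the three factors.
  have hcl : IsClosed (D.range : Set (P.P0 T × P.halfPlus C × P.halfMinus C)) := by
    rw [LinearMap.coe_range]
    exact hK.isClosed_range D.uniformContinuous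
  have hcompl := S.isTopCompl_zero hC
  let j₀ : P.P0 T →L[ℝ] P.P0 T × P.halfPlus C × P.halfMinus C := .inl ℝ _ _
  -- The boundary factors are parametrized by all of H_{1/2} through the projections, so that
  -- density can be tested on the eigenvectors in H_{1/2}.
  let j₁ : P.Half →L[ℝ] P.P0 T × P.halfPlus C × P.halfMinus C :=
    .inr ℝ _ _ ∘L .inl ℝ _ _ ∘L P.projPlus C
  let j₂ : P.Half →L[ℝ] P.P0 T × P.halfPlus C × P.halfMinus C :=
    .inr ℝ _ _ ∘L .inr ℝ _ _ ∘L P.projMinus C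
  have h0 : D.range.comap j₀.toLinearMap = ⊤ :=
    S.eq_top_of_path_mem (hcl.preimage j₀.continuous) fun i φ hφ => by
      obtain ⟨f, hf, hfr⟩ := S.mem_range_augOp_path hC hT i hφ
      exact ⟨f, hfr, hf⟩
  have h1 : D.range.comap j₁.toLinearMap = ⊤ :=
    S.eq_top_of_toHalf_v_mem hC (hcl.preimage j₁.continuous) fun i =>
      S.mem_range_augOp_plus hC hT i
  have h2 : D.range.comap j₂.toLinearMap = ⊤ :=
    S.eq_top_of_toHalf_v_mem hC (hcl.preimage j₂.continuous) fun i =>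
      S.mem_range_augOp_minus hC hT i
  have hsurj : Function.Surjective D := by
    rintro ⟨f, x, y⟩
    obtain ⟨x, rfl⟩ := projPlus_surjective hcompl x
    obtain ⟨y, rfl⟩ := projMinus_surjective hcompl y
    have h3 : j₀ f ∈ D.range := h0.ge (Submodule.mem_top (x := f))
    have h4 : j₁ x ∈ D.range := h1.ge (Submodule.mem_top (x := x))
    have h5 : j₂ y ∈ D.range := h2.ge (Submodule.mem_top (x := y))
    have h6 : (f, P.projPlus C x, P.projMinus C y) = j₀ f + j₁ x + j₂ y := by
      simp [j₀, j₁, j₂]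
    rw [h6]
    exact add_mem (add_mem h3 h4) h5
  let e := LinearEquiv.ofBijective D.toLinearMap ⟨hK.injective, hsurj⟩
  refine ⟨⟨e, D.continuous, ?_⟩, rfl⟩
  exact (hK.to_rightInverse e.right_inv).continuous

end HilbertPair
end
-- Perturbation of the model and invertible local models
noncomputable section

theorem exists_smooth_partition {n : Type*} [Fintype n] {s : Set ℝ} (hs : IsClosed s)
    {U : n → Set ℝ} (hU : ∀ i, IsOpen (U i)) (hsub : s ⊆ ⋃ i, U i) :
    ∃ χ : n → ℝ → ℝ, (∀ i, ContDiff ℝ ∞ (χ i)) ∧ (∀ i t, χ i t ≠ 0 → t ∈ U i) ∧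
      ∀ t ∈ s, ∑ i, χ i t = 1 := by
  obtain ⟨f, hf⟩ := SmoothPartitionOfUnity.exists_isSubordinate (modelWithCornersSelf ℝ ℝ) hs U hU hsub
  refine ⟨fun i => f i, fun i => (f i).contMDiff.contDiff, fun i t ht =>
    hf i (subset_tsupport _ ht), fun t ht => ?_⟩
  rw [← finsum_eq_sum_of_fintype]
  exact f.sum_eq_one ht

theorem exists_equiv_of_near {E F : Type*} [NormedAddCommGroup E] [NormedSpace ℝ E]
    [NormedAddCommGroup F] [NormedSpace ℝ F] [CompleteSpace E] (e : E ≃L[ℝ] F) :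
    ∃ ε : ℝ, 0 < ε ∧ ∀ L : E →L[ℝ] F, ‖L - e‖ ≤ ε → ∃ e' : E ≃L[ℝ] F, (e' : E →L[ℝ] F) = L := by
  obtain ⟨ε, hε, hball⟩ := Metric.mem_nhds_iff.1 (ContinuousLinearEquiv.nhds e)
  refine ⟨ε / 2, half_pos hε, fun L h => hball ?_⟩
  rw [Metric.mem_ball, dist_eq_norm]
  exact h.trans_lt (half_lt_self hε)

namespace HilbertPair

variable {H₀ H₁ : Type*} [NormedAddCommGroup H₀] [InnerProductSpace ℝ H₀] [CompleteSpace H₀]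
  [NormedAddCommGroup H₁] [InnerProductSpace ℝ H₁] [CompleteSpace H₁] {P : HilbertPair H₀ H₁}
  {T : ℝ}

theorem opD_apply {A : ℝ → H₁ →L[ℝ] H₀} (hA : ContinuousOn A (Icc (-T) T)) (ξ : P.P1 T) :
    P.opD hA ξ = P1.der ξ + mulOp hA (P1.val ξ) := rfl

theorem augOp_apply (hT : 0 < T) {A : ℝ → H₁ →L[ℝ] H₀} (hA : ContinuousOn A (Icc (-T) T))
    (Cl Cr : H₁ →L[ℝ] H₀) (ξ : P.P1 T) : P.augOp hT hA Cl Cr ξ =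
      (P.opD hA ξ, P.projPlus Cl (P1.eval hT (-T) (neg_mem_Icc hT) ξ),
        P.projMinus Cr (P1.eval hT T (self_mem_Icc hT) ξ)) := rfl

/-- With the boundary projections fixed, only the term of multiplication by the path differs. -/
theorem norm_augOp_sub_le (hT : 0 < T) {A B : ℝ → H₁ →L[ℝ] H₀} (hA : ContinuousOn A (Icc (-T) T))
    (hB : ContinuousOn B (Icc (-T) T)) (Cl Cr : H₁ →L[ℝ] H₀) {δ : ℝ} (hδ : 0 ≤ δ)
    (h : ∀ s ∈ Icc (-T) T, ‖A s - B s‖ ≤ δ) :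
    ‖P.augOp hT hA Cl Cr - P.augOp hT hB Cl Cr‖ ≤ δ := by
  refine ContinuousLinearMap.opNorm_le_bound _ hδ fun ξ => ?_
  have h1 : (P.augOp hT hA Cl Cr - P.augOp hT hB Cl Cr) ξ =
      (mulOp hA (P1.val ξ) - mulOp hB (P1.val ξ), 0, 0) := by
    rw [_root_.sub_apply, augOp_apply, augOp_apply, Prod.mk_sub_mk, Prod.mk_sub_mk, sub_self,
      sub_self, opD_apply, opD_apply, add_sub_add_left_eq_sub]
  have h2 : ‖mulOp hA (P1.val ξ) - mulOp hB (P1.val ξ)‖ ≤ δ * ‖P1.val ξ‖ := by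
    refine Lp.norm_le_mul_norm_of_ae_le_mul ?_
    filter_upwards [Lp.coeFn_sub (mulOp hA (P1.val ξ)) (mulOp hB (P1.val ξ)),
      coeFn_mulOp hA (P1.val ξ), coeFn_mulOp hB (P1.val ξ), ae_restrict_mem measurableSet_Icc]
      with s h2 h3 h4 hs
    rw [h2, Pi.sub_apply, h3, h4]
    exact (A s - B s).le_of_opNorm_le (h s hs) _
  rw [h1, Prod.norm_def, Prod.norm_def, norm_zero, norm_zero, max_self, max_eq_left (norm_nonneg _)]
  exact h2.trans (mul_le_mul_of_nonneg_left (P1.norm_val_le ξ) hδ)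

/-- The augmented operator is a topological isomorphism for paths near a constant path of
invertible symmetrizable operators. -/
theorem exists_augOp_equiv_of_near (hT : 0 < T) {C : H₁ →L[ℝ] H₀} (hs : P.IsSymmetrizable C)
    (hC : Function.Bijective C) : ∃ ε : ℝ, 0 < ε ∧ ∀ (B : ℝ → H₁ →L[ℝ] H₀)
      (hB : ContinuousOn B (Icc (-T) T)), (∀ s ∈ Icc (-T) T, ‖B s - C‖ ≤ ε) →
      ∃ Φ : P.P1 T ≃L[ℝ] P.P0 T × P.halfPlus C × P.halfMinus C,
        (Φ : P.P1 T →L[ℝ] _) = P.augOp hT hB C C := by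
  obtain ⟨Φ, hΦ⟩ := exists_augOp_const_equiv hT hs hC
  have hc := P1.completeSpace (P := P) hT
  obtain ⟨ε, hε, hnear⟩ := exists_equiv_of_near Φ
  refine ⟨ε, hε, fun B hB h => hnear _ ?_⟩
  rw [hΦ]
  exact norm_augOp_sub_le hT hB continuousOn_const C C hε.le h

/-- The path is frozen outside a small interval around `s₀`. By continuity the modified path stays
close to `C` at all times, so its augmented operator is an isomorphism, while nothing changes near
`s₀` except the term `K ι`. -/
theorem exists_local_model (hT : 0 < T) {A : ℝ → H₁ →L[ℝ] H₀} (hA : ContinuousOn A (Icc (-T) T))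
    {s₀ : ℝ} (hs₀ : s₀ ∈ Icc (-T) T) {K : H₀ →L[ℝ] H₀} {C : H₁ →L[ℝ] H₀}
    (hCK : C = A s₀ + K ∘L P.incl) (hs : P.IsSymmetrizable C) (hC : Function.Bijective C) :
    ∃ δ : ℝ, 0 < δ ∧ ∃ (B : ℝ → H₁ →L[ℝ] H₀) (hB : ContinuousOn B (Icc (-T) T)),
      (∀ s ∈ Icc (-T) T, |s - s₀| ≤ δ → B s = A s + K ∘L P.incl) ∧
      ∃ Φ : P.P1 T ≃L[ℝ] P.P0 T × P.halfPlus C × P.halfMinus C,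
        (Φ : P.P1 T →L[ℝ] _) = P.augOp hT hB C C := by
  obtain ⟨ε, hε, h⟩ := exists_augOp_equiv_of_near hT hs hC
  obtain ⟨δ, hδ, hAδ⟩ := Metric.continuousOn_iff.1 hA s₀ hs₀ ε hε
  have hδ2 := half_pos hδ
  -- Time clamped to the interval of radius `δ / 2` about `s₀`; it stays in `[-T, T]` because `s₀`
  -- lies there. Half of `δ` makes the later distance bound strict.
  let cl : ℝ → ℝ := fun s => max (s₀ - δ / 2) (min s (s₀ + δ / 2))
  have hcl : ∀ s ∈ Icc (-T) T, cl s ∈ Icc (-T) T := fun s hs =>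
    ⟨le_max_of_le_right (le_min hs.1 (by linarith [hs₀.1])),
      max_le (by linarith [hs₀.2]) ((min_le_left _ _).trans hs.2)⟩
  have hclc : Continuous cl := continuous_const.max (continuous_id.min continuous_const)
  have hB : ContinuousOn (fun s => A (cl s) + K ∘L P.incl) (Icc (-T) T) :=
    (hA.comp hclc.continuousOn hcl).add continuousOn_const
  refine ⟨δ / 2, hδ2, fun s => A (cl s) + K ∘L P.incl, hB, fun s _ hsδ => ?_,
    h _ hB fun s hs => ?_⟩
  · rw [abs_le] at hsδ
    have : cl s = s := by
      simp only [cl]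
      rw [min_eq_left (by linarith), max_eq_right (by linarith)]
    simp only [this]
  · rw [hCK, add_sub_add_right_eq_sub, ← dist_eq_norm]
    refine (hAδ _ (hcl s hs) ?_).le
    rw [Real.dist_eq]
    have h1 : cl s ≤ s₀ + δ / 2 := max_le (by linarith) (min_le_right _ _)
    have h2 : s₀ - δ / 2 ≤ cl s := le_max_left _ _
    rw [abs_lt]
    constructor <;> linarith

/-- A Hessian becomes invertible after adding a suitable operator of finite rank. -/
theorem IsHessian.exists_perturbation {A : H₁ →L[ℝ] H₀} (hA : P.IsHessian A) :
    ∃ K : H₀ →L[ℝ] H₀, P.IsSymmetrizable (A + K ∘L P.incl) ∧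
      Function.Bijective (A + K ∘L P.incl) := by
  obtain ⟨⟨B, hs, ⟨c, hc, hBc⟩, hB⟩, hF, hind⟩ := hA
  obtain ⟨E, _, _, _, e, he⟩ := exists_hilbertSpace_of_equivalent B hs hc hBc
  have hkfin : FiniteDimensional ℝ (LinearMap.ker A.toLinearMap) := hF.finite_ker
  have hcfin : FiniteDimensional ℝ (H₀ ⧸ LinearMap.range A.toLinearMap) := hF.finite_coker
  let N : Submodule ℝ H₀ := (LinearMap.ker A.toLinearMap).map P.incl.toLinearMap
  let V : Submodule ℝ E := N.map (e : H₀ →L[ℝ] E).toLinearMap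
  have hNfin : FiniteDimensional ℝ N := inferInstance
  have hVfin : FiniteDimensional ℝ V := inferInstance
  -- The `B`-orthogonal projection onto the image `N` of the kernel of `A` in H₀. Being
  -- `B`-symmetric, it keeps the sum symmetrizable by the same `B`.
  let K : H₀ →L[ℝ] H₀ := (e.symm : E →L[ℝ] H₀) ∘L V.starProjection ∘L (e : H₀ →L[ℝ] E)
  have heK : ∀ x, e (K x) = V.starProjection (e x) := fun x => by simp [K]
  have hKN : ∀ x, K x ∈ N := fun x => by
    obtain ⟨y, hy, hxy⟩ := Submodule.starProjection_apply_mem V (e x)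
    have : K x = y := e.injective (by rw [heK]; exact hxy.symm)
    rwa [this]
  have hKid : ∀ x ∈ N, K x = x := fun x hx => e.injective (by
    rw [heK]
    exact Submodule.starProjection_eq_self_iff.2 ⟨x, hx, rfl⟩)
  -- By symmetry the range of `A` is `B`-orthogonal to `N`, so the two meet only in zero.
  have hAN : ∀ x, ∀ y ∈ N, B (A x) y = 0 := by
    rintro x _ ⟨y, hy, rfl⟩
    have hy0 : A y = 0 := hy
    change B (A x) (P.incl y) = 0
    rw [hB, hy0, map_zero]
  have hdisj : ∀ x ∈ LinearMap.range A.toLinearMap, x ∈ N → x = 0 := by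
    rintro _ ⟨x, rfl⟩ hx
    have h1 := hAN x _ hx
    change B (A x) (A x) = 0 at h1
    rw [← he, inner_self_eq_zero, map_eq_zero_iff _ e.injective] at h1
    exact h1
  refine ⟨K, ⟨B, hs, ⟨c, hc, hBc⟩, fun x y => ?_⟩, (injective_iff_map_eq_zero _).2 fun x hx => ?_,
    fun y => ?_⟩
  · simp only [_root_.add_apply, ContinuousLinearMap.comp_apply, map_add, LinearMap.add_apply, hB]
    congr 1
    rw [← he, ← he, heK, heK, Submodule.inner_starProjection_left_eq_right]
  · have hx' : A x + K (P.incl x) = 0 := hx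
    have h1 : A x = -K (P.incl x) := eq_neg_of_add_eq_zero_left hx'
    have h2 : A x = 0 := hdisj _ ⟨x, rfl⟩ (by
      rw [h1]; exact neg_mem (hKN _))
    rw [h2, zero_add] at hx'
    have h3 : K (P.incl x) = P.incl x := hKid _ ⟨x, h2, rfl⟩
    rw [h3] at hx'
    exact P.incl_injective (hx'.trans (map_zero P.incl).symm)
  -- `N` injects into the cokernel of `A`, and index zero says that the dimensions agree. Hence `N`
  -- is a complement of the range of `A`.
  · let q : N →ₗ[ℝ] H₀ ⧸ LinearMap.range A.toLinearMap :=
      (LinearMap.range A.toLinearMap).mkQ ∘ₗ N.subtype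
    have hq : Function.Injective q := (injective_iff_map_eq_zero _).2 fun x hx =>
      Subtype.ext (hdisj _ ((Submodule.Quotient.mk_eq_zero _).1 hx) x.2)
    have hdim : Module.finrank ℝ N = Module.finrank ℝ (H₀ ⧸ LinearMap.range A.toLinearMap) := by
      have h1 : Module.finrank ℝ N = Module.finrank ℝ (LinearMap.ker A.toLinearMap) :=
        (Submodule.equivMapOfInjective P.incl.toLinearMap P.incl_injective
          (LinearMap.ker A.toLinearMap)).finrank_eq.symm
      rw [fredholmIndex] at hind
      omega
    obtain ⟨n, hn⟩ := (LinearMap.injective_iff_surjective_of_finrank_eq_finrank hdim).1 hq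
      (Submodule.Quotient.mk y)
    have hn' : (Submodule.Quotient.mk (n : H₀) : H₀ ⧸ LinearMap.range A.toLinearMap) =
        Submodule.Quotient.mk y := hn
    rw [Submodule.Quotient.eq] at hn'
    obtain ⟨x, hx⟩ := hn'
    have hx' : A x = n - y := hx
    obtain ⟨z, hz, hzn⟩ : (n : H₀) + K (P.incl x) ∈ N := add_mem n.2 (hKN _)
    have hz0 : A z = 0 := hz
    have hzn' : P.incl z = n + K (P.incl x) := hzn
    -- Here `A x = n - y`, so `-x` produces `y - n` together with an unwanted term `-K ι x`. The
    -- kernel vector `z` with `ι z = n + K ι x` repairs both, as `K` is the identity on `N`.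
    refine ⟨z - x, ?_⟩
    change A (z - x) + K (P.incl (z - x)) = y
    rw [map_sub, map_sub, map_sub, hz0, hx', hzn', map_add, hKid _ n.2, hKid _ (hKN _)]
    abel

end HilbertPair
end
noncomputable section

theorem mk_add_inl {E F : Type*} [NormedAddCommGroup E] [NormedSpace ℝ E] [NormedAddCommGroup F]
    [NormedSpace ℝ F] (f g : E) (x : F) :
    (f, x) + ContinuousLinearMap.inl ℝ E F g = (f + g, x) := by
  rw [ContinuousLinearMap.inl_apply, Prod.mk_add_mk, add_zero]

namespace HilbertPair

variable {H₀ H₁ : Type*} [NormedAddCommGroup H₀] [InnerProductSpace ℝ H₀] [CompleteSpace H₀]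
  [NormedAddCommGroup H₁] [InnerProductSpace ℝ H₁] [CompleteSpace H₁] {P : HilbertPair H₀ H₁}
  {T : ℝ}

/-! ### The Fredholm property of the augmented operators -/

/-- The operator of order zero which arises when a solution operator for one path is used for
another path and cut off by `χ`. -/
def cutoffError {χ : ℝ → ℝ} (hχ : ContDiff ℝ ∞ χ) (K : H₀ →L[ℝ] H₀) : P.P1 T →L[ℝ] P.P0 T :=
  (smulOp (hχ.continuous_deriv (by simp)) + smulOp hχ.continuous ∘L K.compLpL 2 _) ∘L inclP

theorem isFiniteRankLimit_cutoffError (hT : 0 < T) {χ : ℝ → ℝ} (hχ : ContDiff ℝ ∞ χ)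
    (K : H₀ →L[ℝ] H₀) : IsFiniteRankLimit (cutoffError hχ K : P.P1 T →L[ℝ] P.P0 T) :=
  (isFiniteRankLimit_inclP hT).clm_comp _

/-- Where `χ` does not vanish the two paths differ by `K ι`, a term of order zero; differentiating
the cut-off adds another such term. -/
theorem opD_cutoff {A B : ℝ → H₁ →L[ℝ] H₀} (hA : ContinuousOn A (Icc (-T) T))
    (hB : ContinuousOn B (Icc (-T) T)) {χ : ℝ → ℝ} (hχ : ContDiff ℝ ∞ χ) {K : H₀ →L[ℝ] H₀}
    (h : ∀ s ∈ Icc (-T) T, χ s ≠ 0 → B s = A s + K ∘L P.incl) (ξ : P.P1 T) :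
    P.opD hB (P1.smulSmooth hχ ξ) = smulOp hχ.continuous (P.opD hA ξ) + cutoffError hχ K ξ := by
  have h0 : smulOp hχ.continuous (P.opD hB ξ) = smulOp hχ.continuous (P.opD hA ξ) +
      smulOp hχ.continuous (K.compLpL 2 _ (inclP ξ)) := by
    refine Lp.ext ?_
    filter_upwards [Lp.coeFn_add (smulOp hχ.continuous (P.opD hA ξ))
        (smulOp hχ.continuous (K.compLpL 2 _ (inclP ξ))),
      coeFn_smulOp hχ.continuous (P.opD hB ξ), coeFn_smulOp hχ.continuous (P.opD hA ξ),
      coeFn_smulOp hχ.continuous (K.compLpL 2 _ (inclP ξ)), coeFn_opD hA ξ, coeFn_opD hB ξ,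
      K.coeFn_compLpL (inclP ξ), coeFn_inclP ξ, ae_restrict_mem measurableSet_Icc]
      with s h1 h2 h3 h4 h5 h6 h7 h8 hs
    rw [h1, Pi.add_apply, h2, h3, h4, h5, h6, h7, h8]
    by_cases hz : χ s = 0
    · simp [hz]
    · rw [h s hs hz, _root_.add_apply, ContinuousLinearMap.comp_apply, ← smul_add, add_assoc]
  rw [opD_smulSmooth, h0, add_left_comm]
  rfl

/-- In the application `c` is the value of a cut-off function at an end point: either it vanishes
there, or the local model has the prescribed spectral projection. The three lemmas below use the
same alternative. -/
theorem smul_projPlus_projPlus {C Cl : H₁ →L[ℝ] H₀}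
    (hl : Submodule.IsTopCompl (P.halfPlus Cl) (P.halfMinus Cl)) {c : ℝ} (h : c ≠ 0 → C = Cl)
    (z : P.Half) : c • P.projPlus C (P.projPlus Cl z : P.Half) = c • P.projPlus C z := by
  by_cases hc : c = 0
  · rw [hc, zero_smul, zero_smul]
  · obtain rfl := h hc
    rw [Subtype.ext (projPlus_of_mem_plus hl (P.projPlus C z).2)]

theorem smul_projMinus_projMinus {C Cr : H₁ →L[ℝ] H₀}
    (hr : Submodule.IsTopCompl (P.halfPlus Cr) (P.halfMinus Cr)) {c : ℝ} (h : c ≠ 0 → C = Cr)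
    (z : P.Half) : c • P.projMinus C (P.projMinus Cr z : P.Half) = c • P.projMinus C z := by
  by_cases hc : c = 0
  · rw [hc, zero_smul, zero_smul]
  · obtain rfl := h hc
    rw [Subtype.ext (projMinus_of_mem_minus hr (P.projMinus C z).2)]

theorem smul_projPlus_of_eq {C Cl : H₁ →L[ℝ] H₀}
    (hl : Submodule.IsTopCompl (P.halfPlus Cl) (P.halfMinus Cl)) {c : ℝ} (h : c ≠ 0 → C = Cl)
    {z : P.Half} {x : P.halfPlus Cl} (hz : P.projPlus C z = P.projPlus C x) :
    c • P.projPlus Cl z = c • x := by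
  by_cases hc : c = 0
  · rw [hc, zero_smul, zero_smul]
  · obtain rfl := h hc
    rw [hz, Subtype.ext (projPlus_of_mem_plus hl x.2)]

theorem smul_projMinus_of_eq {C Cr : H₁ →L[ℝ] H₀}
    (hr : Submodule.IsTopCompl (P.halfPlus Cr) (P.halfMinus Cr)) {c : ℝ} (h : c ≠ 0 → C = Cr)
    {z : P.Half} {x : P.halfMinus Cr} (hz : P.projMinus C z = P.projMinus C x) :
    c • P.projMinus Cr z = c • x := by
  by_cases hc : c = 0
  · rw [hc, zero_smul, zero_smul]
  · obtain rfl := h hc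
    rw [hz, Subtype.ext (projMinus_of_mem_minus hr x.2)]

variable (P) in
/-- An invertible operator which agrees with a given one over `U`, up to terms of order zero. -/
structure LocalModel (hT : 0 < T) (A : ℝ → H₁ →L[ℝ] H₀) (U : Set ℝ) where
  C : H₁ →L[ℝ] H₀
  K : H₀ →L[ℝ] H₀
  B : ℝ → H₁ →L[ℝ] H₀
  continuousOn : ContinuousOn B (Icc (-T) T)
  eqOn : ∀ s ∈ Icc (-T) T, s ∈ U → B s = A s + K ∘L P.incl
  equiv : P.P1 T ≃L[ℝ] P.P0 T × P.halfPlus C × P.halfMinus C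
  coe_equiv : (equiv : P.P1 T →L[ℝ] _) = P.augOp hT continuousOn C C

namespace LocalModel

variable {hT : 0 < T} {A : ℝ → H₁ →L[ℝ] H₀} {U : Set ℝ} (M : P.LocalModel hT A U)

theorem equiv_apply (ξ : P.P1 T) : M.equiv ξ = (P.opD M.continuousOn ξ,
    P.projPlus M.C (P1.eval hT (-T) (neg_mem_Icc hT) ξ),
    P.projMinus M.C (P1.eval hT T (self_mem_Icc hT) ξ)) := by
  rw [← augOp_apply]
  exact DFunLike.congr_fun M.coe_equiv ξ

/-- Transfer of data for the boundary projections of `Cl` and `Cr` to data for the model. -/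
def transfer (Cl Cr : H₁ →L[ℝ] H₀) :
    P.P0 T × P.halfPlus Cl × P.halfMinus Cr →L[ℝ] P.P0 T × P.halfPlus M.C × P.halfMinus M.C :=
  (ContinuousLinearMap.id ℝ (P.P0 T)).prodMap
    ((P.projPlus M.C ∘L (P.halfPlus Cl).subtypeL).prodMap
      (P.projMinus M.C ∘L (P.halfMinus Cr).subtypeL))

theorem transfer_apply (Cl Cr : H₁ →L[ℝ] H₀) (g : P.P0 T × P.halfPlus Cl × P.halfMinus Cr) :
    M.transfer Cl Cr g = (g.1, P.projPlus M.C g.2.1, P.projMinus M.C g.2.2) := rfl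

/-- Multiplication of boundary value problem data by a cut-off function. -/
def cutoffData {χ : ℝ → ℝ} (hχ : ContDiff ℝ ∞ χ) (Cl Cr : H₁ →L[ℝ] H₀) :
    P.P0 T × P.halfPlus Cl × P.halfMinus Cr →L[ℝ] P.P0 T × P.halfPlus Cl × P.halfMinus Cr :=
  (smulOp hχ.continuous).prodMap ((χ (-T) • ContinuousLinearMap.id ℝ _).prodMap
    (χ T • ContinuousLinearMap.id ℝ _))

theorem cutoffData_apply {χ : ℝ → ℝ} (hχ : ContDiff ℝ ∞ χ) (Cl Cr : H₁ →L[ℝ] H₀)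
    (g : P.P0 T × P.halfPlus Cl × P.halfMinus Cr) :
    cutoffData hχ Cl Cr g = (smulOp hχ.continuous g.1, χ (-T) • g.2.1, χ T • g.2.2) := rfl

variable (hA : ContinuousOn A (Icc (-T) T)) {Cl Cr : H₁ →L[ℝ] H₀}
  (hl : Submodule.IsTopCompl (P.halfPlus Cl) (P.halfMinus Cl))
  (hr : Submodule.IsTopCompl (P.halfPlus Cr) (P.halfMinus Cr))
  {χ : ℝ → ℝ} (hχ : ContDiff ℝ ∞ χ) (hχU : ∀ t, χ t ≠ 0 → t ∈ U)
  (hCl : -T ∈ U → M.C = Cl) (hCr : T ∈ U → M.C = Cr)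
include hl hr hχU hCl hCr

/-- The identity behind the left parametrix: up to order zero, the model operator on the cut-off
path sees only the cut-off data of the given operator. -/
theorem equiv_smulSmooth (ξ : P.P1 T) : M.equiv (P1.smulSmooth hχ ξ) =
    M.transfer Cl Cr (cutoffData hχ Cl Cr (P.augOp hT hA Cl Cr ξ)) +
      ContinuousLinearMap.inl ℝ _ _ (cutoffError hχ M.K ξ) := by
  have h1 := opD_cutoff hA M.continuousOn hχ (fun s hs hz => M.eqOn s hs (hχU s hz)) ξ
  have h2 : P.projPlus M.C (P1.eval hT (-T) (neg_mem_Icc hT) (P1.smulSmooth hχ ξ)) =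
      P.projPlus M.C (χ (-T) • P.projPlus Cl (P1.eval hT (-T) (neg_mem_Icc hT) ξ) : P.halfPlus Cl) := by
    rw [P1.eval_smulSmooth, Submodule.coe_smul, map_smul, map_smul,
      smul_projPlus_projPlus hl fun h => hCl (hχU _ h)]
  have h3 : P.projMinus M.C (P1.eval hT T (self_mem_Icc hT) (P1.smulSmooth hχ ξ)) =
      P.projMinus M.C (χ T • P.projMinus Cr (P1.eval hT T (self_mem_Icc hT) ξ) : P.halfMinus Cr) := by
    rw [P1.eval_smulSmooth, Submodule.coe_smul, map_smul, map_smul,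
      smul_projMinus_projMinus hr fun h => hCr (hχU _ h)]
  refine (M.equiv_apply _).trans ?_
  rw [augOp_apply, cutoffData_apply, transfer_apply, mk_add_inl]
  exact Prod.ext h1 (Prod.ext h2 h3)

/-- The identity behind the right parametrix: the model solution, cut off, solves the given problem
with cut-off data up to order zero. The sign of `M.K` is reversed, since the comparison now goes
from the model to the given path. -/
theorem augOp_smulSmooth (g : P.P0 T × P.halfPlus Cl × P.halfMinus Cr) :
    P.augOp hT hA Cl Cr (P1.smulSmooth hχ (M.equiv.symm (M.transfer Cl Cr g))) =
      cutoffData hχ Cl Cr g + ContinuousLinearMap.inl ℝ _ _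
        (cutoffError hχ (-M.K) (M.equiv.symm (M.transfer Cl Cr g))) := by
  set η := M.equiv.symm (M.transfer Cl Cr g) with hη
  have h1 : M.equiv η = M.transfer Cl Cr g := M.equiv.apply_symm_apply _
  rw [equiv_apply, transfer_apply, Prod.mk.injEq, Prod.mk.injEq] at h1
  obtain ⟨h1, h2, h3⟩ := h1
  rw [augOp_apply, cutoffData_apply, mk_add_inl,
    opD_cutoff M.continuousOn hA hχ (K := -M.K) fun s hs hz => by
      rw [M.eqOn s hs (hχU s hz), ContinuousLinearMap.neg_comp, add_neg_cancel_right],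
    P1.eval_smulSmooth, P1.eval_smulSmooth, h1, map_smul, map_smul,
    smul_projPlus_of_eq hl (fun h => hCl (hχU _ h)) h2,
    smul_projMinus_of_eq hr (fun h => hCr (hχU _ h)) h3]

end LocalModel

theorem sum_smulOp {E : Type*} [NormedAddCommGroup E] [InnerProductSpace ℝ E] [CompleteSpace E]
    {n : Type*} [Fintype n] {χ : n → ℝ → ℝ} (hχ : ∀ i, Continuous (χ i))
    (hsum : ∀ t ∈ Icc (-T) T, ∑ i, χ i t = 1) (u : Lp E 2 (volume.restrict (Icc (-T) T))) :
    ∑ i, smulOp (hχ i) u = u := by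
  have h : ∀ s : Finset n, (⇑(∑ i ∈ s, smulOp (hχ i) u) : ℝ → E) =ᵐ[volume.restrict (Icc (-T) T)]
      fun t => (∑ i ∈ s, χ i t) • u t := by
    intro s
    induction s using Finset.cons_induction with
    | empty =>
      filter_upwards [Lp.coeFn_zero E 2 (volume.restrict (Icc (-T) T))] with t ht
      rw [Finset.sum_empty, Finset.sum_empty, ht, zero_smul, Pi.zero_apply]
    | cons i s hi ih =>
      rw [Finset.sum_cons]
      filter_upwards [Lp.coeFn_add (smulOp (hχ i) u) (∑ i ∈ s, smulOp (hχ i) u), ih,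
        coeFn_smulOp (hχ i) u] with t h1 h2 h3
      rw [h1, Pi.add_apply, h2, h3, Finset.sum_cons, add_smul]
  refine Lp.ext ?_
  filter_upwards [h Finset.univ, ae_restrict_mem measurableSet_Icc] with t h1 ht
  rw [h1, hsum t ht, one_smul]

/-- The norm of P₁ also involves the derivative, but a weak derivative is determined by the path, by
the fundamental lemma of the calculus of variations. -/
theorem P1.ext {ξ η : P.P1 T} (h : P1.val ξ = P1.val η) : ξ = η := by
  have hv : P1.val (ξ - η) = 0 := by rw [map_sub, h, sub_self]
  have hd : P1.der (ξ - η) = 0 := by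
    have h1 := isOpen_Ioo.ae_eq_zero_of_integral_contDiff_smul_eq_zero (μ := volume)
      ((P1.integrableOn_der (ξ - η)).mono_set Ioo_subset_Icc_self).locallyIntegrableOn
      fun φ hφ hφc hφs => by
        have h2 := P1.isWeakDeriv (ξ - η) φ ⟨hφ, hφc, hφs⟩
        have h3 : ∫ s in Icc (-T) T, deriv φ s • P.incl (P1.val (ξ - η) s) = 0 := by
          refine (integral_congr_ae ?_).trans (integral_zero _ _)
          filter_upwards [Lp.coeFn_zero H₁ 2 (volume.restrict (Icc (-T) T))] with s hs
          rw [hv, hs, Pi.zero_apply, map_zero, smul_zero]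
        rw [h3, zero_eq_neg] at h2
        rw [← setIntegral_eq_integral_of_forall_compl_eq_zero (s := Icc (-T) T), h2]
        intro s hs
        rw [image_eq_zero_of_notMem_tsupport fun h' => hs (Ioo_subset_Icc_self (hφs h')), zero_smul]
    refine Lp.ext ?_
    filter_upwards [ae_restrict_of_ae h1, ae_restrict_mem measurableSet_Icc, Measure.ae_ne _ (-T),
      Measure.ae_ne _ T, Lp.coeFn_zero H₀ 2 (volume.restrict (Icc (-T) T))]
      with s hs hsI hs1 hs2 h0
    rw [hs ⟨lt_of_le_of_ne hsI.1 hs1.symm, lt_of_le_of_ne hsI.2 hs2⟩, h0, Pi.zero_apply]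
  have h1 := P1.norm_sq (ξ - η)
  rw [hv, hd, norm_zero, norm_zero] at h1
  refine sub_eq_zero.1 (norm_eq_zero.1 (pow_eq_zero_iff two_ne_zero |>.1 ?_))
  rw [h1]; norm_num

theorem P1.sum_smulSmooth {n : Type*} [Fintype n] {χ : n → ℝ → ℝ} (hχ : ∀ i, ContDiff ℝ ∞ (χ i))
    (hsum : ∀ t ∈ Icc (-T) T, ∑ i, χ i t = 1) (ξ : P.P1 T) :
    ∑ i, P1.smulSmooth (hχ i) ξ = ξ := by
  refine P1.ext ?_
  rw [map_sum]
  simp only [P1.val_smulSmooth]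
  exact sum_smulOp (fun i => (hχ i).continuous) hsum _

theorem LocalModel.sum_cutoffData (hT : 0 < T) {n : Type*} [Fintype n] {χ : n → ℝ → ℝ}
    (hχ : ∀ i, ContDiff ℝ ∞ (χ i)) (hsum : ∀ t ∈ Icc (-T) T, ∑ i, χ i t = 1)
    (Cl Cr : H₁ →L[ℝ] H₀) (g : P.P0 T × P.halfPlus Cl × P.halfMinus Cr) :
    ∑ i, cutoffData (hχ i) Cl Cr g = g := by
  refine Prod.ext ?_ (Prod.ext ?_ ?_)
  · rw [Prod.fst_sum]
    exact sum_smulOp (fun i => (hχ i).continuous) hsum _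
  · rw [Prod.snd_sum, Prod.fst_sum]
    change ∑ i, χ i (-T) • g.2.1 = _
    rw [← Finset.sum_smul, hsum _ (neg_mem_Icc hT), one_smul]
  · rw [Prod.snd_sum, Prod.snd_sum]
    change ∑ i, χ i T • g.2.2 = _
    rw [← Finset.sum_smul, hsum _ (self_mem_Icc hT), one_smul]

/-- The product of P₀ with the two boundary spaces is isomorphic to the complete space P₁, so its
factors are complete. -/
theorem completeSpace_half (hT : 0 < T) {C : H₁ →L[ℝ] H₀} (hs : P.IsSymmetrizable C)
    (hC : Function.Bijective C) : CompleteSpace (P.halfPlus C) ∧ CompleteSpace (P.halfMinus C) := by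
  obtain ⟨Φ, -⟩ := exists_augOp_const_equiv hT hs hC
  have hc := P1.completeSpace (P := P) hT
  have h1 : CompleteSpace (P.P0 T × P.halfPlus C × P.halfMinus C) :=
    (completeSpace_congr (e := Φ.toEquiv) Φ.isUniformEmbedding).1 hc
  have h2 : CompleteSpace (P.halfPlus C × P.halfMinus C) := .snd_of_prod (α := P.P0 T)
  exact ⟨.fst_of_prod (β := P.halfMinus C), .snd_of_prod (α := P.halfPlus C)⟩

/-- An augmented operator is Fredholm if it is covered by finitely many local models. -/
theorem isFredholm_augOp_of_localModels {hT : 0 < T} {A : ℝ → H₁ →L[ℝ] H₀}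
    (hA : ContinuousOn A (Icc (-T) T)) {Cl Cr : H₁ →L[ℝ] H₀}
    (hl : Submodule.IsTopCompl (P.halfPlus Cl) (P.halfMinus Cl))
    (hr : Submodule.IsTopCompl (P.halfPlus Cr) (P.halfMinus Cr))
    [CompleteSpace (P.halfPlus Cl)] [CompleteSpace (P.halfMinus Cr)] {n : Type*} [Fintype n]
    {U : n → Set ℝ} (hU : ∀ i, IsOpen (U i)) (hsub : Icc (-T) T ⊆ ⋃ i, U i)
    (M : ∀ i, P.LocalModel hT A (U i)) (hCl : ∀ i, -T ∈ U i → (M i).C = Cl)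
    (hCr : ∀ i, T ∈ U i → (M i).C = Cr) : (P.augOp hT hA Cl Cr).IsFredholm := by
  obtain ⟨χ, hχ, hχU, hsum⟩ := exists_smooth_partition isClosed_Icc hU hsub
  have hc := P1.completeSpace (P := P) hT
  let inl' : ∀ i, P.P0 T →L[ℝ] P.P0 T × P.halfPlus (M i).C × P.halfMinus (M i).C :=
    fun i => ContinuousLinearMap.inl ℝ _ _
  let inl₀ : P.P0 T →L[ℝ] P.P0 T × P.halfPlus Cl × P.halfMinus Cr := ContinuousLinearMap.inl ℝ _ _
  let Q : ∀ i, P.P0 T × P.halfPlus Cl × P.halfMinus Cr →L[ℝ] P.P1 T := fun i =>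
    ((M i).equiv.symm : _ →L[ℝ] P.P1 T) ∘L (M i).transfer Cl Cr
  -- The left parametrix cuts off the data before solving the local models, the right one cuts off
  -- the solutions afterwards.
  let L : P.P0 T × P.halfPlus Cl × P.halfMinus Cr →L[ℝ] P.P1 T :=
    ∑ i, Q i ∘L LocalModel.cutoffData (hχ i) Cl Cr
  let R : P.P0 T × P.halfPlus Cl × P.halfMinus Cr →L[ℝ] P.P1 T :=
    ∑ i, P1.smulSmooth (hχ i) ∘L Q i
  let k : P.P1 T →L[ℝ] P.P1 T := ∑ i,
    (((M i).equiv.symm : _ →L[ℝ] P.P1 T) ∘L inl' i) ∘L cutoffError (hχ i) (M i).K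
  let k' : P.P0 T × P.halfPlus Cl × P.halfMinus Cr →L[ℝ] P.P0 T × P.halfPlus Cl × P.halfMinus Cr :=
    ∑ i, (-inl₀) ∘L cutoffError (hχ i) (-(M i).K) ∘L Q i
  have hLD : ∀ ξ, L (P.augOp hT hA Cl Cr ξ) = ξ - k ξ := fun ξ => by
    rw [eq_sub_iff_add_eq]
    simp only [L, k, _root_.sum_apply, ContinuousLinearMap.comp_apply]
    rw [← Finset.sum_add_distrib]
    refine Eq.trans (Finset.sum_congr rfl fun i _ => ?_) (P1.sum_smulSmooth hχ hsum ξ)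
    have h := (M i).equiv_smulSmooth hA hl hr (hχ i) (hχU i) (hCl i) (hCr i) ξ
    have h' := (M i).equiv.symm_apply_eq.2 h.symm
    rw [map_add] at h'
    exact h'
  have hDR : ∀ g, P.augOp hT hA Cl Cr (R g) = g - k' g := fun g => by
    rw [eq_sub_iff_add_eq]
    simp only [R, k', _root_.sum_apply, ContinuousLinearMap.comp_apply, map_sum]
    rw [← Finset.sum_add_distrib]
    refine Eq.trans (Finset.sum_congr rfl fun i _ => ?_) (LocalModel.sum_cutoffData hT hχ hsum Cl Cr g)
    have h := (M i).augOp_smulSmooth hA hl hr (hχ i) (hχU i) (hCl i) (hCr i) g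
    rw [_root_.neg_apply, ← sub_eq_add_neg, sub_eq_iff_eq_add]
    exact h
  exact isFredholm_of_parametrix (L := L) (R := R) (k := k) (k' := k')
    (ContinuousLinearMap.ext hLD) (ContinuousLinearMap.ext hDR)
    (.sum _ fun i _ => (isFiniteRankLimit_cutoffError hT (hχ i) _).clm_comp _)
    (.sum _ fun i _ => ((isFiniteRankLimit_cutoffError hT (hχ i) _).comp_clm _).clm_comp _)

end HilbertPair
end
-- Fredholm property for paths of Hessians
noncomputable section

/-- The functionals map `W` isomorphically to the coordinate space: biorthogonality gives
surjectivity, the last assumption injectivity. -/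
theorem finrank_eq_of_dual_family {V n : Type*} [AddCommGroup V] [Module ℝ V] [Fintype n]
    (W : Submodule ℝ V) (L : n → V →ₗ[ℝ] ℝ) (w : n → V) (hw : ∀ i, w i ∈ W)
    (h1 : ∀ i, L i (w i) = 1) (h0 : ∀ i j, i ≠ j → L i (w j) = 0)
    (hW : ∀ x ∈ W, (∀ i, L i x = 0) → x = 0) :
    FiniteDimensional ℝ W ∧ Module.finrank ℝ W = Fintype.card n := by
  classical
  let e : W ≃ₗ[ℝ] n → ℝ := LinearEquiv.ofBijective ((LinearMap.pi L) ∘ₗ W.subtype)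
    ⟨(injective_iff_map_eq_zero _).2 fun x hx => Subtype.ext (hW x x.2 fun i => congrFun hx i),
      fun c => ⟨∑ j, c j • ⟨w j, hw j⟩, by
        funext i
        change L i (W.subtype (∑ j, c j • (⟨w j, hw j⟩ : W))) = c i
        simp only [map_sum, map_smul]
        rw [Finset.sum_eq_single i]
        · change c i • L i (w i) = c i
          rw [h1, smul_eq_mul, mul_one]
        · intro j _ hj
          change c j • L i (w j) = 0
          rw [h0 i j hj.symm, smul_zero]
        · exact fun h => absurd (Finset.mem_univ i) h⟩⟩
  exact ⟨Module.Finite.equiv e.symm, by rw [e.finrank_eq, Module.finrank_fintype_fun_eq_card]⟩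

section Middle

variable {E F F' G : Type*} [NormedAddCommGroup E] [NormedSpace ℝ E] [NormedAddCommGroup F]
  [NormedSpace ℝ F] [NormedAddCommGroup F'] [NormedSpace ℝ F'] [NormedAddCommGroup G]
  [NormedSpace ℝ G]

/-- The kernel of a map acting on the middle factor of a triple product. -/
def kerPlusEquiv (p : F →L[ℝ] F') : LinearMap.ker ((ContinuousLinearMap.id ℝ E).prodMap
    (p.prodMap (ContinuousLinearMap.id ℝ G))).toLinearMap ≃ₗ[ℝ] LinearMap.ker p.toLinearMap where
  toFun x := ⟨x.1.2.1, congrArg (fun z : E × F' × G => z.2.1) x.2⟩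
  map_add' _ _ := rfl
  map_smul' _ _ := rfl
  invFun y := ⟨(0, y.1, 0), Prod.ext rfl (Prod.ext y.2 rfl)⟩
  left_inv x := Subtype.ext (Prod.ext (congrArg (fun z : E × F' × G => z.1) x.2).symm
    (Prod.ext rfl (congrArg (fun z : E × F' × G => z.2.2) x.2).symm))
  right_inv _ := rfl

/-- The kernel of a map acting on the last factor of a triple product. -/
def kerMinusEquiv (p : F →L[ℝ] F') : LinearMap.ker ((ContinuousLinearMap.id ℝ E).prodMap
    ((ContinuousLinearMap.id ℝ G).prodMap p)).toLinearMap ≃ₗ[ℝ] LinearMap.ker p.toLinearMap where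
  toFun x := ⟨x.1.2.2, congrArg (fun z : E × G × F' => z.2.2) x.2⟩
  map_add' _ _ := rfl
  map_smul' _ _ := rfl
  invFun y := ⟨(0, 0, y.1), Prod.ext rfl (Prod.ext rfl y.2)⟩
  left_inv x := Subtype.ext (Prod.ext (congrArg (fun z : E × G × F' => z.1) x.2).symm
    (Prod.ext (congrArg (fun z : E × G × F' => z.2.1) x.2).symm rfl))
  right_inv _ := rfl

end Middle

namespace HilbertPair

variable {H₀ H₁ : Type*} [NormedAddCommGroup H₀] [InnerProductSpace ℝ H₀] [CompleteSpace H₀]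
  [NormedAddCommGroup H₁] [InnerProductSpace ℝ H₁] [CompleteSpace H₁] {P : HilbertPair H₀ H₁}
  {T : ℝ}

theorem isTopCompl_of_mem_resolventSet {A : H₁ →L[ℝ] H₀} (hA : P.IsSymmetrizable A) {r : ℝ}
    (hr : r ∈ P.resolventSet A) :
    Submodule.IsTopCompl (P.halfPlus (P.shift A r)) (P.halfMinus (P.shift A r)) := by
  obtain ⟨S⟩ := exists_eigenSystem hA (resolventSet_bijective hr)
  exact S.isTopCompl (resolventSet_bijective hr)

/-- The radius `ε` is used to keep the neighbourhood away from end points where the model has the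
wrong boundary projections. -/
theorem exists_localModel (hT : 0 < T) {A : ℝ → H₁ →L[ℝ] H₀} (hA : ContinuousOn A (Icc (-T) T))
    {s₀ : ℝ} (hs₀ : s₀ ∈ Icc (-T) T) {K : H₀ →L[ℝ] H₀} {C : H₁ →L[ℝ] H₀}
    (hCK : C = A s₀ + K ∘L P.incl) (hs : P.IsSymmetrizable C) (hC : Function.Bijective C)
    {ε : ℝ} (hε : 0 < ε) :
    ∃ U : Set ℝ, IsOpen U ∧ s₀ ∈ U ∧ (∀ s ∈ U, |s - s₀| < ε) ∧
      ∃ M : P.LocalModel hT A U, M.C = C := by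
  obtain ⟨δ, hδ, B, hB, hAB, Φ, hΦ⟩ := exists_local_model hT hA hs₀ hCK hs hC
  refine ⟨Metric.ball s₀ (min δ ε), Metric.isOpen_ball, Metric.mem_ball_self (lt_min hδ hε),
    fun s hs => ?_, ⟨⟨C, K, B, hB, fun s hs hsU => hAB s hs ?_, Φ, hΦ⟩, rfl⟩⟩
  · rw [Metric.mem_ball, Real.dist_eq] at hs
    exact hs.trans_le (min_le_right _ _)
  · rw [Metric.mem_ball, Real.dist_eq] at hsU
    exact (hsU.trans_le (min_le_left _ _)).le

theorem shift_eq_add (A : H₁ →L[ℝ] H₀) (r : ℝ) :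
    P.shift A r = A + (-r • ContinuousLinearMap.id ℝ H₀) ∘L P.incl := by
  ext x
  simp [shift, sub_eq_add_neg]

/-- The augmented operators of a path of Hessians are Fredholm. -/
theorem isFredholm_augOp (hT : 0 < T) {A : ℝ → H₁ →L[ℝ] H₀} (hA : P.IsHessianPath T A) {l r : ℝ}
    (hl : l ∈ P.resolventSet (A (-T))) (hr : r ∈ P.resolventSet (A T)) :
    (P.augOp hT hA.continuousOn (P.shift (A (-T)) l) (P.shift (A T) r)).IsFredholm := by
  have hsl := (hA.isHessian _ (neg_mem_Icc hT)).symmetrizable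
  have hsr := (hA.isHessian _ (self_mem_Icc hT)).symmetrizable
  have hbl := resolventSet_bijective hl
  have hbr := resolventSet_bijective hr
  -- At the ends the model must be the prescribed shift of `A`, so that the boundary projections
  -- match; radius `T` excludes the opposite end. At an inner time any invertible symmetrizable
  -- perturbation will do, on a neighbourhood containing neither end.
  have hex : ∀ s : Icc (-T) T, ∃ U : Set ℝ, IsOpen U ∧ (s : ℝ) ∈ U ∧
      ∃ M : P.LocalModel hT A U, (-T ∈ U → M.C = P.shift (A (-T)) l) ∧
        (T ∈ U → M.C = P.shift (A T) r) := by
    rintro ⟨s, hs⟩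
    by_cases h1 : s = -T
    · subst h1
      obtain ⟨U, hU, hsU, hUε, M, hM⟩ := exists_localModel hT hA.continuousOn hs
        (shift_eq_add _ _) (hsl.shift l) hbl hT
      refine ⟨U, hU, hsU, M, fun _ => hM, fun h => ?_⟩
      have := hUε _ h
      rw [abs_lt] at this
      linarith
    by_cases h2 : s = T
    · subst h2
      obtain ⟨U, hU, hsU, hUε, M, hM⟩ := exists_localModel hT hA.continuousOn hs
        (shift_eq_add _ _) (hsr.shift r) hbr hT
      refine ⟨U, hU, hsU, M, fun h => ?_, fun _ => hM⟩
      have := hUε _ h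
      rw [abs_lt] at this
      linarith
    · obtain ⟨K, hK, hKb⟩ := (hA.isHessian s hs).exists_perturbation
      have h3 : 0 < min (s + T) (T - s) := lt_min
        (by linarith [lt_of_le_of_ne hs.1 (Ne.symm h1)]) (sub_pos.2 (lt_of_le_of_ne hs.2 h2))
      obtain ⟨U, hU, hsU, hUε, M, hM⟩ := exists_localModel hT hA.continuousOn hs rfl hK hKb h3
      refine ⟨U, hU, hsU, M, fun h => ?_, fun h => ?_⟩
      · have := (hUε _ h).trans_le (min_le_left _ _)
        rw [abs_lt] at this
        linarith
      · have := (hUε _ h).trans_le (min_le_right _ _)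
        rw [abs_lt] at this
        linarith
  choose U hU hsU M hMl hMr using hex
  obtain ⟨t, ht⟩ := isCompact_Icc.elim_finite_subcover U hU
    fun s hs => mem_iUnion.2 ⟨⟨s, hs⟩, hsU ⟨s, hs⟩⟩
  have := (completeSpace_half hT (hsl.shift l) hbl).1
  have := (completeSpace_half hT (hsr.shift r) hbr).2
  refine isFredholm_augOp_of_localModels hA.continuousOn (isTopCompl_of_mem_resolventSet hsl hl)
    (isTopCompl_of_mem_resolventSet hsr hr) (n := t) (U := fun i => U i) (fun i => hU i) ?_
    (fun i => M i) (fun i => hMl i) fun i => hMr i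
  rw [iUnion_subtype]
  exact ht

/-! ### Eigenvalues between two shifts and the spectral subspaces -/

namespace EigenSystem

variable {A : H₁ →L[ℝ] H₀} (S : P.EigenSystem A)

/-- The modes with eigenvalue in `(l, m)`. -/
def window (l m : ℝ) : Finset S.idx :=
  ((S.finite (max |l| |m|)).subset fun i (hi : l < S.a i ∧ S.a i < m) =>
    abs_le_max_abs_abs hi.1.le hi.2.le).toFinset

theorem mem_window {l m : ℝ} {i : S.idx} : i ∈ S.window l m ↔ l < S.a i ∧ S.a i < m :=
  Set.Finite.mem_toFinset _

open Classical in
theorem finrank_ker_shift {l m a : ℝ} (ha : a ∈ Ioo l m) :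
    Module.finrank ℝ (LinearMap.ker (P.shift A a).toLinearMap) =
      ((S.window l m).filter fun i => S.a i = a).card := by
  rw [← Fintype.card_coe]
  refine (finrank_eq_of_dual_family _
    (n := ((S.window l m).filter fun i => S.a i = a)) (fun i => (S.coef i ∘L P.incl).toLinearMap)
    (fun i => S.v i) (fun i => ?_) (fun i => S.coef_self i)
    (fun i j hij => S.coef_ne i j fun h => hij (Subtype.ext h)) fun x hx h0 => ?_).2
  · change P.shift A a (S.v i) = 0
    rw [S.shift_v, (Finset.mem_filter.1 i.2).2, sub_self, zero_smul]
  · have hx' : P.shift A a x = 0 := hx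
    refine P.incl_injective ?_
    rw [map_zero]
    refine S.eq_zero_of_coef fun i => ?_
    by_cases hi : S.a i = a
    · exact h0 ⟨i, Finset.mem_filter.2 ⟨S.mem_window.2 (hi ▸ ha), hi⟩⟩
    · have h1 := S.coef_shift a i x
      rw [hx', map_zero, zero_eq_mul] at h1
      exact h1.resolve_left (sub_ne_zero.2 hi)

/-- The finitely many modes of the window are grouped by eigenvalue; each group is a basis of the
corresponding kernel. Other points contribute nothing, so the sum has finite support. -/
theorem eigenvalueCount_eq (l m : ℝ) : P.eigenvalueCount A l m = (S.window l m).card := by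
  classical
  rw [eigenvalueCount, finsum_mem_eq_sum_of_inter_support_eq (t := (S.window l m).image S.a),
    Finset.card_eq_sum_card_image S.a (S.window l m)]
  · refine Finset.sum_congr rfl fun a ha => ?_
    obtain ⟨i, hi, rfl⟩ := Finset.mem_image.1 ha
    exact S.finrank_ker_shift (S.mem_window.1 hi)
  · ext a
    simp only [mem_inter_iff, Function.mem_support, Finset.coe_image, and_congr_left_iff]
    intro hne
    constructor
    · rintro ⟨-, ha⟩
      rw [S.finrank_ker_shift ha, Finset.card_ne_zero] at hne
      obtain ⟨i, hi⟩ := hne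
      rw [Finset.mem_filter] at hi
      exact ⟨i, hi.1, hi.2⟩
    · rintro ⟨i, hi, rfl⟩
      refine ⟨fun hb => S.a_ne hb i rfl, S.mem_window.1 hi⟩

variable {l m : ℝ} (hl : Function.Bijective (P.shift A l)) (hm : Function.Bijective (P.shift A m))
  (hlm : l ≤ m)
include hl hm

theorem eq_zero_of_mem_of_window {x : P.Half} (h1 : x ∈ P.halfPlus (P.shift A l))
    (h2 : x ∈ P.halfMinus (P.shift A m)) (h : ∀ i ∈ S.window l m, S.coefHalf i x = 0) : x = 0 := by
  refine S.half_ext fun i => ?_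
  rw [map_zero]
  rcases lt_or_gt_of_ne (S.a_ne hl i) with hi | hi
  · exact S.coefHalf_of_mem_halfPlus h1 hi.le
  rcases lt_or_gt_of_ne (S.a_ne hm i) with hi' | hi'
  · exact h i (S.mem_window.2 ⟨hi, hi'⟩)
  · exact S.coefHalf_of_mem_halfMinus h2 hi'.le

/-- The kernel is the intersection of H⁺ for the shift `l` with H⁻ for the shift `m`. Its elements
have coordinates only in the window, and the window modes lie in it. -/
theorem finrank_ker_projPlus :
    FiniteDimensional ℝ (LinearMap.ker
      (P.projPlus (P.shift A m) ∘L (P.halfPlus (P.shift A l)).subtypeL).toLinearMap) ∧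
    Module.finrank ℝ (LinearMap.ker
      (P.projPlus (P.shift A m) ∘L (P.halfPlus (P.shift A l)).subtypeL).toLinearMap) =
      (S.window l m).card := by
  rw [← Fintype.card_coe]
  refine finrank_eq_of_dual_family _ (n := S.window l m)
    (fun i => (S.coefHalf i ∘L (P.halfPlus (P.shift A l)).subtypeL).toLinearMap)
    (fun i => ⟨P.toHalf (S.v i), S.toHalf_v_mem_halfPlus (S.mem_window.1 i.2).1⟩) (fun i => ?_)
    (fun i => S.coefHalf_self i) (fun i j hij => S.coefHalf_ne fun h => hij (Subtype.ext h))
    fun x hx h0 => ?_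
  · exact projPlus_of_mem_minus (S.isTopCompl hm)
      (S.toHalf_v_mem_halfMinus (S.mem_window.1 i.2).2)
  · refine Subtype.ext (S.eq_zero_of_mem_of_window hl hm x.2 ?_ fun i hi => h0 ⟨i, hi⟩)
    exact (projPlus_eq_zero_iff (S.isTopCompl hm)).1 hx

theorem finrank_ker_projMinus :
    FiniteDimensional ℝ (LinearMap.ker
      (P.projMinus (P.shift A l) ∘L (P.halfMinus (P.shift A m)).subtypeL).toLinearMap) ∧
    Module.finrank ℝ (LinearMap.ker
      (P.projMinus (P.shift A l) ∘L (P.halfMinus (P.shift A m)).subtypeL).toLinearMap) =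
      (S.window l m).card := by
  rw [← Fintype.card_coe]
  refine finrank_eq_of_dual_family _ (n := S.window l m)
    (fun i => (S.coefHalf i ∘L (P.halfMinus (P.shift A m)).subtypeL).toLinearMap)
    (fun i => ⟨P.toHalf (S.v i), S.toHalf_v_mem_halfMinus (S.mem_window.1 i.2).2⟩) (fun i => ?_)
    (fun i => S.coefHalf_self i) (fun i j hij => S.coefHalf_ne fun h => hij (Subtype.ext h))
    fun x hx h0 => ?_
  · exact projMinus_of_mem_plus (S.isTopCompl hl)
      (S.toHalf_v_mem_halfPlus (S.mem_window.1 i.2).1)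
  · refine Subtype.ext (S.eq_zero_of_mem_of_window hl hm ?_ x.2 fun i hi => h0 ⟨i, hi⟩)
    exact (projMinus_eq_zero_iff (S.isTopCompl hl)).1 hx

include S hlm

theorem halfPlus_le : P.halfPlus (P.shift A m) ≤ P.halfPlus (P.shift A l) := fun _ hx =>
  (S.mem_halfPlus_iff hl).2 fun i hi => (S.mem_halfPlus_iff hm).1 hx i (hi.trans_le hlm)

theorem halfMinus_le : P.halfMinus (P.shift A l) ≤ P.halfMinus (P.shift A m) := fun _ hx =>
  (S.mem_halfMinus_iff hm).2 fun i hi => (S.mem_halfMinus_iff hl).1 hx i (hlm.trans_lt hi)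

/-- The part removed by the inner projection lies in H⁻ for the shift `l`, hence in the larger H⁻
for `m`, which the outer projection annihilates. -/
theorem projPlus_projPlus (z : P.Half) :
    P.projPlus (P.shift A m) (P.projPlus (P.shift A l) z : P.Half) = P.projPlus (P.shift A m) z := by
  have h := (projPlus_eq_zero_iff (S.isTopCompl hm)).2
    (S.halfMinus_le hl hm hlm (sub_projPlus_mem (S.isTopCompl hl) z))
  rw [map_sub, sub_eq_zero] at h
  exact h.symm

theorem projMinus_projMinus (z : P.Half) :
    P.projMinus (P.shift A l) (P.projMinus (P.shift A m) z : P.Half) =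
      P.projMinus (P.shift A l) z := by
  have h := (projMinus_eq_zero_iff (S.isTopCompl hl)).2
    (S.halfPlus_le hl hm hlm (sub_projMinus_mem (S.isTopCompl hm) z))
  rw [map_sub, sub_eq_zero] at h
  exact h.symm

theorem surjective_projPlus : Function.Surjective
    (P.projPlus (P.shift A m) ∘L (P.halfPlus (P.shift A l)).subtypeL) := fun x =>
  ⟨⟨x, S.halfPlus_le hl hm hlm x.2⟩, Subtype.ext (projPlus_of_mem_plus (S.isTopCompl hm) x.2)⟩

theorem surjective_projMinus : Function.Surjective
    (P.projMinus (P.shift A l) ∘L (P.halfMinus (P.shift A m)).subtypeL) := fun x =>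
  ⟨⟨x, S.halfMinus_le hl hm hlm x.2⟩, Subtype.ext (projMinus_of_mem_minus (S.isTopCompl hl) x.2)⟩

end EigenSystem

/-- Moving the left shift. -/
theorem fredholmIndex_augOp_left (hT : 0 < T) {A : ℝ → H₁ →L[ℝ] H₀}
    (hA : ContinuousOn A (Icc (-T) T)) {A₀ Cr : H₁ →L[ℝ] H₀} (hs : P.IsSymmetrizable A₀) {l m : ℝ}
    (hl : l ∈ P.resolventSet A₀) (hm : m ∈ P.resolventSet A₀) (hlm : l ≤ m)
    (hF : (P.augOp hT hA (P.shift A₀ l) Cr).IsFredholm) :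
    fredholmIndex (P.augOp hT hA (P.shift A₀ m) Cr) =
      fredholmIndex (P.augOp hT hA (P.shift A₀ l) Cr) + P.eigenvalueCount A₀ l m := by
  have hbl := resolventSet_bijective hl
  have hbm := resolventSet_bijective hm
  obtain ⟨S⟩ := exists_eigenSystem hs hbl
  let p := P.projPlus (P.shift A₀ m) ∘L (P.halfPlus (P.shift A₀ l)).subtypeL
  let q := (ContinuousLinearMap.id ℝ (P.P0 T)).prodMap
    (p.prodMap (ContinuousLinearMap.id ℝ (P.halfMinus Cr)))
  obtain ⟨hfin, hrank⟩ := S.finrank_ker_projPlus hbl hbm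
  -- H⁺ shrinks as the shift increases, so the operator for `m` factors through the one for `l`.
  have hq : P.augOp hT hA (P.shift A₀ m) Cr = q ∘L P.augOp hT hA (P.shift A₀ l) Cr :=
    ContinuousLinearMap.ext fun ξ => Prod.ext rfl
      (Prod.ext (S.projPlus_projPlus hbl hbm hlm _).symm rfl)
  have hqs : Function.Surjective q := fun ⟨f, x, y⟩ => by
    obtain ⟨z, rfl⟩ := S.surjective_projPlus hbl hbm hlm x
    exact ⟨(f, z, y), rfl⟩
  have : FiniteDimensional ℝ (LinearMap.ker q.toLinearMap) :=
    Module.Finite.equiv (kerPlusEquiv (E := P.P0 T) (G := P.halfMinus Cr) p).symm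
  rw [hq, fredholmIndex_comp_of_surjective hF hqs, S.eigenvalueCount_eq, ← hrank]
  congr 2
  exact (kerPlusEquiv (E := P.P0 T) (G := P.halfMinus Cr) p).finrank_eq

/-- Moving the right shift. -/
theorem fredholmIndex_augOp_right (hT : 0 < T) {A : ℝ → H₁ →L[ℝ] H₀}
    (hA : ContinuousOn A (Icc (-T) T)) {A₀ Cl : H₁ →L[ℝ] H₀} (hs : P.IsSymmetrizable A₀) {l m : ℝ}
    (hl : l ∈ P.resolventSet A₀) (hm : m ∈ P.resolventSet A₀) (hlm : l ≤ m)
    (hF : (P.augOp hT hA Cl (P.shift A₀ m)).IsFredholm) :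
    fredholmIndex (P.augOp hT hA Cl (P.shift A₀ l)) =
      fredholmIndex (P.augOp hT hA Cl (P.shift A₀ m)) + P.eigenvalueCount A₀ l m := by
  have hbl := resolventSet_bijective hl
  have hbm := resolventSet_bijective hm
  obtain ⟨S⟩ := exists_eigenSystem hs hbl
  let p := P.projMinus (P.shift A₀ l) ∘L (P.halfMinus (P.shift A₀ m)).subtypeL
  let q := (ContinuousLinearMap.id ℝ (P.P0 T)).prodMap
    ((ContinuousLinearMap.id ℝ (P.halfPlus Cl)).prodMap p)
  obtain ⟨hfin, hrank⟩ := S.finrank_ker_projMinus hbl hbm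
  -- H⁻ grows with the shift, so here the operator for `l` factors through the one for `m`; hence
  -- the opposite sign.
  have hq : P.augOp hT hA Cl (P.shift A₀ l) = q ∘L P.augOp hT hA Cl (P.shift A₀ m) :=
    ContinuousLinearMap.ext fun ξ => Prod.ext rfl
      (Prod.ext rfl (S.projMinus_projMinus hbl hbm hlm _).symm)
  have hqs : Function.Surjective q := fun ⟨f, x, y⟩ => by
    obtain ⟨z, rfl⟩ := S.surjective_projMinus hbl hbm hlm y
    exact ⟨(f, x, z), rfl⟩
  have : FiniteDimensional ℝ (LinearMap.ker q.toLinearMap) :=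
    Module.Finite.equiv (kerMinusEquiv (E := P.P0 T) (G := P.halfPlus Cl) p).symm
  rw [hq, fredholmIndex_comp_of_surjective hF hqs, S.eigenvalueCount_eq, ← hrank]
  congr 2
  exact (kerMinusEquiv (E := P.P0 T) (G := P.halfPlus Cl) p).finrank_eq

/-- The index changes by the spectral content when the left shift is moved. -/
theorem fredholmIndex_augOp_sub_left (hT : 0 < T) {A : ℝ → H₁ →L[ℝ] H₀}
    (hA : ContinuousOn A (Icc (-T) T)) {A₀ Cr : H₁ →L[ℝ] H₀} (hs : P.IsSymmetrizable A₀) {l m : ℝ}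
    (hl : l ∈ P.resolventSet A₀) (hm : m ∈ P.resolventSet A₀)
    (hFl : (P.augOp hT hA (P.shift A₀ l) Cr).IsFredholm)
    (hFm : (P.augOp hT hA (P.shift A₀ m) Cr).IsFredholm) :
    fredholmIndex (P.augOp hT hA (P.shift A₀ m) Cr) -
      fredholmIndex (P.augOp hT hA (P.shift A₀ l) Cr) = P.spectralContent A₀ l m := by
  rw [spectralContent]
  split_ifs with h
  · rw [fredholmIndex_augOp_left hT hA hs hl hm h hFl]; ring
  · rw [fredholmIndex_augOp_left hT hA hs hm hl (not_le.1 h).le hFm]; ring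

/-- The index changes by minus the spectral content when the right shift is moved. -/
theorem fredholmIndex_augOp_sub_right (hT : 0 < T) {A : ℝ → H₁ →L[ℝ] H₀}
    (hA : ContinuousOn A (Icc (-T) T)) {A₀ Cl : H₁ →L[ℝ] H₀} (hs : P.IsSymmetrizable A₀) {l m : ℝ}
    (hl : l ∈ P.resolventSet A₀) (hm : m ∈ P.resolventSet A₀)
    (hFl : (P.augOp hT hA Cl (P.shift A₀ l)).IsFredholm)
    (hFm : (P.augOp hT hA Cl (P.shift A₀ m)).IsFredholm) :
    fredholmIndex (P.augOp hT hA Cl (P.shift A₀ m)) -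
      fredholmIndex (P.augOp hT hA Cl (P.shift A₀ l)) = -P.spectralContent A₀ l m := by
  rw [spectralContent]
  split_ifs with h
  · rw [fredholmIndex_augOp_right hT hA hs hl hm h hFm]; ring
  · rw [fredholmIndex_augOp_right hT hA hs hm hl (not_le.1 h).le hFl]; ring

end HilbertPair

theorem mainTheorem5 {H₀ H₁ : Type*} [NormedAddCommGroup H₀] [InnerProductSpace ℝ H₀]
    [CompleteSpace H₀] [NormedAddCommGroup H₁] [InnerProductSpace ℝ H₁] [CompleteSpace H₁]
    (P : HilbertPair H₀ H₁) (T : ℝ) (hT : 0 < T) (A : ℝ → H₁ →L[ℝ] H₀)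
    (hA : P.IsHessianPath T A) (lam mu : ℝ × ℝ)
    (hlam₁ : lam.1 ∈ P.resolventSet (A (-T))) (hlam₂ : lam.2 ∈ P.resolventSet (A T))
    (hmu₁ : mu.1 ∈ P.resolventSet (A (-T))) (hmu₂ : mu.2 ∈ P.resolventSet (A T)) :
    -- the spectral splittings `H_{1/2} = H⁺ ⊕ H⁻` at the two ends exist
    (∀ a ∈ P.resolventSet (A (-T)), Submodule.IsTopCompl
      (P.halfPlus (P.shift (A (-T)) a)) (P.halfMinus (P.shift (A (-T)) a))) ∧
    (∀ a ∈ P.resolventSet (A T), Submodule.IsTopCompl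
      (P.halfPlus (P.shift (A T) a)) (P.halfMinus (P.shift (A T) a))) ∧
    -- the shifted augmented operators are Fredholm
    (P.augmentedOp hT hA.continuousOn lam).IsFredholm ∧
    (P.augmentedOp hT hA.continuousOn mu).IsFredholm ∧
    -- the index difference
    fredholmIndex (P.augmentedOp hT hA.continuousOn mu) -
        fredholmIndex (P.augmentedOp hT hA.continuousOn lam) =
      P.spectralContent (A (-T)) lam.1 mu.1 - P.spectralContent (A T) lam.2 mu.2 := by
  have hsl := (hA.isHessian _ (neg_mem_Icc hT)).symmetrizable
  have hsr := (hA.isHessian _ (self_mem_Icc hT)).symmetrizable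
  have hF1 := HilbertPair.isFredholm_augOp hT hA hlam₁ hlam₂
  -- The intermediate pair of shifts `(mu.1, lam.2)` allows the two ends to be moved one at a time.
  have hF2 := HilbertPair.isFredholm_augOp hT hA hmu₁ hlam₂
  have hF3 := HilbertPair.isFredholm_augOp hT hA hmu₁ hmu₂
  refine ⟨fun a ha => HilbertPair.isTopCompl_of_mem_resolventSet hsl ha,
    fun a ha => HilbertPair.isTopCompl_of_mem_resolventSet hsr ha, hF1, hF3, ?_⟩
  have h1 := HilbertPair.fredholmIndex_augOp_sub_left hT hA.continuousOn hsl hlam₁ hmu₁ hF1 hF2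
  have h2 := HilbertPair.fredholmIndex_augOp_sub_right hT hA.continuousOn hsr hlam₂ hmu₂ hF2 hF3
  change fredholmIndex (P.augOp hT hA.continuousOn (P.shift (A (-T)) mu.1) (P.shift (A T) mu.2)) -
    fredholmIndex (P.augOp hT hA.continuousOn (P.shift (A (-T)) lam.1) (P.shift (A T) lam.2)) = _
  linarith

end
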